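/- Let $d\ge 1$, let $\Lambda\subset\mathbb R^d$ be a lattice of rank $d$ and let $\Omega\subset\mathbb R^d$ be a $\Lambda$-invariant set consisting of finitely many $\Lambda$-orbits. Let $D\subset\mathbb R^d$ be a simply connected domain (open set) containing $0$. For $n\ge 1$ put $\Omega_n=D\cap\Omega/n$, identified via $x\mapsto nx$ with $\Omega\cap nD$. Let each $\Omega_n$ carry a determinantal point process, with law $\mathbb P_n$ and real kernel $K_n$ (indexed by $\Omega\cap nD$), i.e. the probability that distinct sites $x_1,\dots,x_k$ all belong to the process is $\det(K_n(x_i,x_j))_{i,j}$; likewise let $\mathbb P$ be the law of a determinantal process on $\Omega$ with real kernel $K$. Assume: 1. $K_n\to K$ pointwise around every point of $D$, locally uniformly: for all $x,y\in\Omega$ and every compact $C\subset D$, $\ \sup\{|K_n(x+\lambda,y+\lambda)-K(x,y)| : \lambda\in\Lambda,\ \lambda/n\in C\}\to 0$ as $n\to\infty$ (the kernels are defined at these sites for large $n$); 2. $K_n(x,y)=O(|x-y|^{-d})$ uniformly in $n$, locally uniformly in $D$: for every compact $C\subset D$ there is $M$ such that $|K_n(x,y)|\le M|x-y|^{-d}$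 for all $n$ and all $x\ne y$ in $\Omega\cap nC$. (With 1, this gives $K(x,y)=O(|x-y|^{-d})$.) A pattern $\mathbf x=(\mathbf x_0,\mathbf x_1)$ is a pair of disjoint finite sets of sites, not both empty; it occurs if the process contains all the sites of $\mathbf x_1$ and none of $\mathbf x_0$. Its support is $\mathbf x_0\cup\mathbf x_1$, and its location $z_{\mathbf x}$ is the centre of mass of its support. Let $\mathcal P^0$ be a finite collection of patterns in $\Omega$ such that the supports of $\mathbf x$ and $\mathbf y+\lambda$ are disjoint for all $\mathbf x,\mathbf y\in\mathcal P^0$, $\lambda\in\Lambda$, unless $\mathbf x=\mathbf y$ and $\lambda=0$. Let $\mathcal P=\{\mathbf x+\lambda:\mathbf x\in\mathcal P^0,\lambda\in\Lambda\}$, and let $\mathcal P_n$ be the set of the patterns of $\mathcal P$ with support in $\Omega\cap nD$. Assume: 3. there is $c>0$ with $\mathbb P_n(\mathbf x\text{ occurs})\ge c$ for all $n\geq 1$ and all $\mathbf x\in\mathcal P_n$. For $\varphi\in C_0^\infty(D)$ let $\xi_n(\varphi)=\sum_{\mathbf x\in\mathcal P_n}\varphi(z_{\mathbf x}/n)\mathbf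 1_{\{\mathbf x\text{ occurs}\}}$. Let $\mathrm{Cov}(\mathbf x,\mathbf y)$ be the covariance under $\mathbb P$ of the indicators of the occurrence of $\mathbf x$ and $\mathbf y$. Then, for every $\mathbf x\in\mathcal P^0$, the series $\sum_{\mathbf y\in\mathcal P}\mathrm{Cov}(\mathbf x,\mathbf y)$ converges absolutely, $$I(\mathcal P^0)=\frac1{|\mathcal P^0|}\sum_{\mathbf x\in\mathcal P^0}\sum_{\mathbf y\in\mathcal P}\mathrm{Cov}(\mathbf x,\mathbf y)\ \ge 0$$ (with $I(\emptyset)=0$), and $n^{-d/2}(\xi_n-\mathbb E\xi_n)$ converges weakly to Gaussian white noise on $D$ with intensity $I(\mathcal P^0)$ relative to the limiting density $|\mathcal P^0|/\mathrm{covol}(\Lambda)$ of patterns. That is, for all $\varphi_1,\dots,\varphi_k\in C_0^\infty(D)$, the vector $\big(n^{-d/2}(\xi_n(\varphi_i)-\mathbb E\xi_n(\varphi_i))\big)_{1\le i\le k}$ converges in distribution to the centred Gaussian vector with covariances $$\frac{|\mathcal P^0|}{\mathrm{covol}(\Lambda)}\,I(\mathcal P^0)\int_D\varphi_i\varphi_j\,dz$$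 (the zero field if $I(\mathcal P^0)=0$). -/

import Mathlib

open MeasureTheory ProbabilityTheory Filter Topology
open scoped ContDiff

/-- `Ω ⊆ ℝ^d` is periodic under the lattice `Λ`: it is `Λ`-invariant and consists of finitely many
`Λ`-orbits. -/
def IsPeriodicSet {d : ℕ} (Λ : Submodule ℤ (EuclideanSpace ℝ (Fin d)))
    (Ω : Set (EuclideanSpace ℝ (Fin d))) : Prop :=
  (∀ l ∈ Λ, ∀ x ∈ Ω, x + l ∈ Ω) ∧
    ∃ F : Finset (EuclideanSpace ℝ (Fin d)), (F : Set (EuclideanSpace ℝ (Fin d))) ⊆ Ω ∧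
      ∀ x ∈ Ω, ∃ f ∈ F, ∃ l ∈ Λ, x = f + l

/-- The set `Ω ∩ nD`, that is, the set `Ω_n = D ∩ (Ω / n)` multiplied back by `n`. All the discrete
objects are written in these unscaled coordinates; macroscopic positions are `x / n ∈ D`. -/
def sites {d : ℕ} (Ω D : Set (EuclideanSpace ℝ (Fin d))) (n : ℕ+) :
    Set (EuclideanSpace ℝ (Fin d)) :=
  {x | x ∈ Ω ∧ ((n : ℝ)⁻¹) • x ∈ D}

/-- A point process on the discrete set `S` is (the law of) a random subset `T` of `S`. It is
determinantal with kernel `K` if `P(x₁, …, x_k ∈ T) = det (K(x_i, x_j))` for all distinct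
`x₁, …, x_k ∈ S`. Only the values of `K` on `S × S` matter; `K` need not be symmetric. -/
def IsDeterminantal {d : ℕ} {S : Set (EuclideanSpace ℝ (Fin d))} (μ : Measure (Set S))
    (K : EuclideanSpace ℝ (Fin d) → EuclideanSpace ℝ (Fin d) → ℝ) : Prop :=
  ∀ (k : ℕ) (x : Fin k → S), Function.Injective x →
    μ.real {T | ∀ i, x i ∈ T} = (Matrix.of fun i j => K (x i) (x j)).det

/-- A pattern: a finite non-empty set of sites, each carrying a prescribed spin `0` or `1`. -/
@[ext]
structure Pattern (d : ℕ) where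
  /-- the sites with spin `0` -/
  zeros : Finset (EuclideanSpace ℝ (Fin d))
  /-- the sites with spin `1` -/
  ones : Finset (EuclideanSpace ℝ (Fin d))
  disj : Disjoint zeros ones
  nonempty : zeros.Nonempty ∨ ones.Nonempty

namespace Pattern

/-- The support of a pattern. -/
def support {d : ℕ} (p : Pattern d) : Set (EuclideanSpace ℝ (Fin d)) :=
  (p.zeros : Set (EuclideanSpace ℝ (Fin d))) ∪ p.ones

/-- The location of a pattern: the centre of mass of its support. -/
noncomputable def location {d : ℕ} (p : Pattern d) : EuclideanSpace ℝ (Fin d) :=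
  ((p.zeros.card + p.ones.card : ℝ)⁻¹) • (∑ x ∈ p.zeros, x + ∑ x ∈ p.ones, x)

/-- The translate `p + l` of a pattern. -/
def translate {d : ℕ} (p : Pattern d) (l : EuclideanSpace ℝ (Fin d)) : Pattern d where
  zeros := p.zeros.map (addRightEmbedding l)
  ones := p.ones.map (addRightEmbedding l)
  disj := by simpa using p.disj
  nonempty := by simpa using p.nonempty

/-- The event that the pattern `p` occurs in the random subset `T` of `S`: all the sites of spin
`1` belong to `T` and all the sites of spin `0` do not. (Used for `p.support ⊆ S`.) -/
def occurs {d : ℕ} (S : Set (EuclideanSpace ℝ (Fin d))) (p : Pattern d) : Set (Set S) :=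
  {T | (p.ones : Set (EuclideanSpace ℝ (Fin d))) ⊆ Subtype.val '' T ∧
    Disjoint (p.zeros : Set (EuclideanSpace ℝ (Fin d))) (Subtype.val '' T)}

/-- `Cov(p, q) = P(p, q) - P(p) P(q)`: the covariance of the indicators of the occurrence of the
patterns `p` and `q`. -/
noncomputable def cov {d : ℕ} {S : Set (EuclideanSpace ℝ (Fin d))} (μ : Measure (Set S))
    (p q : Pattern d) : ℝ :=
  μ.real (p.occurs S ∩ q.occurs S) - μ.real (p.occurs S) * μ.real (q.occurs S)

end Pattern

/-- The periodic collection of patterns `P = Λ P⁰` generated by `P⁰`. -/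
def periodicPatterns {d : ℕ} (Λ : Submodule ℤ (EuclideanSpace ℝ (Fin d)))
    (P₀ : Finset (Pattern d)) : Set (Pattern d) :=
  {q | ∃ p ∈ P₀, ∃ l ∈ Λ, q = p.translate l}

/-- `P⁰` is a finite collection of patterns in `Ω` whose translates under `Λ` are pairwise disjoint:
`p` and `q + l` have disjoint supports unless `p = q` and `l = 0`. So `P = Λ P⁰` is a collection of
disjoint patterns and `P⁰` contains exactly one pattern of each orbit. -/
def GeneratesDisjointPatterns {d : ℕ} (Λ : Submodule ℤ (EuclideanSpace ℝ (Fin d)))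
    (Ω : Set (EuclideanSpace ℝ (Fin d))) (P₀ : Finset (Pattern d)) : Prop :=
  (∀ p ∈ P₀, p.support ⊆ Ω) ∧
    ∀ p ∈ P₀, ∀ q ∈ P₀, ∀ l ∈ Λ, (p ≠ q ∨ l ≠ 0) → Disjoint p.support (q.translate l).support

/-- `P_n`: the patterns of the periodic collection that lie in `Ω ∩ nD`. -/
def patternsIn {d : ℕ} (Λ : Submodule ℤ (EuclideanSpace ℝ (Fin d))) (P₀ : Finset (Pattern d))
    (Ω D : Set (EuclideanSpace ℝ (Fin d))) (n : ℕ+) : Set (Pattern d) :=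
  {q | q ∈ periodicPatterns Λ P₀ ∧ q.support ⊆ sites Ω D n}

/-- The pattern field `ξ_n(φ) = ∑_{q ∈ P_n} φ(z_q / n) 1{q occurs}`, with `z_q` the location of `q`.
For `φ` of compact support only finitely many `q` contribute. -/
noncomputable def patternField {d : ℕ} (Λ : Submodule ℤ (EuclideanSpace ℝ (Fin d)))
    (P₀ : Finset (Pattern d)) (Ω D : Set (EuclideanSpace ℝ (Fin d))) (n : ℕ+)
    (φ : EuclideanSpace ℝ (Fin d) → ℝ) (T : Set (sites Ω D n)) : ℝ :=
  ∑ᶠ (q : Pattern d) (_ : q ∈ patternsIn Λ P₀ Ω D n),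
    φ (((n : ℝ)⁻¹) • q.location) * (q.occurs (sites Ω D n)).indicator 1 T

/-- The centred and rescaled field `n^{-d/2} (ξ_n(φ) - E ξ_n(φ))`. -/
noncomputable def rescaledField {d : ℕ} (Λ : Submodule ℤ (EuclideanSpace ℝ (Fin d)))
    (P₀ : Finset (Pattern d)) (Ω D : Set (EuclideanSpace ℝ (Fin d))) (n : ℕ+)
    (μ : Measure (Set (sites Ω D n)))
    (φ : EuclideanSpace ℝ (Fin d) → ℝ) (T : Set (sites Ω D n)) : ℝ :=
  (n : ℝ) ^ (-(d : ℝ) / 2) *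
    (patternField Λ P₀ Ω D n φ T - ∫ T', patternField Λ P₀ Ω D n φ T' ∂μ)

/-- The kernels `K_n` converge to `K` pointwise around every point of `D`: for fixed `x, y ∈ Ω`,
`K_n(x + l, y + l) → K(x, y)`, uniformly over the lattice vectors `l` with `l / n` in a given compact
subset of `D`. (For `l = 0` this is pointwise convergence. It also forces `K` to be
`Λ`-invariant. For `n` large, `x + l` and `y + l` belong to `Ω ∩ nD`.) -/
def KernelsConverge {d : ℕ} (Λ : Submodule ℤ (EuclideanSpace ℝ (Fin d)))
    (Ω D : Set (EuclideanSpace ℝ (Fin d)))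
    (Kn : ℕ+ → EuclideanSpace ℝ (Fin d) → EuclideanSpace ℝ (Fin d) → ℝ)
    (K : EuclideanSpace ℝ (Fin d) → EuclideanSpace ℝ (Fin d) → ℝ) : Prop :=
  ∀ C ⊆ D, IsCompact C → ∀ x ∈ Ω, ∀ y ∈ Ω, ∀ ε > 0, ∀ᶠ n : ℕ+ in atTop,
    ∀ l ∈ Λ, ((n : ℝ)⁻¹) • l ∈ C → |Kn n (x + l) (y + l) - K x y| < ε

/-- `K_n(x, y) = O(|x - y|^{-d})`, with a constant that is uniform in `n` and in `x ≠ y` as long as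
`x / n` and `y / n` stay in a given compact subset of `D`. (If `K_n → K` pointwise and `0` is an
interior point of `D`, this contains `K(x, y) = O(|x - y|^{-d})`.) -/
def KernelsDecay {d : ℕ} (Ω D : Set (EuclideanSpace ℝ (Fin d)))
    (Kn : ℕ+ → EuclideanSpace ℝ (Fin d) → EuclideanSpace ℝ (Fin d) → ℝ) : Prop :=
  ∀ C ⊆ D, IsCompact C → ∃ M : ℝ, ∀ n : ℕ+, ∀ x ∈ sites Ω C n, ∀ y ∈ sites Ω C n, x ≠ y →
    |Kn n x y| ≤ M / ‖x - y‖ ^ d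

/-- `I(P⁰) = |P⁰|⁻¹ ∑_{p ∈ P⁰} ∑_{q ∈ P} Cov(p, q)`, for the process `μ` on `Ω`. -/
noncomputable def patternIntensity {d : ℕ} {Ω : Set (EuclideanSpace ℝ (Fin d))}
    (Λ : Submodule ℤ (EuclideanSpace ℝ (Fin d))) (P₀ : Finset (Pattern d))
    (μ : Measure (Set Ω)) : ℝ :=
  (P₀.card : ℝ)⁻¹ * ∑ p ∈ P₀, ∑' q : periodicPatterns Λ P₀, p.cov μ q

/-- Test functions on `D`: smooth functions with compact support contained in `D`. -/
def IsTestFunction {d : ℕ} (D : Set (EuclideanSpace ℝ (Fin d)))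
    (φ : EuclideanSpace ℝ (Fin d) → ℝ) : Prop :=
  ContDiff ℝ ∞ φ ∧ HasCompactSupport φ ∧ tsupport φ ⊆ D

/-- Weak convergence of the random fields `φ ↦ X n φ` on `D` to the Gaussian white noise `W` with
`E (W(φ) W(ψ)) = σ ∫_D φ ψ`: for all test functions `φ₁, …, φ_k`, the vector
`(X n φ₁, …, X n φ_k)` converges in distribution to the centred Gaussian vector with covariance
matrix `(σ ∫_D φ_i φ_j)_{i, j}`. -/
def ConvergesToWhiteNoise {d : ℕ} (D : Set (EuclideanSpace ℝ (Fin d)))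
    {S : ℕ+ → Type*} [∀ n, MeasurableSpace (S n)] (μ : ∀ n, Measure (S n))
    [∀ n, IsProbabilityMeasure (μ n)] (X : ∀ n, (EuclideanSpace ℝ (Fin d) → ℝ) → S n → ℝ)
    (σ : ℝ) : Prop :=
  ∀ (k : ℕ) (φ : Fin k → EuclideanSpace ℝ (Fin d) → ℝ), (∀ i, IsTestFunction D (φ i)) →
    TendstoInDistribution (fun n s => WithLp.toLp 2 fun i => X n (φ i) s) atTop
      (id : EuclideanSpace ℝ (Fin k) → EuclideanSpace ℝ (Fin k)) μ
      (multivariateGaussian 0 (Matrix.of fun i j => σ * ∫ z in D, φ i z * φ j z))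

/-! Tested against φ, the rescaled field is a linear statistic W = ∑ a_q (J_q - E J_q) of the 0-1
indicators J_q of the patterns, with coefficients a_q = n^{-d/2} φ(z_q/n). The proof shows that its
moments satisfy, up to a vanishing error, the recursion E W^{m+1} = m Var(W) E W^{m-1} that
determines the Gaussian moments, and that Var(W) converges.

Cluster expansion. The probability that all patterns of a finite set A occur is a determinant whose
rows come from K (spin 1) or from 1 - K (spin 0), see `IsDeterminantal.measureReal_biInter_occurs`.
Sorting the permutations of the Leibniz formula by the set B of patterns that they link to a given
pattern q yields P(q, A) = ∑_{B ⊆ A} u(q, B) P(A \ B) (`ClusterDet.det_rowMask_insert`). A linking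
permutation contains an arrow into each pattern of B from a pattern attached earlier, so ∑_{|B| = k}
|u(q, B)| is at most a constant times the k-th power of the sum of |x|^{-d} over a box, which is
here bounded by a multiple of n^{d/8}. If B is a single pattern, the permutation crosses in both
directions; this gives the summable decay |x|^{-2d} of the covariances.

Integration by parts. Inserting the expansion in E J_q G(W) turns every element of B into a finite
difference of G with a step of order n^{-d/2} (`IsTruncated.integral_mul_comp`). Summed over the
O(n^d) patterns q with their coefficients, the sets B of size j contribute O(n^{d/2} n^{-dj/2}
n^{dj/8}), which is negligible for j ≥ 2. The sets of size 1, together with the diagonal term, give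
Var(W) E G'(W). The choice G(x) = x^m is the recursion (`IsTruncated.abs_moment_sub_le`).

Variance. Pairs of patterns are grouped by relative position. By the local uniform convergence of
the kernels each group is a Riemann sum over the rescaled lattice, and the squared decay dominates
the sum over relative positions (`tendsto_statVar`). Being a limit of second moments, the result is
nonnegative, whence I ≥ 0.

Conclusion. The recursion bounds and then identifies all moments, hence the characteristic function
of W at 1. The field is linear in φ, so this is the convergence of the characteristic functions of
the vectors, and Lévy's theorem applies. -/

set_option linter.unusedSectionVars false

/-! ### Cluster expansion of determinants -/

namespace ClusterDet

variable {V ι : Type*} [Fintype V] [DecidableEq V] [DecidableEq ι]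

/-- The matrix whose rows of colour in `A` are those of `M` and whose other rows are those of the
identity. -/
def rowMask (M : Matrix V V ℝ) (c : V → ι) (A : Finset ι) : Matrix V V ℝ :=
  Matrix.of fun v w => if c v ∈ A then M v w else if v = w then 1 else 0

/-- The set of the elements with colour in `C` is invariant under `σ`. -/
def IsClosedUnder (c : V → ι) (σ : Equiv.Perm V) (C : Finset ι) : Prop :=
  ∀ v, c v ∈ C → c (σ v) ∈ C

/-- `B` is the smallest set of colours that contains `q` and is closed under `σ`. -/
def IsLinked (c : V → ι) (q : ι) (B : Finset ι) (σ : Equiv.Perm V) : Prop :=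
  ∀ C ⊆ B, q ∈ C → IsClosedUnder c σ C → C = B

/-- The term of the permutation `σ` in the determinant of `rowMask M c A`. -/
def term (M : Matrix V V ℝ) (c : V → ι) (A : Finset ι) (σ : Equiv.Perm V) : ℝ :=
  (Equiv.Perm.sign σ : ℝ) * ∏ v, rowMask M c A v (σ v)

open Classical in
/-- The truncated determinant: the part of the determinant over the colours `insert q B` coming from
the permutations that link all these colours to `q`. -/
noncomputable def truncDet (M : Matrix V V ℝ) (c : V → ι) (q : ι) (B : Finset ι) : ℝ :=
  ∑ σ : Equiv.Perm V, if IsLinked c q (insert q B) σ then term M c (insert q B) σ else 0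

lemma det_rowMask (M : Matrix V V ℝ) (c : V → ι) (A : Finset ι) :
    (rowMask M c A).det = ∑ σ, term M c A σ := by
  rw [← Matrix.det_transpose, Matrix.det_apply']
  rfl

lemma term_ne_zero {M : Matrix V V ℝ} {c : V → ι} {A : Finset ι} {σ : Equiv.Perm V}
    (h : term M c A σ ≠ 0) {v : V} (hv : c v ∉ A) : σ v = v := by
  by_contra hne
  apply h
  have : ∏ v, rowMask M c A v (σ v) = 0 :=
    Finset.prod_eq_zero (Finset.mem_univ v) (by simp [rowMask, hv, Ne.symm hne])
  simp [term, this]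

lemma isClosedUnder_of_fixes {V ι : Type*} {c : V → ι} {A : Finset ι} {σ : Equiv.Perm V}
    (h : ∀ v, c v ∉ A → σ v = v) : IsClosedUnder c σ A := by
  intro v hv
  by_contra hn
  have := σ.injective (h _ hn)
  rw [this] at hn
  exact hn hv

/-- An injective map of a finite set into itself is onto, so invariance also holds backwards. -/
lemma IsClosedUnder.symm {V ι : Type*} [Finite V] {c : V → ι} {A : Finset ι} {σ : Equiv.Perm V}
    (h : IsClosedUnder c σ A) (v : V) : c (σ v) ∈ A ↔ c v ∈ A := by
  refine ⟨fun hv => ?_, h v⟩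
  have hfin : (σ '' {v | c v ∈ A}) = {v | c v ∈ A} := by
    apply Set.eq_of_subset_of_ncard_le
    · rintro _ ⟨w, hw, rfl⟩
      exact h w hw
    · rw [Set.ncard_image_of_injective _ σ.injective]
    · exact Set.toFinite _
  have : σ v ∈ σ '' {v | c v ∈ A} := by rw [hfin]; exact hv
  obtain ⟨w, hw, hwv⟩ := this
  rw [← σ.injective hwv]
  exact hw

/-- The product splits row by row: each row is active in at most one of the two masks, and in the
other mask it is an identity row evaluated on the diagonal, with value 1. -/
lemma term_mul {M : Matrix V V ℝ} {c : V → ι} {A₁ A₂ : Finset ι} (hd : Disjoint A₁ A₂)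
    {σ₁ σ₂ : Equiv.Perm V} (h₁ : ∀ v, c v ∉ A₁ → σ₁ v = v) (h₂ : ∀ v, c v ∈ A₁ → σ₂ v = v) :
    term M c (A₁ ∪ A₂) (σ₁ * σ₂) = term M c A₁ σ₁ * term M c A₂ σ₂ := by
  have key : ∀ v, rowMask M c (A₁ ∪ A₂) v ((σ₁ * σ₂) v) =
      rowMask M c A₁ v (σ₁ v) * rowMask M c A₂ v (σ₂ v) := by
    intro v
    by_cases hv : c v ∈ A₁
    · have hv2 : c v ∉ A₂ := fun h => Finset.disjoint_left.1 hd hv h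
      simp [rowMask, hv, hv2, h₂ v hv]
    · have hs : c (σ₂ v) ∉ A₁ := by
        intro h
        have := σ₂.injective (h₂ _ h)
        rw [this] at h
        exact hv h
      simp [rowMask, hv, h₁ v hv, h₁ _ hs]
  simp only [term, key, Finset.prod_mul_distrib, Equiv.Perm.sign_mul, Units.val_mul, Int.cast_mul]
  ring

-- A permutation leaving the elements coloured in `A₁` invariant splits uniquely into a permutation
-- of these elements and a permutation of the others, and its term factors by `term_mul`. The
-- hypothesis `hP` says that `P` sees only the first factor.
open Classical in
lemma sum_closed_term (M : Matrix V V ℝ) (c : V → ι) {A₁ A₂ : Finset ι} (hd : Disjoint A₁ A₂)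
    (P : Equiv.Perm V → Prop)
    (hP : ∀ σ τ : Equiv.Perm V, (∀ v, c v ∈ A₁ → σ v = τ v) → P σ → P τ) :
    ∑ σ : Equiv.Perm V, (if IsClosedUnder c σ A₁ ∧ P σ then term M c (A₁ ∪ A₂) σ else 0) =
      (∑ σ : Equiv.Perm V, if P σ then term M c A₁ σ else 0) * ∑ σ, term M c A₂ σ := by
  have e₁ : (∑ σ : Equiv.Perm V, if P σ then term M c A₁ σ else 0) =
      ∑ σ ∈ Finset.univ.filter (fun σ : Equiv.Perm V => ∀ v, c v ∉ A₁ → σ v = v),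
        if P σ then term M c A₁ σ else 0 := by
    symm
    apply Finset.sum_subset (Finset.subset_univ _)
    intro σ _ hσ
    have : term M c A₁ σ = 0 := by
      by_contra hne
      exact hσ (by simpa using fun v hv => term_ne_zero hne hv)
    simp [this]
  have e₂ : (∑ σ, term M c A₂ σ) =
      ∑ σ ∈ Finset.univ.filter (fun σ : Equiv.Perm V => ∀ v, c v ∈ A₁ → σ v = v),
        term M c A₂ σ := by
    symm
    apply Finset.sum_subset (Finset.subset_univ _)
    intro σ _ hσ
    by_contra hne
    exact hσ (by
      simpa using fun v hv => term_ne_zero hne (fun h => Finset.disjoint_left.1 hd hv h))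
  rw [e₁, e₂, Finset.sum_mul_sum, ← Finset.sum_product', ← Finset.sum_filter]
  have e₃ : ∑ σ ∈ Finset.univ.filter (fun σ : Equiv.Perm V => IsClosedUnder c σ A₁ ∧ P σ),
      term M c (A₁ ∪ A₂) σ =
      ∑ σ ∈ Finset.univ.filter (fun σ : Equiv.Perm V => IsClosedUnder c σ A₁),
        if P σ then term M c (A₁ ∪ A₂) σ else 0 := by
    rw [← Finset.sum_filter, Finset.filter_filter]
  rw [e₃]
  symm
  refine Finset.sum_bij (fun x _ => x.1 * x.2) ?_ ?_ ?_ ?_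
  · rintro ⟨σ₁, σ₂⟩ h
    simp only [Finset.mem_product, Finset.mem_filter, Finset.mem_univ, true_and] at h ⊢
    intro v hv
    rw [Equiv.Perm.mul_apply, h.2 v hv]
    exact isClosedUnder_of_fixes h.1 v hv
  · rintro ⟨σ₁, σ₂⟩ h ⟨τ₁, τ₂⟩ h' heq
    simp only [Finset.mem_product, Finset.mem_filter, Finset.mem_univ, true_and] at h h' heq
    have h1 : σ₁ = τ₁ := by
      ext v
      by_cases hv : c v ∈ A₁
      · have := congrArg (fun σ : Equiv.Perm V => σ v) heq
        simp only [Equiv.Perm.mul_apply, h.2 v hv, h'.2 v hv] at this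
        rw [this]
      · rw [h.1 v hv, h'.1 v hv]
    subst h1
    simpa using heq
  · intro σ hσ
    simp only [Finset.mem_filter, Finset.mem_univ, true_and] at hσ
    let σ₁ : Equiv.Perm V := Equiv.Perm.ofSubtype (σ.subtypePerm (p := fun v => c v ∈ A₁)
      (fun v => hσ.symm v))
    have h₁ : ∀ v, c v ∈ A₁ → σ₁ v = σ v := fun v hv => by
      simp [σ₁, Equiv.Perm.ofSubtype_apply_of_mem (p := fun v => c v ∈ A₁) _ hv]
    have h₁' : ∀ v, c v ∉ A₁ → σ₁ v = v := fun v hv =>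
      Equiv.Perm.ofSubtype_apply_of_not_mem (p := fun v => c v ∈ A₁) _ hv
    refine ⟨(σ₁, σ₁⁻¹ * σ), ?_, by simp⟩
    simp only [Finset.mem_product, Finset.mem_filter, Finset.mem_univ, true_and]
    refine ⟨h₁', fun v hv => ?_⟩
    rw [Equiv.Perm.mul_apply, ← h₁ v hv]
    simp
  · rintro ⟨σ₁, σ₂⟩ h
    simp only [Finset.mem_product, Finset.mem_filter, Finset.mem_univ, true_and] at h ⊢
    have hPiff : P σ₁ ↔ P (σ₁ * σ₂) :=
      ⟨hP _ _ fun v hv => by simp [h.2 v hv], hP _ _ fun v hv => by simp [h.2 v hv]⟩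
    rw [term_mul hd h.1 h.2, ← hPiff]
    split_ifs <;> simp

/-- Invariant sets of colours containing `q` are stable under intersection, so there is a smallest
one. It is obtained by minimal cardinality; intersecting it with another candidate gives uniqueness.
-/
lemma existsUnique_linked {V ι : Type*} [DecidableEq ι] {c : V → ι} {q : ι} {A : Finset ι} (hq : q ∉ A) {σ : Equiv.Perm V}
    (hA : IsClosedUnder c σ (insert q A)) :
    ∃! B, B ∈ A.powerset ∧ IsClosedUnder c σ (insert q B) ∧ IsLinked c q (insert q B) σ := by
  classical
  have hne : ((insert q A).powerset.filter fun C => q ∈ C ∧ IsClosedUnder c σ C).Nonempty :=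
    ⟨insert q A, by simp [hA]⟩
  obtain ⟨C, hC, hmin⟩ := Finset.exists_min_image _ Finset.card hne
  simp only [Finset.mem_filter, Finset.mem_powerset] at hC hmin
  have hins : insert q (C.erase q) = C := Finset.insert_erase hC.2.1
  have hlink : IsLinked c q C σ := fun D hD hqD hcl =>
    Finset.eq_of_subset_of_card_le hD (hmin D ⟨hD.trans hC.1, hqD, hcl⟩)
  refine ⟨C.erase q, ⟨?_, ?_, ?_⟩, ?_⟩
  · rw [Finset.mem_powerset]
    intro r hr
    rw [Finset.mem_erase] at hr
    exact (Finset.mem_insert.1 (hC.1 hr.2)).resolve_left hr.1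
  · rw [hins]; exact hC.2.2
  · rw [hins]; exact hlink
  · rintro B ⟨hB, hcl, hl⟩
    rw [Finset.mem_powerset] at hB
    have hint : IsClosedUnder c σ (insert q B ∩ C) := fun v hv => by
      rw [Finset.mem_inter] at hv ⊢
      exact ⟨hcl v hv.1, hC.2.2 v hv.2⟩
    have h1 := hl _ Finset.inter_subset_left (by simp [hC.2.1]) hint
    have h2 := hlink _ Finset.inter_subset_right (by simp [hC.2.1]) hint
    rw [← h2, h1, Finset.erase_insert fun h => hq (hB h)]

/-- Every contributing permutation is attributed to the cluster of `q`, the smallest invariant set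
of colours around `q`. What it does on the cluster builds `truncDet`; what it does on the rest is
unrestricted and sums up to a determinant again. -/
theorem det_rowMask_insert (M : Matrix V V ℝ) (c : V → ι) {q : ι} {A : Finset ι} (hq : q ∉ A) :
    (rowMask M c (insert q A)).det =
      ∑ B ∈ A.powerset, truncDet M c q B * (rowMask M c (A \ B)).det := by
  classical
  have step : ∀ σ, term M c (insert q A) σ = ∑ B ∈ A.powerset,
      if IsClosedUnder c σ (insert q B) ∧ IsLinked c q (insert q B) σ then
        term M c (insert q A) σ else 0 := by
    intro σ
    by_cases h0 : term M c (insert q A) σ = 0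
    · simp [h0]
    obtain ⟨B, hB, huniq⟩ := existsUnique_linked hq
      (isClosedUnder_of_fixes fun v hv => term_ne_zero h0 hv)
    rw [Finset.sum_eq_single B]
    · rw [if_pos hB.2]
    · intro B' hB' hne
      rw [if_neg]
      exact fun h => hne (huniq B' ⟨hB', h⟩)
    · exact fun h => absurd hB.1 h
  rw [det_rowMask, Finset.sum_congr rfl fun σ _ => step σ, Finset.sum_comm]
  refine Finset.sum_congr rfl fun B hB => ?_
  rw [Finset.mem_powerset] at hB
  rw [det_rowMask, truncDet]
  have hun : insert q A = insert q B ∪ (A \ B) := by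
    rw [Finset.insert_union, Finset.union_sdiff_of_subset hB]
  rw [hun]
  refine sum_closed_term M c ?_ _ ?_
  · rw [Finset.disjoint_insert_left]
    exact ⟨fun h => hq (Finset.mem_sdiff.1 h).1, Finset.disjoint_sdiff⟩
  · intro σ τ hστ hl C hC hqC hcl
    refine hl C hC hqC fun v hv => ?_
    rw [hστ v (hC hv)]
    exact hcl v hv

end ClusterDet

/-! ### Tree bounds for truncated determinants -/

namespace ClusterDet

/-- The sum over the ways of growing the set `C` to `C ∪ D` by adding the elements of `D` one by
one, each new element `r` being linked to one element `s` already present with weight `g s r`. -/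
noncomputable def treeWeight {ι : Type*} [DecidableEq ι] (g : ι → ι → ℝ) :
    ℕ → Finset ι → Finset ι → ℝ
  | 0, _, _ => 1
  | k + 1, C, D => ∑ r ∈ D, (∑ s ∈ C, g s r) * treeWeight g k (insert r C) (D.erase r)

lemma treeWeight_nonneg {ι : Type*} [DecidableEq ι] {g : ι → ι → ℝ} (hg : ∀ a b, 0 ≤ g a b) (k : ℕ)
    (C D : Finset ι) : 0 ≤ treeWeight g k C D := by
  induction k generalizing C D with
  | zero => simp [treeWeight]
  | succ k ih =>
    exact Finset.sum_nonneg fun r _ => mul_nonneg (Finset.sum_nonneg fun _ _ => hg _ _) (ih _ _)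

/-- The map `(D, r) ↦ (r, D.erase r)` is injective on pairs with `r ∈ D`. This allows the new
element in `treeWeight` to be summed first. -/
lemma sum_powersetCard_sum_erase_le {ι : Type*} [DecidableEq ι] {F : ι → Finset ι → ℝ}
    (hF : ∀ r D, 0 ≤ F r D) (k : ℕ) (S : Finset ι) :
    ∑ D ∈ S.powersetCard (k + 1), ∑ r ∈ D, F r (D.erase r) ≤
      ∑ r ∈ S, ∑ D ∈ (S.erase r).powersetCard k, F r D := by
  rw [Finset.sum_sigma', Finset.sum_sigma']
  have hinj : Set.InjOn (fun x : (_ : Finset ι) × ι => (⟨x.2, x.1.erase x.2⟩ : (_ : ι) × Finset ι))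
      ((S.powersetCard (k + 1)).sigma fun D => D) := by
    rintro ⟨D, r⟩ h ⟨D', r'⟩ h' heq
    simp only [Finset.coe_sigma, Set.mem_sigma_iff, Finset.mem_coe] at h h'
    simp only [Sigma.mk.injEq, heq_eq_eq] at heq
    obtain ⟨rfl, he⟩ := heq
    have : D = D' := by rw [← Finset.insert_erase h.2, he, Finset.insert_erase h'.2]
    subst this
    rfl
  rw [← Finset.sum_image (f := fun y : (_ : ι) × Finset ι => F y.1 y.2) hinj]
  refine Finset.sum_le_sum_of_subset_of_nonneg ?_ fun _ _ _ => hF _ _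
  intro y hy
  obtain ⟨⟨D, r⟩, h, rfl⟩ := Finset.mem_image.1 hy
  simp only [Finset.mem_sigma, Finset.mem_powersetCard] at h ⊢
  exact ⟨h.1.1 h.2, Finset.erase_subset_erase _ h.1.1, by
    rw [Finset.card_erase_of_mem h.2, h.1.2]; rfl⟩

/-- Each growth step chooses a new element and an element already present to which it is attached.
For a fixed element present the sum over new ones costs `L`, and at most `C.card + k` elements are
ever present. -/
lemma sum_treeWeight_le {ι : Type*} [DecidableEq ι] {g : ι → ι → ℝ} (hg : ∀ a b, 0 ≤ g a b)
    {Q : Finset ι} {L : ℝ} (hL : ∀ a ∈ Q, ∑ b ∈ Q, g a b ≤ L) (k : ℕ) {C S : Finset ι}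
    (hC : C ⊆ Q) (hS : S ⊆ Q) (hne : C.Nonempty) :
    ∑ D ∈ S.powersetCard k, treeWeight g k C D ≤ ((C.card : ℝ) + k) ^ k * L ^ k := by
  have hL0 : 0 ≤ L := by
    obtain ⟨a, ha⟩ := hne
    exact (Finset.sum_nonneg fun _ _ => hg _ _).trans (hL a (hC ha))
  induction k generalizing C S with
  | zero => simp [treeWeight]
  | succ k ih =>
    calc ∑ D ∈ S.powersetCard (k + 1), treeWeight g (k + 1) C D
        ≤ ∑ r ∈ S, ∑ D ∈ (S.erase r).powersetCard k,
            (∑ s ∈ C, g s r) * treeWeight g k (insert r C) D :=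
          sum_powersetCard_sum_erase_le
            (F := fun r D => (∑ s ∈ C, g s r) * treeWeight g k (insert r C) D)
            (fun r D => mul_nonneg (Finset.sum_nonneg fun _ _ => hg _ _)
              (treeWeight_nonneg hg _ _ _)) k S
      _ ≤ ∑ r ∈ S, (∑ s ∈ C, g s r) * (((C.card : ℝ) + (k + 1 : ℕ)) ^ k * L ^ k) := by
          refine Finset.sum_le_sum fun r hr => ?_
          rw [← Finset.mul_sum]
          refine mul_le_mul_of_nonneg_left ?_ (Finset.sum_nonneg fun _ _ => hg _ _)
          refine (ih (Finset.insert_subset (hS hr) hC) ((Finset.erase_subset _ _).trans hS)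
            (Finset.insert_nonempty _ _)).trans ?_
          have : ((insert r C).card : ℝ) ≤ C.card + 1 := mod_cast Finset.card_insert_le r C
          have h2 : ((insert r C).card : ℝ) + k ≤ C.card + (k + 1 : ℕ) := by
            push_cast; linarith
          gcongr
      _ = (∑ s ∈ C, ∑ r ∈ S, g s r) * (((C.card : ℝ) + (k + 1 : ℕ)) ^ k * L ^ k) := by
          rw [← Finset.sum_mul, Finset.sum_comm]
      _ ≤ (C.card * L) * (((C.card : ℝ) + (k + 1 : ℕ)) ^ k * L ^ k) := by
          refine mul_le_mul_of_nonneg_right ?_ (by positivity)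
          calc ∑ s ∈ C, ∑ r ∈ S, g s r ≤ ∑ s ∈ C, L := Finset.sum_le_sum fun s hs =>
                (Finset.sum_le_sum_of_subset_of_nonneg hS fun _ _ _ => hg _ _).trans (hL s (hC hs))
            _ = C.card * L := by simp
      _ ≤ ((C.card : ℝ) + (k + 1 : ℕ)) ^ (k + 1) * L ^ (k + 1) := by
          have : (C.card : ℝ) ≤ C.card + (k + 1 : ℕ) := by
            have : (0 : ℝ) ≤ (k + 1 : ℕ) := by positivity
            linarith
          calc (C.card * L) * (((C.card : ℝ) + (k + 1 : ℕ)) ^ k * L ^ k)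
              ≤ (((C.card : ℝ) + (k + 1 : ℕ)) * L) * (((C.card : ℝ) + (k + 1 : ℕ)) ^ k * L ^ k) := by
                gcongr
            _ = _ := by ring

variable {V ι : Type*} [Fintype V] [DecidableEq ι]

/-- As long as colours are missing, `C` is not invariant, so some arrow leads from `C` to a colour
`r` of `D`. Its factor occurs in the sum over `s` in `treeWeight`, and the other arrows into `r` are
dropped because `g ≤ 1`. Arrows are sorted by the colour of their target, so none is used twice. -/
lemma prod_le_treeWeight {g : ι → ι → ℝ} (hg : ∀ a b, 0 ≤ g a b) {c : V → ι} {q : ι}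
    {B : Finset ι} {σ : Equiv.Perm V} (hcl : IsClosedUnder c σ B) (hl : IsLinked c q B σ)
    (hg1 : ∀ a b, g a b ≤ 1) {k : ℕ} {C D : Finset ι} (hk : D.card = k) (hCD : C ∪ D = B)
    (hq : q ∈ C) (hdis : Disjoint C D) :
    (∏ v ∈ Finset.univ.filter fun v => c (σ v) ∈ D, g (c v) (c (σ v))) ≤ treeWeight g k C D := by
  induction k generalizing C D with
  | zero =>
    rw [Finset.card_eq_zero] at hk
    simp [hk, treeWeight]
  | succ k ih =>
    have hex : ∃ v, c v ∈ C ∧ c (σ v) ∈ D := by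
      by_contra! hcon
      have : C = B := by
        refine hl C (hCD ▸ Finset.subset_union_left) hq fun v hv => ?_
        have h1 := hcl v (hCD ▸ Finset.mem_union_left _ hv)
        rw [← hCD, Finset.mem_union] at h1
        exact h1.resolve_right (hcon v hv)
      rw [this] at hCD hdis
      have : D ⊆ B := hCD ▸ Finset.subset_union_right
      have : D = ∅ := by
        rw [← Finset.disjoint_self_iff_empty]
        exact hdis.mono_left this
      rw [this] at hk
      simp at hk
    obtain ⟨v₀, hv₀, hr⟩ := hex
    classical
    set r := c (σ v₀) with hrdef
    have hrC : r ∉ C := fun h => Finset.disjoint_left.1 hdis h hr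
    have hsplit : (Finset.univ.filter fun v => c (σ v) ∈ D) =
        (Finset.univ.filter fun v => c (σ v) ∈ D.erase r) ∪
          (Finset.univ.filter fun v => c (σ v) = r) := by
      ext v
      simp only [Finset.mem_filter, Finset.mem_univ, true_and, Finset.mem_union, Finset.mem_erase]
      constructor
      · intro h
        by_cases h' : c (σ v) = r
        · exact Or.inr h'
        · exact Or.inl ⟨h', h⟩
      · rintro (h | h)
        · exact h.2
        · rw [h]; exact hr
    have hdj : Disjoint (Finset.univ.filter fun v => c (σ v) ∈ D.erase r)
          (Finset.univ.filter fun v => c (σ v) = r) := by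
      rw [Finset.disjoint_left]
      intro v h1 h2
      simp only [Finset.mem_filter, Finset.mem_univ, true_and, Finset.mem_erase] at h1 h2
      exact h1.1 h2
    have hone : (∏ v ∈ Finset.univ.filter fun v => c (σ v) = r, g (c v) (c (σ v))) ≤
        ∑ s ∈ C, g s r := by
      have hmem : v₀ ∈ Finset.univ.filter fun v => c (σ v) = r := by simp [hrdef]
      rw [← Finset.mul_prod_erase _ _ hmem]
      calc g (c v₀) (c (σ v₀)) * _ ≤ g (c v₀) (c (σ v₀)) * 1 :=
            mul_le_mul_of_nonneg_left (Finset.prod_le_one (fun _ _ => hg _ _) fun _ _ => hg1 _ _)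
              (hg _ _)
        _ = g (c v₀) r := by rw [mul_one]
        _ ≤ ∑ s ∈ C, g s r := Finset.single_le_sum (f := fun s => g s r) (fun _ _ => hg _ _) hv₀
    rw [hsplit, Finset.prod_union hdj, mul_comm]
    have ih' := ih (C := insert r C) (D := D.erase r)
      (by rw [Finset.card_erase_of_mem hr, hk]; rfl)
      (by rw [← hCD, Finset.insert_union, ← Finset.union_insert, Finset.insert_erase hr])
      (Finset.mem_insert_of_mem hq)
      (by
        rw [Finset.disjoint_insert_left]
        exact ⟨by simp, hdis.mono_right (Finset.erase_subset _ _)⟩)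
    calc _ ≤ (∑ s ∈ C, g s r) * treeWeight g k (insert r C) (D.erase r) :=
          mul_le_mul hone ih' (Finset.prod_nonneg fun _ _ => hg _ _)
            (Finset.sum_nonneg fun _ _ => hg _ _)
      _ ≤ _ := Finset.single_le_sum
          (f := fun r => (∑ s ∈ C, g s r) * treeWeight g k (insert r C) (D.erase r))
          (fun r _ => mul_nonneg (Finset.sum_nonneg fun _ _ => hg _ _)
            (treeWeight_nonneg hg _ _ _)) hr

variable [DecidableEq V]

/-- A nonzero term fixes all elements coloured outside `insert q B`, so at most `N!` permutations
contribute, each with at most `N` entries of size `m * g`. The bound `T` is left open to serve both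
the tree estimate and the two-way crossing between two colours. -/
lemma abs_truncDet_le {M : Matrix V V ℝ} {c : V → ι} {q : ι} {B : Finset ι} {g : ι → ι → ℝ}
    {m T : ℝ} {N : ℕ} (hm : 1 ≤ m)
    (hg : ∀ a b, 0 ≤ g a b) (hM : ∀ v w, c v ∈ insert q B → c w ∈ insert q B →
      |M v w| ≤ m * g (c v) (c w))
    (hN : (Finset.univ.filter fun v => c v ∈ insert q B).card ≤ N)
    (hT0 : 0 ≤ T)
    (hT : ∀ σ : Equiv.Perm V, IsClosedUnder c σ (insert q B) → IsLinked c q (insert q B) σ →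
      (∏ v ∈ Finset.univ.filter fun v => c v ∈ insert q B, g (c v) (c (σ v))) ≤ T) :
    |truncDet M c q B| ≤ N.factorial * m ^ N * T := by
  classical
  set B' := insert q B with hB'
  set F := Finset.univ.filter fun σ : Equiv.Perm V => ∀ v, ¬ (c v ∈ B') → σ v = v with hF
  have hcard : F.card = (Finset.univ.filter fun v => c v ∈ B').card.factorial := by
    rw [hF, ← Fintype.card_subtype,
      ← Fintype.card_congr (Equiv.Perm.subtypeEquivSubtypePerm fun v => c v ∈ B'),
      Fintype.card_perm, Fintype.card_subtype]
  have hterm : ∀ σ, |if IsLinked c q B' σ then term M c B' σ else 0| ≤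
      if σ ∈ F then m ^ N * T else 0 := by
    intro σ
    by_cases h0 : term M c B' σ = 0
    · have : 0 ≤ m ^ N * T := by positivity
      simp only [h0, ite_self, abs_zero]
      split_ifs <;> simp [this]
    have hfix : ∀ v, c v ∉ B' → σ v = v := fun v hv => term_ne_zero h0 hv
    have hσF : σ ∈ F := by simpa [hF] using hfix
    rw [if_pos hσF]
    split_ifs with hl
    swap
    · simpa using (by positivity : 0 ≤ m ^ N * T)
    have hcl := isClosedUnder_of_fixes hfix
    have hsgn : |((Equiv.Perm.sign σ : ℤ) : ℝ)| = 1 := by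
      rcases Int.units_eq_one_or (Equiv.Perm.sign σ) with h | h <;> simp [h]
    rw [term, abs_mul, hsgn, one_mul, Finset.abs_prod,
      ← Finset.prod_filter_mul_prod_filter_not Finset.univ (fun v => c v ∈ B')]
    have h2 : (∏ v ∈ Finset.univ.filter fun v => ¬ c v ∈ B', |rowMask M c B' v (σ v)|) = 1 := by
      refine Finset.prod_eq_one fun v hv => ?_
      simp only [Finset.mem_filter, Finset.mem_univ, true_and] at hv
      simp [rowMask, hv, hfix v hv]
    rw [h2, mul_one]
    calc (∏ v ∈ Finset.univ.filter fun v => c v ∈ B', |rowMask M c B' v (σ v)|)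
        ≤ ∏ v ∈ Finset.univ.filter fun v => c v ∈ B', m * g (c v) (c (σ v)) := by
          refine Finset.prod_le_prod (fun _ _ => abs_nonneg _) fun v hv => ?_
          simp only [Finset.mem_filter, Finset.mem_univ, true_and] at hv
          simpa [rowMask, hv] using hM v (σ v) hv (hcl v hv)
      _ = m ^ (Finset.univ.filter fun v => c v ∈ B').card *
            ∏ v ∈ Finset.univ.filter fun v => c v ∈ B', g (c v) (c (σ v)) := by
          rw [Finset.prod_mul_distrib, Finset.prod_const]
      _ ≤ m ^ N * T := by
          refine mul_le_mul (pow_le_pow_right₀ hm hN) (hT σ hcl hl)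
            (Finset.prod_nonneg fun _ _ => hg _ _) (by positivity)
  calc |truncDet M c q B| ≤ ∑ σ : Equiv.Perm V, |if IsLinked c q B' σ then term M c B' σ else 0| :=
        Finset.abs_sum_le_sum_abs _ _
    _ ≤ ∑ σ : Equiv.Perm V, if σ ∈ F then m ^ N * T else 0 := Finset.sum_le_sum fun σ _ => hterm σ
    _ = F.card * (m ^ N * T) := by
        rw [← Finset.sum_filter, Finset.sum_const, nsmul_eq_mul]
        congr 3
        ext σ; simp
    _ ≤ N.factorial * (m ^ N * T) := by
        refine mul_le_mul_of_nonneg_right ?_ (by positivity)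
        rw [hcard]
        exact_mod_cast Nat.factorial_le hN
    _ = _ := by ring

theorem abs_truncDet_le_treeWeight {M : Matrix V V ℝ} {c : V → ι} {q : ι} {B : Finset ι}
    {g : ι → ι → ℝ} {m : ℝ} {N : ℕ} (hm : 1 ≤ m) (hqB : q ∉ B)
    (hg : ∀ a b, 0 ≤ g a b) (hg1 : ∀ a b, g a b ≤ 1)
    (hM : ∀ v w, c v ∈ insert q B → c w ∈ insert q B → |M v w| ≤ m * g (c v) (c w))
    (hN : (Finset.univ.filter fun v => c v ∈ insert q B).card ≤ N) :
    |truncDet M c q B| ≤ N.factorial * m ^ N * treeWeight g B.card {q} B := by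
  refine abs_truncDet_le hm hg hM hN (treeWeight_nonneg hg _ _ _) fun σ hcl hl => ?_
  refine le_trans ?_ (prod_le_treeWeight hg hcl hl hg1 rfl (C := {q}) (D := B)
    (by rw [Finset.insert_eq]) (by simp) (by simpa using hqB))
  -- Only the arrows into `B` feed the tree; those into `q` are bounded by 1.
  rw [← Finset.prod_filter_mul_prod_filter_not (Finset.univ.filter fun v => c v ∈ insert q B)
    (fun v => c (σ v) ∈ B)]
  have : ((Finset.univ.filter fun v => c v ∈ insert q B).filter fun v => c (σ v) ∈ B) =
      Finset.univ.filter fun v => c (σ v) ∈ B := by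
    ext v
    simp only [Finset.mem_filter, Finset.mem_univ, true_and, and_iff_right_iff_imp]
    exact fun h => (hcl.symm v).1 (Finset.mem_insert_of_mem h)
  rw [this]
  exact mul_le_of_le_one_right (Finset.prod_nonneg fun _ _ => hg _ _)
    (Finset.prod_le_one (fun _ _ => hg _ _) fun _ _ => hg1 _ _)

/-- A permutation that links two colours maps some element of colour `q` to colour `r`, and some
element of colour `r` to colour `q`, since otherwise `{r}` would be invariant. Keeping both factors
gives the square of the decay, which is what makes the covariances summable. -/
theorem abs_truncDet_singleton_le {M : Matrix V V ℝ} {c : V → ι} {q r : ι}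
    {g : ι → ι → ℝ} {m : ℝ} {N : ℕ} (hm : 1 ≤ m) (hqr : q ≠ r)
    (hg : ∀ a b, 0 ≤ g a b) (hg1 : ∀ a b, g a b ≤ 1)
    (hM : ∀ v w, c v ∈ ({q, r} : Finset ι) → c w ∈ ({q, r} : Finset ι) →
      |M v w| ≤ m * g (c v) (c w))
    (hN : (Finset.univ.filter fun v => c v ∈ ({q, r} : Finset ι)).card ≤ N) :
    |truncDet M c q {r}| ≤ N.factorial * m ^ N * (g q r * g r q) := by
  refine abs_truncDet_le hm hg hM hN (mul_nonneg (hg _ _) (hg _ _)) fun σ hcl hl => ?_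
  have hneq : ({q} : Finset ι) ≠ {q, r} := fun h => by
    have : r ∈ ({q} : Finset ι) := h ▸ (by simp)
    exact hqr (Finset.mem_singleton.1 this).symm
  have hncl : ¬ IsClosedUnder c σ {q} := fun h =>
    hneq (hl {q} (by simp) (by simp) h)
  have h1 : ∃ v, c v = q ∧ c (σ v) = r := by
    unfold IsClosedUnder at hncl
    push Not at hncl
    obtain ⟨v, hv, hv'⟩ := hncl
    rw [Finset.mem_singleton] at hv hv'
    have := hcl v (by simp [hv])
    rw [Finset.mem_insert, Finset.mem_singleton] at this
    exact ⟨v, hv, this.resolve_left hv'⟩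
  have h2 : ∃ v, c v = r ∧ c (σ v) = q := by
    by_contra! hcon
    have hr : IsClosedUnder c σ {r} := by
      intro v hv
      rw [Finset.mem_singleton] at hv ⊢
      have := hcl v (by simp [hv])
      rw [Finset.mem_insert, Finset.mem_singleton] at this
      exact this.resolve_left (hcon v hv)
    obtain ⟨v, hv, hv'⟩ := h1
    have := (hr.symm v).1 (by simp [hv'])
    rw [Finset.mem_singleton, hv] at this
    exact hqr this
  obtain ⟨v, hv, hv'⟩ := h1
  obtain ⟨w, hw, hw'⟩ := h2
  have hvw : v ≠ w := fun h => hqr (by rw [← hv, h, hw])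
  have hsub : ({v, w} : Finset V) ⊆ Finset.univ.filter fun v => c v ∈ insert q ({r} : Finset ι) := by
    intro x hx
    rw [Finset.mem_insert, Finset.mem_singleton] at hx
    rcases hx with rfl | rfl <;> simp [hv, hw]
  rw [← Finset.prod_sdiff hsub, Finset.prod_pair hvw, hv, hv', hw, hw']
  exact mul_le_of_le_one_left (mul_nonneg (hg _ _) (hg _ _))
    (Finset.prod_le_one (fun _ _ => hg _ _) fun _ _ => hg1 _ _)

end ClusterDet

/-! ### Iterated finite differences -/

section FinDiff

/-- The iterated finite difference of `G` at `x`, with the steps `b r`, `r ∈ B`. -/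
noncomputable def finDiff {ι : Type*} (b : ι → ℝ) (B : Finset ι) (G : ℝ → ℝ) (x : ℝ) : ℝ :=
  ∑ C ∈ B.powerset, (-1) ^ (B.card + C.card) * G (x + ∑ r ∈ C, b r)

lemma finDiff_empty {ι : Type*} (b : ι → ℝ) (G : ℝ → ℝ) (x : ℝ) : finDiff b ∅ G x = G x := by
  simp [finDiff]

lemma finDiff_insert {ι : Type*} [DecidableEq ι] (b : ι → ℝ) {B : Finset ι} {s : ι} (hs : s ∉ B) (G : ℝ → ℝ) (x : ℝ) :
    finDiff b (insert s B) G x = finDiff b B G (x + b s) - finDiff b B G x := by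
  unfold finDiff
  rw [Finset.sum_powerset_insert hs, Finset.card_insert_of_notMem hs, add_comm, sub_eq_add_neg,
    ← Finset.sum_neg_distrib]
  congr 1
  · refine Finset.sum_congr rfl fun C hC => ?_
    have hsC : s ∉ C := fun h => hs (Finset.mem_powerset.1 hC h)
    rw [Finset.card_insert_of_notMem hsC, Finset.sum_insert hsC, ← add_assoc x]
    ring
  · refine Finset.sum_congr rfl fun C _ => ?_
    ring

/-- Differences commute, so the step `b s` may be applied to the function instead of the argument.
Having both forms is what closes the induction of the integration by parts. -/
lemma finDiff_insert' {ι : Type*} [DecidableEq ι] (b : ι → ℝ) {B : Finset ι} {s : ι} (hs : s ∉ B) (G : ℝ → ℝ) (x : ℝ) :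
    finDiff b (insert s B) G x = finDiff b B (fun y => G (y + b s) - G y) x := by
  rw [finDiff_insert b hs]
  unfold finDiff
  rw [← Finset.sum_sub_distrib]
  refine Finset.sum_congr rfl fun C _ => ?_
  rw [show x + b s + ∑ r ∈ C, b r = x + ∑ r ∈ C, b r + b s by ring]
  ring

lemma finDiff_singleton {ι : Type*} [DecidableEq ι] (b : ι → ℝ) (s : ι) (G : ℝ → ℝ) (x : ℝ) :
    finDiff b {s} G x = G (x + b s) - G x := by
  rw [← insert_empty_eq, finDiff_insert b (by simp), finDiff_empty, finDiff_empty]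

lemma continuous_finDiff {ι : Type*} (b : ι → ℝ) (B : Finset ι) {G : ℝ → ℝ} (hG : Continuous G) :
    Continuous (finDiff b B G) := by
  unfold finDiff
  fun_prop

/-- `(1 + |x|)^(m - j)`, to be read as `0` for `j > m`: the growth of the `j`-th derivative of a
polynomial of degree `m`. -/
noncomputable def polyWeight (m j : ℕ) (x : ℝ) : ℝ := if j ≤ m then (1 + |x|) ^ (m - j) else 0

lemma polyWeight_nonneg (m j : ℕ) (x : ℝ) : 0 ≤ polyWeight m j x := by
  unfold polyWeight; split_ifs <;> positivity

lemma polyWeight_le {m j : ℕ} {x y K : ℝ} (hK : 1 ≤ K) (h : 1 + |x| ≤ K * (1 + |y|)) :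
    polyWeight m j x ≤ K ^ m * polyWeight m j y := by
  unfold polyWeight
  split_ifs with hj
  · calc (1 + |x|) ^ (m - j) ≤ (K * (1 + |y|)) ^ (m - j) := by gcongr
      _ = K ^ (m - j) * (1 + |y|) ^ (m - j) := mul_pow _ _ _
      _ ≤ K ^ m * (1 + |y|) ^ (m - j) := by
        gcongr
        · exact Nat.sub_le m j
  · simp

lemma polyWeight_le_pow {m j i : ℕ} (hij : m - j ≤ i) (x : ℝ) :
    polyWeight m j x ≤ (1 + |x|) ^ i := by
  unfold polyWeight
  split_ifs
  · exact pow_le_pow_right₀ (by linarith [abs_nonneg x]) hij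
  · positivity

/-- `G` is a sequence of successive derivatives, `G j` growing like the `(j + k)`-th derivative of a
polynomial of degree `m`. -/
structure PolyGrowth (m k : ℕ) (C : ℝ) (G : ℕ → ℝ → ℝ) : Prop where
  deriv : ∀ j x, HasDerivAt (G j) (G (j + 1) x) x
  bound : ∀ j x, |G j x| ≤ C * polyWeight m (j + k) x

lemma PolyGrowth.continuous {m k : ℕ} {C : ℝ} {G : ℕ → ℝ → ℝ} (h : PolyGrowth m k C G) (j : ℕ) :
    Continuous (G j) :=
  continuous_iff_continuousAt.2 fun x => (h.deriv j x).continuousAt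

lemma PolyGrowth.shift {m k : ℕ} {C : ℝ} {G : ℕ → ℝ → ℝ} (h : PolyGrowth m k C G) :
    PolyGrowth m (k + 1) C fun j => G (j + 1) :=
  ⟨fun j x => h.deriv (j + 1) x, fun j x => by
    have := h.bound (j + 1) x
    rwa [show j + 1 + k = j + (k + 1) by ring] at this⟩

/-- The mean value inequality on the segment. The bound is expressed at a separate point `z`, whose
weight dominates all weights along the segment up to `K ^ m`. -/
lemma PolyGrowth.abs_sub_le {m k : ℕ} {C : ℝ} (hC : 0 ≤ C) {G : ℕ → ℝ → ℝ}
    (hG : PolyGrowth m k C G) (j : ℕ) {x h K z : ℝ} (hK : 1 ≤ K)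
    (hz : 1 + |x| + |h| ≤ K * (1 + |z|)) :
    |G j (x + h) - G j x| ≤ |h| * (C * K ^ m * polyWeight m (j + 1 + k) z) := by
  have hb : ∀ y ∈ segment ℝ x (x + h), ‖G (j + 1) y‖ ≤ C * K ^ m * polyWeight m (j + 1 + k) z := by
    intro y hy
    rw [Real.norm_eq_abs, mul_assoc]
    refine (hG.bound (j + 1) y).trans (mul_le_mul_of_nonneg_left (polyWeight_le hK ?_) hC)
    obtain ⟨t, ⟨ht0, ht1⟩, rfl⟩ := (segment_eq_image' ℝ x (x + h)).subset hy
    refine le_trans ?_ hz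
    have h1 : |x + t • (x + h - x)| ≤ |x| + |t * h| := by
      simpa using abs_add_le x (t * h)
    have h2 : |t * h| ≤ |h| := by
      rw [abs_mul, abs_of_nonneg ht0]
      exact mul_le_of_le_one_left (abs_nonneg _) ht1
    linarith
  have := (convex_segment x (x + h)).norm_image_sub_le_of_norm_hasDerivWithin_le
    (f := G j) (f' := G (j + 1)) (fun y _ => (hG.deriv j y).hasDerivWithinAt) hb
    (left_mem_segment ℝ _ _) (right_mem_segment ℝ _ _)
  simp only [Real.norm_eq_abs, add_sub_cancel_left] at this
  linarith

/-- A difference of step `h` acts like a derivative: the degree drops by one and the constant gains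
`|h|`. The factor `2 ^ m` compares the weights at points at distance at most 1. -/
lemma PolyGrowth.diff {m k : ℕ} {C : ℝ} (hC : 0 ≤ C) {G : ℕ → ℝ → ℝ} (hG : PolyGrowth m k C G)
    {h : ℝ} (hh : |h| ≤ 1) :
    PolyGrowth m (k + 1) (2 ^ m * |h| * C) fun j x => G j (x + h) - G j x := by
  refine ⟨fun j x => ?_, fun j x => ?_⟩
  · exact ((hG.deriv j (x + h)).comp_add_const x h).sub (hG.deriv j x)
  · have := hG.abs_sub_le hC j (x := x) (h := h) (K := 2) (z := x) (by norm_num)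
      (by linarith [abs_nonneg x])
    rw [show j + 1 + k = j + (k + 1) by ring] at this
    linarith

/-- Iteration of `PolyGrowth.diff`. Once `k + B.card` exceeds `m` the weight is 0, which later cuts
the sums over `B` off at size `m`. -/
lemma PolyGrowth.abs_finDiff_le {ι : Type*} [DecidableEq ι] {m k : ℕ} {C : ℝ} (hC : 0 ≤ C) {G : ℕ → ℝ → ℝ}
    (hG : PolyGrowth m k C G) {b : ι → ℝ} {B : Finset ι} (hb : ∀ r ∈ B, |b r| ≤ 1) (x : ℝ) :
    |finDiff b B (G 0) x| ≤
      (2 ^ m) ^ B.card * (∏ r ∈ B, |b r|) * C * polyWeight m (k + B.card) x := by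
  induction B using Finset.induction_on generalizing G k C with
  | empty => simpa [finDiff_empty] using hG.bound 0 x
  | insert s B hs ih =>
    rw [finDiff_insert' b hs]
    have hs1 := hb s (Finset.mem_insert_self _ _)
    have := ih (by positivity) (hG.diff hC hs1) fun r hr => hb r (Finset.mem_insert_of_mem hr)
    refine this.trans (le_of_eq ?_)
    rw [Finset.card_insert_of_notMem hs, Finset.prod_insert hs,
      show k + 1 + B.card = k + (B.card + 1) by ring]
    ring

lemma polyGrowth_pow (m : ℕ) :
    PolyGrowth m 0 m.factorial fun j x => (m.descFactorial j : ℝ) * x ^ (m - j) := by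
  refine ⟨fun j x => ?_, fun j x => ?_⟩
  · have := (hasDerivAt_pow (m - j) x).const_mul (m.descFactorial j : ℝ)
    rw [Nat.descFactorial_succ, show m - (j + 1) = m - j - 1 by omega]
    refine this.congr_deriv ?_
    push_cast
    ring
  · unfold polyWeight
    split_ifs with hj
    · rw [abs_mul, abs_pow, Nat.abs_cast, add_zero]
      have h1 : (m.descFactorial j : ℝ) ≤ m.factorial := by
        exact_mod_cast Nat.le_of_dvd m.factorial_pos
          (Dvd.intro_left _ (Nat.factorial_mul_descFactorial (by simpa using hj)))
      have h2 : |x| ≤ 1 + |x| := by linarith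
      gcongr
    · rw [Nat.descFactorial_eq_zero_iff_lt.2 (by omega)]
      simp

end FinDiff

/-! ### Bounded measurable functions -/

/-- Bounded measurable real functions. -/
def BddMeas {Ω : Type*} [MeasurableSpace Ω] (f : Ω → ℝ) : Prop :=
  Measurable f ∧ ∃ C, ∀ η, |f η| ≤ C

namespace BddMeas

variable {Ω : Type*} [MeasurableSpace Ω] {f g : Ω → ℝ}

lemma const (a : ℝ) : BddMeas fun _ : Ω => a := ⟨measurable_const, |a|, fun _ => le_rfl⟩

lemma add (hf : BddMeas f) (hg : BddMeas g) : BddMeas fun η => f η + g η := by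
  obtain ⟨A, hA⟩ := hf.2
  obtain ⟨B, hB⟩ := hg.2
  exact ⟨hf.1.add hg.1, A + B, fun η => (abs_add_le _ _).trans (add_le_add (hA η) (hB η))⟩

lemma mul (hf : BddMeas f) (hg : BddMeas g) : BddMeas fun η => f η * g η := by
  obtain ⟨A, hA⟩ := hf.2
  obtain ⟨B, hB⟩ := hg.2
  refine ⟨hf.1.mul hg.1, A * B, fun η => ?_⟩
  rw [abs_mul]
  exact mul_le_mul (hA η) (hB η) (abs_nonneg _) ((abs_nonneg _).trans (hA η))

lemma sub (hf : BddMeas f) (hg : BddMeas g) : BddMeas fun η => f η - g η := by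
  simpa [sub_eq_add_neg] using hf.add ((const (-1)).mul hg)

lemma sum {ι : Type*} {s : Finset ι} {F : ι → Ω → ℝ} (h : ∀ i ∈ s, BddMeas (F i)) :
    BddMeas fun η => ∑ i ∈ s, F i η := by
  classical
  induction s using Finset.induction_on with
  | empty => simpa using const 0
  | insert a s ha ih =>
    simp_rw [Finset.sum_insert ha]
    exact (h a (Finset.mem_insert_self _ _)).add
      (ih fun i hi => h i (Finset.mem_insert_of_mem hi))

lemma prod {ι : Type*} {s : Finset ι} {F : ι → Ω → ℝ} (h : ∀ i ∈ s, BddMeas (F i)) :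
    BddMeas fun η => ∏ i ∈ s, F i η := by
  classical
  induction s using Finset.induction_on with
  | empty => simpa using const 1
  | insert a s ha ih =>
    simp_rw [Finset.prod_insert ha]
    exact (h a (Finset.mem_insert_self _ _)).mul
      (ih fun i hi => h i (Finset.mem_insert_of_mem hi))

lemma comp (hf : BddMeas f) {G : ℝ → ℝ} (hG : Continuous G) : BddMeas fun η => G (f η) := by
  obtain ⟨A, hA⟩ := hf.2
  obtain ⟨C, hC⟩ := (isCompact_Icc (a := -A) (b := A)).exists_bound_of_continuousOn
    hG.continuousOn
  exact ⟨hG.measurable.comp hf.1, C, fun η => hC _ (abs_le.1 (hA η))⟩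

lemma integrable (hf : BddMeas f) {μ : Measure Ω} [IsFiniteMeasure μ] : Integrable f μ := by
  obtain ⟨A, hA⟩ := hf.2
  exact Integrable.of_bound hf.1.aestronglyMeasurable A (ae_of_all _ hA)

end BddMeas

/-! ### Integration by parts against truncated correlation functions -/

section IntegrationByParts

variable {Ω ι : Type*} [MeasurableSpace Ω] [DecidableEq ι] (μ : Measure Ω) [IsProbabilityMeasure μ]

/-- `u` is the family of the truncated correlation functions, rooted at the first argument, of the
`0`-`1`-valued random variables `J q`, `q ∈ Q`. -/
structure IsTruncated (Q : Finset ι) (J : ι → Ω → ℝ) (u : ι → Finset ι → ℝ) : Prop where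
  meas : ∀ q, Measurable (J q)
  zero_or_one : ∀ q η, J q η = 0 ∨ J q η = 1
  expand : ∀ q ∈ Q, ∀ A ⊆ Q, q ∉ A → ∫ η, J q η * ∏ r ∈ A, J r η ∂μ =
    ∑ B ∈ A.powerset, u q B * ∫ η, ∏ r ∈ A \ B, J r η ∂μ

variable {μ} {Q : Finset ι} {J : ι → Ω → ℝ} {u : ι → Finset ι → ℝ}

lemma bddMeas_of_zero_or_one {Ω : Type*} [MeasurableSpace Ω] {j : Ω → ℝ} (hm : Measurable j) (h : ∀ η, j η = 0 ∨ j η = 1) :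
    BddMeas j :=
  ⟨hm, 1, fun η => by rcases h η with h | h <;> simp [h]⟩

lemma IsTruncated.bdd {Ω ι : Type*} [MeasurableSpace Ω] [DecidableEq ι] {μ : Measure Ω}
    {Q : Finset ι} {J : ι → Ω → ℝ} {u : ι → Finset ι → ℝ} (h : IsTruncated μ Q J u) (q : ι) : BddMeas (J q) :=
  bddMeas_of_zero_or_one (h.meas q) (h.zero_or_one q)

/-- Induction on `S`. As `J s` is 0 or 1, `G (y + b s * J s)` equals `G y + J s * (G (y + b s) - G
y)`. The first part no longer involves `s`; the second moves `s` into the product over `A` and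
replaces `G` by its difference. The product over `A` is present only to close this induction; for `S
= ∅` the claim is the expansion that defines `u`. -/
lemma IsTruncated.integral_mul_prod_comp (h : IsTruncated μ Q J u) {q : ι} (hq : q ∈ Q)
    (b : ι → ℝ) {A S : Finset ι} (hA : A ⊆ Q) (hS : S ⊆ Q) (hqA : q ∉ A) (hqS : q ∉ S)
    (hAS : Disjoint A S) {G : ℝ → ℝ} (hG : Continuous G) (x : ℝ) :
    ∫ η, J q η * (∏ r ∈ A, J r η) * G (x + ∑ r ∈ S, b r * J r η) ∂μ =
      ∑ B' ∈ A.powerset, ∑ B ∈ S.powerset, u q (B' ∪ B) *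
        ∫ η, (∏ r ∈ A \ B', J r η) * finDiff b B G (x + ∑ r ∈ S \ B, b r * J r η) ∂μ := by
  have hY : ∀ (T : Finset ι), BddMeas fun η => x + ∑ r ∈ T, b r * J r η := fun T =>
    (BddMeas.const x).add (BddMeas.sum fun r _ => (BddMeas.const _).mul (h.bdd r))
  have hP : ∀ (T : Finset ι), BddMeas fun η => ∏ r ∈ T, J r η := fun T =>
    BddMeas.prod fun r _ => h.bdd r
  induction S using Finset.induction_on generalizing A G with
  | empty =>
    simp only [Finset.sum_empty, add_zero, integral_mul_const, Finset.powerset_empty,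
      Finset.sum_singleton, Finset.union_empty, finDiff_empty, Finset.sdiff_self]
    rw [h.expand q hq A hA hqA, Finset.sum_mul]
    exact Finset.sum_congr rfl fun B _ => by ring
  | insert s S hs ih =>
    rw [Finset.insert_subset_iff] at hS
    rw [Finset.mem_insert, not_or] at hqS
    rw [Finset.disjoint_insert_right] at hAS
    have hG' : Continuous fun y => G (y + b s) - G y := by fun_prop
    have i1 := ih hA hS.2 hqA hqS.2 hAS.2 hG
    have i2 := ih (A := insert s A) (Finset.insert_subset hS.1 hA) hS.2
      (by simpa [hqA] using hqS.1) hqS.2 (by simp [hs, hAS.2]) hG'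
    have hdec : ∀ (F : ℝ → ℝ) (T : Finset ι) (_ : s ∉ T) (η : Ω),
        F (x + ∑ r ∈ insert s T, b r * J r η) = F (x + ∑ r ∈ T, b r * J r η) +
          J s η * (F (x + ∑ r ∈ T, b r * J r η + b s) - F (x + ∑ r ∈ T, b r * J r η)) := by
      intro F T hT η
      rw [Finset.sum_insert hT]
      rcases h.zero_or_one s η with h0 | h1
      · simp [h0]
      · rw [h1, show x + (b s * 1 + ∑ r ∈ T, b r * J r η) = x + ∑ r ∈ T, b r * J r η + b s by ring]
        ring
    have hL : ∫ η, J q η * (∏ r ∈ A, J r η) * G (x + ∑ r ∈ insert s S, b r * J r η) ∂μ =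
        ∫ η, J q η * (∏ r ∈ A, J r η) * G (x + ∑ r ∈ S, b r * J r η) ∂μ +
        ∫ η, J q η * (∏ r ∈ insert s A, J r η) * (fun y => G (y + b s) - G y)
          (x + ∑ r ∈ S, b r * J r η) ∂μ := by
      rw [← integral_add]
      · refine integral_congr_ae (ae_of_all _ fun η => ?_)
        simp only [hdec G S hs η, Finset.prod_insert hAS.1]
        ring
      · exact (((h.bdd q).mul (hP A)).mul ((hY S).comp hG)).integrable
      · exact (((h.bdd q).mul (hP _)).mul ((hY S).comp hG')).integrable
    rw [hL, i1, i2, Finset.sum_powerset_insert hAS.1, ← add_assoc, ← Finset.sum_add_distrib,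
      ← Finset.sum_add_distrib]
    refine Finset.sum_congr rfl fun B' hB' => ?_
    rw [Finset.sum_powerset_insert hs, ← Finset.sum_add_distrib]
    rw [Finset.mem_powerset] at hB'
    have hsB' : s ∉ B' := fun hh => hAS.1 (hB' hh)
    -- Sets `B` without `s` collect one term from each of `i1` and `i2`, recombined by `hdec`; sets
    -- `B` containing `s` come from the terms of `i2` in which `s` is used by `u`.
    congr 1
    · refine Finset.sum_congr rfl fun B hB => ?_
      rw [Finset.mem_powerset] at hB
      have hsB : s ∉ B := fun hh => hs (hB hh)
      rw [← mul_add, ← integral_add]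
      · congr 1
        refine integral_congr_ae (ae_of_all _ fun η => ?_)
        simp only
        rw [Finset.insert_sdiff_of_notMem _ hsB, Finset.insert_sdiff_of_notMem _ hsB',
          hdec (finDiff b B G) _ (by simp [hs]), Finset.prod_insert (by simp [hAS.1]),
          ← finDiff_insert' b hsB, finDiff_insert b hsB]
        ring
      · exact ((hP _).mul ((hY _).comp (continuous_finDiff b B hG))).integrable
      · exact ((hP _).mul ((hY _).comp (continuous_finDiff b B hG'))).integrable
    · refine Finset.sum_congr rfl fun B hB => ?_
      rw [Finset.mem_powerset] at hB
      have hsB : s ∉ B := fun hh => hs (hB hh)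
      rw [Finset.insert_union, Finset.union_insert, Finset.insert_sdiff_insert,
        Finset.insert_sdiff_insert, Finset.sdiff_insert_of_notMem hAS.1,
        Finset.sdiff_insert_of_notMem hs]
      simp only [finDiff_insert' b hsB]

/-- Integration by parts for a function of a linear statistic of the other variables. -/
theorem IsTruncated.integral_mul_comp (h : IsTruncated μ Q J u) {q : ι} (hq : q ∈ Q)
    (b : ι → ℝ) {S : Finset ι} (hS : S ⊆ Q) (hqS : q ∉ S) {G : ℝ → ℝ} (hG : Continuous G) (x : ℝ) :
    ∫ η, J q η * G (x + ∑ r ∈ S, b r * J r η) ∂μ =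
      ∑ B ∈ S.powerset, u q B *
        ∫ η, finDiff b B G (x + ∑ r ∈ S \ B, b r * J r η) ∂μ := by
  simpa using h.integral_mul_prod_comp hq b (A := ∅) (by simp) hS (by simp) hqS (by simp) hG x

lemma IsTruncated.trunc_empty (h : IsTruncated μ Q J u) {q : ι} (hq : q ∈ Q) :
    u q ∅ = ∫ η, J q η ∂μ := by
  have := h.expand q hq ∅ (by simp) (by simp)
  simpa using this.symm

lemma IsTruncated.trunc_singleton (h : IsTruncated μ Q J u) {q r : ι} (hq : q ∈ Q) (hr : r ∈ Q)
    (hqr : q ≠ r) :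
    u q {r} = ∫ η, J q η * J r η ∂μ - (∫ η, J q η ∂μ) * ∫ η, J r η ∂μ := by
  have := h.expand q hq {r} (by simpa using hr) (by simpa using hqr)
  have hpow : ({r} : Finset ι).powerset = {∅, {r}} := by
    ext B
    simp [Finset.subset_singleton_iff]
  rw [hpow, Finset.sum_pair (by simp)] at this
  simp [h.trunc_empty hq] at this
  linarith

end IntegrationByParts

/-! ### Integration by parts for centred linear statistics -/

section MomentRecursion

/-- The function `y ↦ G 0 y - y * G 1 z` has a small derivative within distance `ρ` of `z`. The
slope is taken at `z`, not at `x`, because the derivative at the full statistic is wanted. -/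
lemma PolyGrowth.abs_taylor_le {m k : ℕ} {C : ℝ} (hC : 0 ≤ C) {G : ℕ → ℝ → ℝ}
    (hG : PolyGrowth m k C G) {x h z ρ K : ℝ} (hx : |x - z| ≤ ρ) (hxh : |x + h - z| ≤ ρ)
    (hK : 1 ≤ K) (hρ : 1 + |z| + ρ ≤ K * (1 + |z|)) :
    |G 0 (x + h) - G 0 x - h * G 1 z| ≤ |h| * (ρ * (C * K ^ m * polyWeight m (2 + k) z)) := by
  have hρ0 : 0 ≤ ρ := (abs_nonneg _).trans hx
  have hb : ∀ y ∈ segment ℝ x (x + h), ‖G 1 y - G 1 z‖ ≤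
      ρ * (C * K ^ m * polyWeight m (2 + k) z) := by
    intro y hy
    have hyz : |y - z| ≤ ρ := by
      have hs : segment ℝ x (x + h) ⊆ Metric.closedBall z ρ :=
        (convex_closedBall z ρ).segment_subset (by simpa [Real.dist_eq] using hx)
          (by simpa [Real.dist_eq] using hxh)
      simpa [Real.dist_eq] using hs hy
    have := hG.abs_sub_le hC 1 (x := z) (h := y - z) (K := K) (z := z) hK (by linarith)
    rw [show z + (y - z) = y by ring, show 1 + 1 + k = 2 + k by ring] at this
    refine this.trans (mul_le_mul_of_nonneg_right hyz ?_)
    have := polyWeight_nonneg m (2 + k) z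
    positivity
  have := (convex_segment x (x + h)).norm_image_sub_le_of_norm_hasDerivWithin_le
    (f := fun y => G 0 y - y * G 1 z) (f' := fun y => G 1 y - G 1 z)
    (fun y _ => by
      simpa using ((hG.deriv 0 y).fun_sub ((hasDerivAt_id y).mul_const (G 1 z))).hasDerivWithinAt) hb
    (left_mem_segment ℝ _ _) (right_mem_segment ℝ _ _)
  simp only [Real.norm_eq_abs, add_sub_cancel_left] at this
  rw [mul_comm |h|]
  refine le_trans (le_of_eq ?_) this
  congr 1
  ring

variable {Ω ι : Type*} [MeasurableSpace Ω] [DecidableEq ι] {μ : Measure Ω} [IsProbabilityMeasure μ]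
  {Q : Finset ι} {J : ι → Ω → ℝ} {u : ι → Finset ι → ℝ}

/-- The centred linear statistic with coefficients `a`. -/
noncomputable def linStat {Ω ι : Type*} [MeasurableSpace Ω] (μ : Measure Ω) (J : ι → Ω → ℝ)
    (a : ι → ℝ) (S : Finset ι) (η : Ω) : ℝ :=
  ∑ r ∈ S, a r * (J r η - ∫ η', J r η' ∂μ)

/-- Bounds for the coefficients of a linear statistic and for the truncated correlations. -/
structure StatBounds (Q : Finset ι) (u : ι → Finset ι → ℝ) (a : ι → ℝ) (α : ℝ) (U : ℕ → ℝ) :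
    Prop where
  nonneg : 0 ≤ α
  le_one : α ≤ 1
  coeff : ∀ r ∈ Q, |a r| ≤ α
  trunc : ∀ q ∈ Q, ∀ k, 1 ≤ k → ∑ B ∈ (Q.erase q).powersetCard k, |u q B| ≤ U k

/-- The constant in the moment recursion. -/
noncomputable def momentConst (m : ℕ) : ℝ := 3 * (2 ^ m) ^ m * (m + 4) ^ m

/-- `momentConst` has to dominate two constants: `3 * 4 ^ m` from the Taylor estimates, and `(2 ^ m)
^ j * (m + 4) ^ m` from `j` finite differences. -/
lemma three_mul_four_pow_le (m : ℕ) : 3 * 4 ^ m ≤ momentConst m := by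
  unfold momentConst
  have h1 : (1 : ℝ) ≤ (2 ^ m) ^ m := one_le_pow₀ (one_le_pow₀ (by norm_num))
  have h2 : (4 : ℝ) ^ m ≤ (m + 4) ^ m := by
    gcongr
    linarith [(Nat.cast_nonneg m : (0 : ℝ) ≤ m)]
  nlinarith [pow_pos (show (0 : ℝ) < 4 by norm_num) m]

lemma pow_mul_pow_le_momentConst {m j : ℕ} (hj : j ≤ m) :
    (2 ^ m) ^ j * (m + 4 : ℝ) ^ m ≤ momentConst m := by
  unfold momentConst
  have h1 : ((2 : ℝ) ^ m) ^ j ≤ (2 ^ m) ^ m :=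
    pow_le_pow_right₀ (one_le_pow₀ (by norm_num)) hj
  have h3 : (0 : ℝ) ≤ (m + 4 : ℝ) ^ m := by positivity
  have h4 : (0 : ℝ) ≤ (2 ^ m) ^ m := by positivity
  nlinarith [mul_le_mul_of_nonneg_right h1 h3, mul_nonneg h4 h3]

lemma momentConst_nonneg (m : ℕ) : 0 ≤ momentConst m := by unfold momentConst; positivity

lemma StatBounds.trunc_nonneg {Q : Finset ι} {a : ι → ℝ} {α : ℝ} {U : ℕ → ℝ}
    (hs : StatBounds Q u a α U) {q : ι} (hq : q ∈ Q) {k : ℕ} (hk : 1 ≤ k) : 0 ≤ U k :=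
  (Finset.sum_nonneg fun _ _ => abs_nonneg _).trans (hs.trunc q hq k hk)

lemma IsTruncated.bdd_linStat {a : ι → ℝ} (h : IsTruncated μ Q J u) (S : Finset ι) :
    BddMeas (linStat μ J a S) :=
  BddMeas.sum fun r _ => (BddMeas.const _).mul ((h.bdd r).sub (BddMeas.const _))

lemma IsTruncated.integral_mem {Q : Finset ι} (h : IsTruncated μ Q J u) (r : ι) :
    0 ≤ ∫ η, J r η ∂μ ∧ ∫ η, J r η ∂μ ≤ 1 := by
  constructor
  · exact integral_nonneg fun η => by rcases h.zero_or_one r η with h | h <;> simp [h]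
  · calc ∫ η, J r η ∂μ ≤ ∫ _, (1 : ℝ) ∂μ := by
          refine integral_mono (h.bdd r).integrable (integrable_const _) fun η => ?_
          rcases h.zero_or_one r η with h | h <;> simp [h]
      _ = 1 := by simp

lemma IsTruncated.abs_sub_le_one {Q : Finset ι} (h : IsTruncated μ Q J u) (r : ι) (η : Ω) :
    |J r η - ∫ η', J r η' ∂μ| ≤ 1 := by
  have := h.integral_mem r
  rw [abs_le]
  rcases h.zero_or_one r η with h | h <;> rw [h] <;> constructor <;> linarith

variable {a : ι → ℝ} {α : ℝ} {U : ℕ → ℝ}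

/-- The argument of the finite difference over `B` in the integration by parts. -/
noncomputable def linShift {Ω ι : Type*} [MeasurableSpace Ω] [DecidableEq ι] (μ : Measure Ω)
    (J : ι → Ω → ℝ) (a : ι → ℝ) (S B : Finset ι) (η : Ω) : ℝ :=
  -∑ r ∈ S, a r * ∫ η', J r η' ∂μ + ∑ r ∈ S \ B, a r * J r η

lemma IsTruncated.bdd_linShift (h : IsTruncated μ Q J u) (S B : Finset ι) :
    BddMeas (linShift μ J a S B) :=
  (BddMeas.const _).add (BddMeas.sum fun r _ => (BddMeas.const _).mul (h.bdd r))

lemma linStat_sub_linShift (μ : Measure Ω) (J : ι → Ω → ℝ) (a : ι → ℝ) {q : ι} (hq : q ∈ Q)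
    {B : Finset ι} (hB : B ⊆ Q.erase q) (η : Ω) :
    linStat μ J a Q η - linShift μ J a (Q.erase q) B η =
      a q * (J q η - ∫ η', J q η' ∂μ) + ∑ r ∈ B, a r * J r η := by
  unfold linStat linShift
  rw [← Finset.add_sum_erase _ _ hq]
  have h1 : ∑ r ∈ Q.erase q, a r * (J r η - ∫ η', J r η' ∂μ) =
      ∑ r ∈ Q.erase q, a r * J r η - ∑ r ∈ Q.erase q, a r * ∫ η', J r η' ∂μ := by
    rw [← Finset.sum_sub_distrib]
    exact Finset.sum_congr rfl fun r _ => by ring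
  rw [h1, ← Finset.sum_sdiff hB]
  ring

lemma IsTruncated.abs_linStat_sub_linShift_le (h : IsTruncated μ Q J u) (hs : StatBounds Q u a α U)
    {q : ι} (hq : q ∈ Q) {B : Finset ι} (hB : B ⊆ Q.erase q) (η : Ω) :
    |linStat μ J a Q η - linShift μ J a (Q.erase q) B η| ≤ (B.card + 1) * α := by
  rw [linStat_sub_linShift μ J a hq hB]
  have h1 : |a q * (J q η - ∫ η', J q η' ∂μ)| ≤ α := by
    rw [abs_mul]
    exact (mul_le_of_le_one_right (abs_nonneg _) (h.abs_sub_le_one q η)).trans (hs.coeff q hq)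
  have h2 : |∑ r ∈ B, a r * J r η| ≤ B.card * α := by
    refine (Finset.abs_sum_le_sum_abs _ _).trans ?_
    rw [← nsmul_eq_mul]
    refine Finset.sum_le_card_nsmul _ _ _ fun r hr => ?_
    have hrQ := Finset.mem_of_mem_erase (hB hr)
    rw [abs_mul]
    refine (mul_le_of_le_one_right (abs_nonneg _) ?_).trans (hs.coeff r hrQ)
    rcases h.zero_or_one r η with h | h <;> simp [h]
  calc _ ≤ _ := abs_add_le _ _
    _ ≤ α + B.card * α := add_le_add h1 h2
    _ = _ := by ring

/-- Each of the `B.card` steps is at most `α` and lowers the degree by one, so more than `m` steps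
give 0. The argument is within `(B.card + 1) * α ≤ m + 1` of the full statistic, so the weight is
moved there at the cost of `(m + 4) ^ m`. As `B` is not empty, no power above `m - 1` remains. -/
lemma IsTruncated.abs_finDiff_linShift_le (h : IsTruncated μ Q J u) (hs : StatBounds Q u a α U)
    {m k : ℕ} {C : ℝ} (hC : 0 ≤ C) {G : ℕ → ℝ → ℝ} (hG : PolyGrowth m k C G)
    {q : ι} (hq : q ∈ Q) {B : Finset ι} (hB : B ⊆ Q.erase q) (hB1 : 1 ≤ B.card) (η : Ω) :
    |finDiff a B (G 0) (linShift μ J a (Q.erase q) B η)| ≤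
      if B.card ≤ m then momentConst m * C * α ^ B.card * (1 + |linStat μ J a Q η|) ^ (m - 1)
      else 0 := by
  have hBQ : ∀ r ∈ B, |a r| ≤ α := fun r hr => hs.coeff r (Finset.mem_of_mem_erase (hB hr))
  have hα := hs.nonneg
  refine (hG.abs_finDiff_le hC (fun r hr => (hBQ r hr).trans hs.le_one) _).trans ?_
  split_ifs with hm
  · have hd := h.abs_linStat_sub_linShift_le hs hq hB η
    set W := linStat μ J a Q η
    set ξ := linShift μ J a (Q.erase q) B η
    have h1 : 1 + |ξ| ≤ (m + 4 : ℝ) * (1 + |W|) := by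
      have hc : (B.card : ℝ) ≤ m := by exact_mod_cast hm
      have h3 : ((B.card : ℝ) + 1) * α ≤ m + 1 := by
        have := hs.le_one
        nlinarith
      have h4 : |ξ| ≤ |W| + |W - ξ| := by
        have := abs_sub_abs_le_abs_sub ξ W
        rw [abs_sub_comm ξ W] at this
        linarith
      have h5 : (0 : ℝ) ≤ m := Nat.cast_nonneg m
      have h6 := abs_nonneg W
      nlinarith [mul_nonneg h5 h6]
    have h2 : polyWeight m (k + B.card) ξ ≤ (m + 4 : ℝ) ^ m * (1 + |W|) ^ (m - 1) :=
      (polyWeight_le (by linarith [(Nat.cast_nonneg m : (0 : ℝ) ≤ m)]) h1).trans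
        (mul_le_mul_of_nonneg_left (polyWeight_le_pow (by omega) _) (by positivity))
    have h3 : ∏ r ∈ B, |a r| ≤ α ^ B.card := by
      rw [← Finset.prod_const]
      exact Finset.prod_le_prod (fun _ _ => abs_nonneg _) hBQ
    have h7 : 0 ≤ ∏ r ∈ B, |a r| := Finset.prod_nonneg fun _ _ => abs_nonneg _
    have h8 := polyWeight_nonneg m (k + B.card) ξ
    calc (2 ^ m) ^ B.card * (∏ r ∈ B, |a r|) * C * polyWeight m (k + B.card) ξ
        ≤ (2 ^ m) ^ B.card * α ^ B.card * C * ((m + 4 : ℝ) ^ m * (1 + |W|) ^ (m - 1)) := by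
          gcongr
      _ = ((2 ^ m) ^ B.card * (m + 4 : ℝ) ^ m) * (C * α ^ B.card * (1 + |W|) ^ (m - 1)) := by ring
      _ ≤ momentConst m * (C * α ^ B.card * (1 + |W|) ^ (m - 1)) :=
          mul_le_mul_of_nonneg_right (pow_mul_pow_le_momentConst hm) (by positivity)
      _ = _ := by ring
  · rw [polyWeight, if_neg (by omega)]
    simp

lemma abs_integral_le_of_forall {f g : Ω → ℝ} (hg : BddMeas g) (hfg : ∀ η, |f η| ≤ g η) :
    |∫ η, f η ∂μ| ≤ ∫ η, g η ∂μ := by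
  exact norm_integral_le_of_norm_le (μ := μ) (f := f) hg.integrable (ae_of_all _ hfg)

/-- The moment `E (1 + |W|)^i` of the statistic `W`. -/
noncomputable def absMoment {Ω : Type*} [MeasurableSpace Ω] (μ : Measure Ω) (W : Ω → ℝ)
    (i : ℕ) : ℝ := ∫ η, (1 + |W η|) ^ i ∂μ

lemma BddMeas.absPow {W : Ω → ℝ} (hW : BddMeas W) (i : ℕ) : BddMeas fun η => (1 + |W η|) ^ i :=
  hW.comp (G := fun x => (1 + |x|) ^ i) (by fun_prop)

lemma absMoment_nonneg (μ : Measure Ω) (W : Ω → ℝ) (i : ℕ) : 0 ≤ absMoment μ W i :=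
  integral_nonneg fun _ => by positivity

/-- The sets `B` are grouped by their size `j`: the differences give `α ^ j`, the truncated
correlations give `U j`, and sizes above `m` vanish. -/
lemma IsTruncated.abs_sum_trunc_le (h : IsTruncated μ Q J u) (hs : StatBounds Q u a α U)
    {m k : ℕ} {C : ℝ} (hC : 0 ≤ C) {G : ℕ → ℝ → ℝ} (hG : PolyGrowth m k C G)
    {q : ι} (hq : q ∈ Q) {k₀ : ℕ} (hk₀ : 1 ≤ k₀) :
    |∑ B ∈ (Q.erase q).powerset.filter (fun B => k₀ ≤ B.card), u q B *
        ∫ η, finDiff a B (G 0) (linShift μ J a (Q.erase q) B η) ∂μ| ≤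
      momentConst m * C * absMoment μ (linStat μ J a Q) (m - 1) *
        ∑ j ∈ Finset.Icc k₀ m, α ^ j * U j := by
  set D := momentConst m * C * absMoment μ (linStat μ J a Q) (m - 1) with hD
  have hα := hs.nonneg
  have hD0 : 0 ≤ D :=
    mul_nonneg (mul_nonneg (momentConst_nonneg m) hC) (absMoment_nonneg _ _ _)
  have hone : ∀ B ∈ (Q.erase q).powerset.filter (fun B => k₀ ≤ B.card),
      |u q B * ∫ η, finDiff a B (G 0) (linShift μ J a (Q.erase q) B η) ∂μ| ≤
        if B.card ≤ m then |u q B| * (D * α ^ B.card) else 0 := by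
    intro B hB
    rw [Finset.mem_filter, Finset.mem_powerset] at hB
    have hp := h.abs_finDiff_linShift_le hs hC hG hq hB.1 (hk₀.trans hB.2)
    rw [abs_mul]
    split_ifs with hm
    · refine mul_le_mul_of_nonneg_left ?_ (abs_nonneg _)
      simp only [hm, if_true] at hp
      refine (abs_integral_le_of_forall
        ((BddMeas.const _).mul ((h.bdd_linStat Q).absPow (m - 1))) hp).trans (le_of_eq ?_)
      rw [integral_const_mul, hD, absMoment]
      ring
    · simp only [hm, if_false] at hp
      have : ∀ η, finDiff a B (G 0) (linShift μ J a (Q.erase q) B η) = 0 := fun η =>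
        abs_nonpos_iff.1 (hp η)
      simp [this]
  calc _ ≤ ∑ B ∈ (Q.erase q).powerset.filter (fun B => k₀ ≤ B.card),
        |u q B * ∫ η, finDiff a B (G 0) (linShift μ J a (Q.erase q) B η) ∂μ| :=
        Finset.abs_sum_le_sum_abs _ _
    _ ≤ ∑ B ∈ (Q.erase q).powerset.filter (fun B => k₀ ≤ B.card),
        if B.card ≤ m then |u q B| * (D * α ^ B.card) else 0 := Finset.sum_le_sum hone
    _ = ∑ B ∈ (Q.erase q).powerset.filter (fun B => B.card ∈ Finset.Icc k₀ m),
        |u q B| * (D * α ^ B.card) := by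
        rw [← Finset.sum_filter, Finset.filter_filter]
        refine Finset.sum_congr ?_ fun _ _ => rfl
        ext B
        simp
    _ = ∑ j ∈ Finset.Icc k₀ m, ∑ B ∈ (Q.erase q).powersetCard j, |u q B| * (D * α ^ j) := by
        rw [← Finset.sum_fiberwise_of_maps_to (g := Finset.card) (t := Finset.Icc k₀ m)]
        · refine Finset.sum_congr rfl fun j hj => ?_
          rw [Finset.powersetCard_eq_filter, Finset.filter_filter]
          refine Finset.sum_congr ?_ ?_
          · ext B
            simp only [Finset.mem_filter]
            constructor
            · rintro ⟨h1, _, h3⟩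
              exact ⟨h1, h3⟩
            · rintro ⟨h1, h3⟩
              exact ⟨h1, h3 ▸ hj, h3⟩
          · intro B hB
            rw [(Finset.mem_filter.1 hB).2]
        · intro B hB
          exact (Finset.mem_filter.1 hB).2
    _ ≤ ∑ j ∈ Finset.Icc k₀ m, U j * (D * α ^ j) := by
        refine Finset.sum_le_sum fun j hj => ?_
        rw [← Finset.sum_mul]
        refine mul_le_mul_of_nonneg_right ?_ (by positivity)
        exact hs.trunc q hq j (hk₀.trans (Finset.mem_Icc.1 hj).1)
    _ = _ := by
        rw [Finset.mul_sum]
        exact Finset.sum_congr rfl fun j _ => by ring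

/-- Centring `J q` removes exactly the term `B = ∅`, since `u q ∅` is the mean of `J q`. -/
lemma IsTruncated.integral_centered_mul_comp (h : IsTruncated μ Q J u) {q : ι} (hq : q ∈ Q)
    (a : ι → ℝ) {G : ℝ → ℝ} (hG : Continuous G) :
    ∫ η, (J q η - ∫ η', J q η' ∂μ) * G (linStat μ J a (Q.erase q) η) ∂μ =
      ∑ B ∈ (Q.erase q).powerset.filter (fun B => 1 ≤ B.card), u q B *
        ∫ η, finDiff a B G (linShift μ J a (Q.erase q) B η) ∂μ := by
  have hst : ∀ η, linStat μ J a (Q.erase q) η =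
      -∑ r ∈ Q.erase q, a r * ∫ η', J r η' ∂μ + ∑ r ∈ Q.erase q, a r * J r η := by
    intro η
    unfold linStat
    rw [← sub_eq_neg_add, ← Finset.sum_sub_distrib]
    exact Finset.sum_congr rfl fun r _ => by ring
  have hb := (h.bdd_linStat (a := a) (Q.erase q)).comp hG
  have h1 := h.integral_mul_comp hq a (Finset.erase_subset q Q) (Finset.notMem_erase q Q) hG
    (-∑ r ∈ Q.erase q, a r * ∫ η', J r η' ∂μ)
  simp only [← hst] at h1
  have h2 : ∫ η, (J q η - ∫ η', J q η' ∂μ) * G (linStat μ J a (Q.erase q) η) ∂μ =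
      ∫ η, J q η * G (linStat μ J a (Q.erase q) η) ∂μ -
        (∫ η', J q η' ∂μ) * ∫ η, G (linStat μ J a (Q.erase q) η) ∂μ := by
    simp only [sub_mul]
    rw [integral_sub ((h.bdd q).mul hb).integrable
      ((BddMeas.const _).mul hb).integrable, integral_const_mul]
  have hfil : (Q.erase q).powerset.filter (fun B => 1 ≤ B.card) = (Q.erase q).powerset.erase ∅ := by
    ext B
    simp only [Finset.mem_filter, Finset.mem_erase, Finset.one_le_card,
      Finset.nonempty_iff_ne_empty]
    tauto
  rw [h2, h1, hfil, ← Finset.add_sum_erase _ _ (Finset.empty_mem_powerset (Q.erase q)),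
    h.trunc_empty hq]
  have h3 : ∀ η, finDiff a ∅ G (-∑ r ∈ Q.erase q, a r * ∫ η', J r η' ∂μ +
      ∑ r ∈ Q.erase q \ ∅, a r * J r η) = G (linStat μ J a (Q.erase q) η) := fun η => by
    rw [finDiff_empty, Finset.sdiff_empty, hst]
  simp only [h3]
  rw [add_sub_cancel_left]
  rfl

/-- The covariance of `J q` and `J r`. -/
noncomputable def indCov {Ω ι : Type*} [MeasurableSpace Ω] (μ : Measure Ω) (J : ι → Ω → ℝ)
    (q r : ι) : ℝ :=
  ∫ η, J q η * J r η ∂μ - (∫ η, J q η ∂μ) * ∫ η, J r η ∂μ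

end MomentRecursion

/-! ### The approximate Gaussian recursion with explicit error -/

section MomentRecursionBound

variable {Ω ι : Type*} [MeasurableSpace Ω] [DecidableEq ι] {μ : Measure Ω} [IsProbabilityMeasure μ]
  {Q : Finset ι} {J : ι → Ω → ℝ} {u : ι → Finset ι → ℝ} {a : ι → ℝ} {α : ℝ} {U : ℕ → ℝ}

/-- The part of the integration by parts coming from a single other variable. -/
lemma IsTruncated.abs_sum_singleton_sub_le (h : IsTruncated μ Q J u) (hs : StatBounds Q u a α U)
    {m : ℕ} {C : ℝ} (hC : 0 ≤ C) {G : ℕ → ℝ → ℝ} (hG : PolyGrowth m 0 C G)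
    {q : ι} (hq : q ∈ Q) :
    |∑ r ∈ Q.erase q, u q {r} * ∫ η, finDiff a {r} (G 0) (linShift μ J a (Q.erase q) {r} η) ∂μ -
        (∑ r ∈ Q.erase q, u q {r} * a r) * ∫ η, G 1 (linStat μ J a Q η) ∂μ| ≤
      momentConst m * C * absMoment μ (linStat μ J a Q) (m - 1) * (α ^ 2 * U 1) := by
  have hα := hs.nonneg
  set W := linStat μ J a Q with hW
  have hWb : BddMeas W := h.bdd_linStat Q
  set e := absMoment μ W (m - 1) with he
  have he0 : 0 ≤ e := absMoment_nonneg _ _ _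
  have hone : ∀ r ∈ Q.erase q,
      |∫ η, finDiff a {r} (G 0) (linShift μ J a (Q.erase q) {r} η) ∂μ - a r * ∫ η, G 1 (W η) ∂μ| ≤
        momentConst m * C * e * α ^ 2 := by
    intro r hr
    have hrQ := Finset.mem_of_mem_erase hr
    have hrα := hs.coeff r hrQ
    have hξ : BddMeas (linShift μ J a (Q.erase q) {r}) := h.bdd_linShift _ _
    have hF : BddMeas fun η => finDiff a {r} (G 0) (linShift μ J a (Q.erase q) {r} η) :=
      hξ.comp (continuous_finDiff _ _ (hG.continuous 0))
    have hG1 : BddMeas fun η => G 1 (W η) := hWb.comp (hG.continuous 1)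
    rw [← integral_const_mul, ← integral_sub hF.integrable
      ((BddMeas.const (a r)).mul hG1).integrable]
    have hpt : ∀ η, |finDiff a {r} (G 0) (linShift μ J a (Q.erase q) {r} η) - a r * G 1 (W η)| ≤
        momentConst m * C * α ^ 2 * (1 + |W η|) ^ (m - 1) := by
      intro η
      rw [finDiff_singleton]
      have hd := h.abs_linStat_sub_linShift_le hs hq (B := {r})
        (by simpa using hr) η
      rw [Finset.card_singleton] at hd
      push_cast at hd
      set ξ := linShift μ J a (Q.erase q) {r} η
      have h1 : |ξ - W η| ≤ 3 * α := by
        rw [abs_sub_comm]; exact hd.trans (by linarith)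
      have h2 : |ξ + a r - W η| ≤ 3 * α := by
        calc |ξ + a r - W η| = |(ξ - W η) + a r| := by ring_nf
          _ ≤ |ξ - W η| + |a r| := abs_add_le _ _
          _ ≤ (1 + 1) * α + α := by rw [abs_sub_comm]; exact add_le_add hd hrα
          _ = _ := by ring
      have := hG.abs_taylor_le hC h1 h2 (K := 4) (by norm_num)
        (by have := hs.le_one; linarith [abs_nonneg (W η)])
      refine this.trans ?_
      have hw : polyWeight m (2 + 0) (W η) ≤ (1 + |W η|) ^ (m - 1) :=
        polyWeight_le_pow (by omega) _
      have hw0 := polyWeight_nonneg m (2 + 0) (W η)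
      calc |a r| * (3 * α * (C * 4 ^ m * polyWeight m (2 + 0) (W η)))
          ≤ α * (3 * α * (C * 4 ^ m * (1 + |W η|) ^ (m - 1))) := by gcongr
        _ = (3 * 4 ^ m) * (C * α ^ 2 * (1 + |W η|) ^ (m - 1)) := by ring
        _ ≤ momentConst m * (C * α ^ 2 * (1 + |W η|) ^ (m - 1)) :=
          mul_le_mul_of_nonneg_right (three_mul_four_pow_le m) (by positivity)
        _ = _ := by ring
    refine (abs_integral_le_of_forall
      ((BddMeas.const _).mul (hWb.absPow (m - 1))) hpt).trans (le_of_eq ?_)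
    rw [integral_const_mul, he, absMoment]
    ring
  have hU : ∑ r ∈ Q.erase q, |u q {r}| ≤ U 1 := by
    have := hs.trunc q hq 1 le_rfl
    rwa [Finset.powersetCard_one, Finset.sum_map] at this
  rw [Finset.sum_mul, ← Finset.sum_sub_distrib]
  calc _ ≤ ∑ r ∈ Q.erase q, |u q {r}| * (momentConst m * C * e * α ^ 2) := by
        refine (Finset.abs_sum_le_sum_abs _ _).trans (Finset.sum_le_sum fun r hr => ?_)
        rw [mul_assoc (u q {r}), ← mul_sub, abs_mul]
        exact mul_le_mul_of_nonneg_left (hone r hr) (abs_nonneg _)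
    _ ≤ U 1 * (momentConst m * C * e * α ^ 2) := by
        rw [← Finset.sum_mul]
        exact mul_le_mul_of_nonneg_right hU
          (mul_nonneg (mul_nonneg (mul_nonneg (momentConst_nonneg m) hC) he0) (by positivity))
    _ = _ := by ring

/-- The sets `B = {r}` produce the covariances times the mean of the derivative, after
linearisation; sets with two or more elements are error terms. -/
lemma IsTruncated.abs_centered_sub_le (h : IsTruncated μ Q J u) (hs : StatBounds Q u a α U)
    {m : ℕ} {C : ℝ} (hC : 0 ≤ C) {G : ℕ → ℝ → ℝ} (hG : PolyGrowth m 0 C G)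
    {q : ι} (hq : q ∈ Q) :
    |∫ η, (J q η - ∫ η', J q η' ∂μ) * G 0 (linStat μ J a (Q.erase q) η) ∂μ -
        (∑ r ∈ Q.erase q, indCov μ J q r * a r) * ∫ η, G 1 (linStat μ J a Q η) ∂μ| ≤
      momentConst m * C * absMoment μ (linStat μ J a Q) (m - 1) *
        (α ^ 2 * U 1 + ∑ j ∈ Finset.Icc 2 m, α ^ j * U j) := by
  rw [h.integral_centered_mul_comp hq a (hG.continuous 0)]
  have hcov : ∑ r ∈ Q.erase q, indCov μ J q r * a r = ∑ r ∈ Q.erase q, u q {r} * a r := by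
    refine Finset.sum_congr rfl fun r hr => ?_
    rw [Finset.mem_erase] at hr
    rw [h.trunc_singleton hq hr.2 hr.1.symm, indCov]
  have hsplit : ∀ f : Finset ι → ℝ,
      ∑ B ∈ (Q.erase q).powerset.filter (fun B => 1 ≤ B.card), f B =
        ∑ r ∈ Q.erase q, f {r} + ∑ B ∈ (Q.erase q).powerset.filter (fun B => 2 ≤ B.card), f B := by
    intro f
    have h1 : ∑ r ∈ Q.erase q, f {r} = ∑ B ∈ (Q.erase q).powersetCard 1, f B := by
      rw [Finset.powersetCard_one, Finset.sum_map]
      rfl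
    rw [h1, ← Finset.sum_union]
    · refine Finset.sum_congr ?_ fun _ _ => rfl
      ext B
      simp only [Finset.mem_filter, Finset.mem_powerset, Finset.mem_union, Finset.mem_powersetCard]
      rw [← and_or_left]
      refine and_congr_right fun _ => ?_
      omega
    · rw [Finset.disjoint_left]
      intro B h1 h2
      rw [Finset.mem_powersetCard] at h1
      rw [Finset.mem_filter] at h2
      omega
  rw [hsplit, hcov]
  have e1 := h.abs_sum_singleton_sub_le hs hC hG hq
  have e2 := h.abs_sum_trunc_le hs hC hG hq (k₀ := 2) (by norm_num)
  rw [add_sub_right_comm, mul_add]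
  exact (abs_add_le _ _).trans (add_le_add e1 e2)

/-- A single centred variable is nearly uncorrelated with a function of the statistic. Removing `q`
from the statistic costs `α`, and integration by parts for the derivative `G 1` bounds the remainder
by the sum starting at `j = 1`. This controls the self-interaction of `q` in the next lemma. -/
lemma IsTruncated.abs_centered_comp_le (h : IsTruncated μ Q J u) (hs : StatBounds Q u a α U)
    {m : ℕ} {C : ℝ} (hC : 0 ≤ C) {G : ℕ → ℝ → ℝ} (hG : PolyGrowth m 0 C G)
    {q : ι} (hq : q ∈ Q) :
    |∫ η, (J q η - ∫ η', J q η' ∂μ) * G 1 (linStat μ J a Q η) ∂μ| ≤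
      momentConst m * C * absMoment μ (linStat μ J a Q) (m - 1) *
        (α + ∑ j ∈ Finset.Icc 1 m, α ^ j * U j) := by
  have hα := hs.nonneg
  set W := linStat μ J a Q with hW
  have hWb : BddMeas W := h.bdd_linStat Q
  have hYb : BddMeas (linStat μ J a (Q.erase q)) := h.bdd_linStat _
  have hZb : BddMeas fun η => J q η - ∫ η', J q η' ∂μ := (h.bdd q).sub (BddMeas.const _)
  have e1 : |∫ η, (J q η - ∫ η', J q η' ∂μ) * G 1 (linStat μ J a (Q.erase q) η) ∂μ| ≤
      momentConst m * C * absMoment μ W (m - 1) * ∑ j ∈ Finset.Icc 1 m, α ^ j * U j := by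
    rw [h.integral_centered_mul_comp hq a (hG.continuous 1)]
    exact h.abs_sum_trunc_le hs hC hG.shift hq (k₀ := 1) le_rfl
  have hpt : ∀ η, |(J q η - ∫ η', J q η' ∂μ) * G 1 (W η) -
      (J q η - ∫ η', J q η' ∂μ) * G 1 (linStat μ J a (Q.erase q) η)| ≤
        momentConst m * C * α * (1 + |W η|) ^ (m - 1) := by
    intro η
    have hdec : linStat μ J a (Q.erase q) η = W η + -(a q * (J q η - ∫ η', J q η' ∂μ)) := by
      rw [hW, linStat, linStat, ← Finset.add_sum_erase _ _ hq]
      ring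
    have hsmall : |a q * (J q η - ∫ η', J q η' ∂μ)| ≤ α := by
      rw [abs_mul]
      exact (mul_le_of_le_one_right (abs_nonneg _) (h.abs_sub_le_one q η)).trans (hs.coeff q hq)
    have h1 := hG.abs_sub_le hC 1 (x := W η) (h := -(a q * (J q η - ∫ η', J q η' ∂μ))) (K := 4)
      (z := W η) (by norm_num) (by
        rw [abs_neg]; have := hs.le_one; linarith [abs_nonneg (W η)])
    rw [← mul_sub, abs_mul, hdec, abs_sub_comm (G 1 (W η))]
    refine (mul_le_of_le_one_left (abs_nonneg _) (h.abs_sub_le_one q η)).trans (h1.trans ?_)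
    rw [abs_neg]
    have hw : polyWeight m (1 + 1 + 0) (W η) ≤ (1 + |W η|) ^ (m - 1) :=
      polyWeight_le_pow (by omega) _
    have hw0 := polyWeight_nonneg m (1 + 1 + 0) (W η)
    have h4 : (4 : ℝ) ^ m ≤ momentConst m := by
      have := three_mul_four_pow_le m
      have := pow_pos (show (0 : ℝ) < 4 by norm_num) m
      linarith
    calc _ ≤ α * (C * 4 ^ m * (1 + |W η|) ^ (m - 1)) := by gcongr
      _ = 4 ^ m * (C * α * (1 + |W η|) ^ (m - 1)) := by ring
      _ ≤ momentConst m * (C * α * (1 + |W η|) ^ (m - 1)) :=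
          mul_le_mul_of_nonneg_right h4 (by positivity)
      _ = _ := by ring
  have e2 := abs_integral_le_of_forall (μ := μ)
    ((BddMeas.const _).mul (hWb.absPow (m - 1))) hpt
  rw [integral_const_mul, integral_sub (hZb.mul (hWb.comp (hG.continuous 1))).integrable
    (hZb.mul (hYb.comp (hG.continuous 1))).integrable] at e2
  have e3 := abs_sub_abs_le_abs_sub (∫ η, (J q η - ∫ η', J q η' ∂μ) * G 1 (W η) ∂μ)
    (∫ η, (J q η - ∫ η', J q η' ∂μ) * G 1 (linStat μ J a (Q.erase q) η) ∂μ)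
  have e4 : momentConst m * C * α * ∫ η, (1 + |W η|) ^ (m - 1) ∂μ =
      momentConst m * C * absMoment μ W (m - 1) * α := by
    rw [absMoment]; ring
  rw [mul_add]
  linarith

/-- The error in the moment recursion. -/
noncomputable def momentError (α : ℝ) (U : ℕ → ℝ) (m : ℕ) : ℝ :=
  α + α * U 1 + ∑ j ∈ Finset.Icc 2 m, α ^ (j - 1) * U j

/-- Putting `q` back into the statistic creates, to first order in `a q`, the term `(J q - p) ^ 2 *
G 1`. For a 0-1 variable the square is `(1 - 2 * p) * (J q - p) + (p - p ^ 2)`. The constant is the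
missing diagonal covariance, and the centred part is small by `IsTruncated.abs_centered_comp_le`. -/
lemma IsTruncated.abs_centered_comp_sub_le (h : IsTruncated μ Q J u) (hs : StatBounds Q u a α U)
    {m : ℕ} (hm : 1 ≤ m) {C : ℝ} (hC : 0 ≤ C) {G : ℕ → ℝ → ℝ} (hG : PolyGrowth m 0 C G)
    {q : ι} (hq : q ∈ Q) :
    |∫ η, (J q η - ∫ η', J q η' ∂μ) * G 0 (linStat μ J a Q η) ∂μ -
        (∑ r ∈ Q, indCov μ J q r * a r) * ∫ η, G 1 (linStat μ J a Q η) ∂μ| ≤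
      momentConst m * C * absMoment μ (linStat μ J a Q) (m - 1) * (2 * α * momentError α U m) := by
  have hα := hs.nonneg
  have hα1 := hs.le_one
  set W := linStat μ J a Q with hW
  set p := ∫ η', J q η' ∂μ with hp
  have hWb : BddMeas W := h.bdd_linStat Q
  have hYb : BddMeas (linStat μ J a (Q.erase q)) := h.bdd_linStat _
  have hZb : BddMeas fun η => J q η - p := (h.bdd q).sub (BddMeas.const _)
  have e1 := h.abs_centered_sub_le hs hC hG hq
  have e2 := h.abs_centered_comp_le hs hC hG hq
  set D := momentConst m * C * absMoment μ W (m - 1) with hD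
  have hD0 : 0 ≤ D := mul_nonneg (mul_nonneg (momentConst_nonneg m) hC) (absMoment_nonneg _ _ _)
  have hG0 := hWb.comp (hG.continuous 0)
  have hG1 := hWb.comp (hG.continuous 1)
  have hGY := hYb.comp (hG.continuous 0)
  have hpt : ∀ η, |(J q η - p) * G 0 (W η) - (J q η - p) * G 0 (linStat μ J a (Q.erase q) η) -
      a q * ((1 - 2 * p) * ((J q η - p) * G 1 (W η)) + (p - p ^ 2) * G 1 (W η))| ≤
        momentConst m * C * α ^ 2 * (1 + |W η|) ^ (m - 1) := by
    intro η
    have hdec : W η = linStat μ J a (Q.erase q) η + a q * (J q η - p) := by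
      rw [hW, linStat, linStat, ← Finset.add_sum_erase _ _ hq]
      ring
    have hsmall : |a q * (J q η - p)| ≤ α := by
      rw [abs_mul]
      exact (mul_le_of_le_one_right (abs_nonneg _) (h.abs_sub_le_one q η)).trans (hs.coeff q hq)
    have hsq : (1 - 2 * p) * (J q η - p) + (p - p ^ 2) = (J q η - p) ^ 2 := by
      rcases h.zero_or_one q η with h0 | h0 <;> rw [h0] <;> ring
    have h1 := hG.abs_taylor_le hC (x := linStat μ J a (Q.erase q) η) (h := a q * (J q η - p))
      (z := W η) (ρ := α) (K := 4) (by
        rw [hdec, show linStat μ J a (Q.erase q) η -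
          (linStat μ J a (Q.erase q) η + a q * (J q η - p)) = -(a q * (J q η - p)) by ring, abs_neg]
        exact hsmall) (by rw [← hdec]; simpa using hα) (by norm_num)
        (by linarith [abs_nonneg (W η)])
    rw [← hdec] at h1
    have heq : (J q η - p) * G 0 (W η) - (J q η - p) * G 0 (linStat μ J a (Q.erase q) η) -
      a q * ((1 - 2 * p) * ((J q η - p) * G 1 (W η)) + (p - p ^ 2) * G 1 (W η)) =
      (J q η - p) * (G 0 (W η) - G 0 (linStat μ J a (Q.erase q) η) -
        a q * (J q η - p) * G 1 (W η)) := by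
      have : (1 - 2 * p) * ((J q η - p) * G 1 (W η)) + (p - p ^ 2) * G 1 (W η) =
          (J q η - p) ^ 2 * G 1 (W η) := by rw [← hsq]; ring
      rw [this]; ring
    rw [heq, abs_mul]
    refine (mul_le_of_le_one_left (abs_nonneg _) (h.abs_sub_le_one q η)).trans (h1.trans ?_)
    have hw : polyWeight m (2 + 0) (W η) ≤ (1 + |W η|) ^ (m - 1) :=
      polyWeight_le_pow (by omega) _
    have hw0 := polyWeight_nonneg m (2 + 0) (W η)
    have h4 : (4 : ℝ) ^ m ≤ momentConst m := by
      have := three_mul_four_pow_le m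
      have := pow_pos (show (0 : ℝ) < 4 by norm_num) m
      linarith
    calc _ ≤ α * (α * (C * 4 ^ m * (1 + |W η|) ^ (m - 1))) := by gcongr
      _ = 4 ^ m * (C * α ^ 2 * (1 + |W η|) ^ (m - 1)) := by ring
      _ ≤ momentConst m * (C * α ^ 2 * (1 + |W η|) ^ (m - 1)) :=
          mul_le_mul_of_nonneg_right h4 (by positivity)
      _ = _ := by ring
  have e3 := abs_integral_le_of_forall (μ := μ)
    ((BddMeas.const _).mul (hWb.absPow (m - 1))) hpt
  have e4 : ∫ η, momentConst m * C * α ^ 2 * (1 + |W η|) ^ (m - 1) ∂μ = D * α ^ 2 := by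
    rw [integral_const_mul, hD, absMoment]; ring
  have hA := hZb.mul hG0
  have hB := hZb.mul hGY
  have hE := (BddMeas.const (1 - 2 * p)).mul (hZb.mul hG1)
  have hF := (BddMeas.const (p - p ^ 2)).mul hG1
  rw [e4, integral_sub (hA.sub hB).integrable ((BddMeas.const _).mul (hE.add hF)).integrable,
    integral_sub hA.integrable hB.integrable, integral_const_mul,
    integral_add hE.integrable hF.integrable, integral_const_mul, integral_const_mul] at e3
  have hcovq : indCov μ J q q = p - p ^ 2 := by
    have : ∀ η, J q η * J q η = J q η := fun η => by
      rcases h.zero_or_one q η with h0 | h0 <;> rw [h0] <;> ring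
    simp only [indCov, this]
    rw [← hp]; ring
  rw [← Finset.add_sum_erase _ _ hq, hcovq]
  set X := ∫ η, G 1 (W η) ∂μ
  set R := ∫ η, (J q η - p) * G 1 (W η) ∂μ
  set S := ∑ r ∈ Q.erase q, indCov μ J q r * a r
  have hq' := hs.coeff q hq
  have hp01 : |1 - 2 * p| ≤ 1 := by
    have := h.integral_mem q
    rw [abs_le]; constructor <;> linarith
  have e5 : |a q * ((1 - 2 * p) * R)| ≤ α * (D * (α + ∑ j ∈ Finset.Icc 1 m, α ^ j * U j)) := by
    rw [abs_mul, abs_mul]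
    refine mul_le_mul hq' ?_ (by positivity) hα
    exact (mul_le_of_le_one_left (abs_nonneg _) hp01).trans e2
  set s₂ := ∑ j ∈ Finset.Icc 2 m, α ^ j * U j with hs₂
  have hs₂0 : 0 ≤ s₂ := Finset.sum_nonneg fun j hj => mul_nonneg (by positivity)
    (hs.trunc_nonneg hq (by have := (Finset.mem_Icc.1 hj).1; omega))
  have e6 : ∑ j ∈ Finset.Icc 1 m, α ^ j * U j = α * U 1 + s₂ := by
    rw [← Finset.add_sum_Ioc_eq_sum_Icc hm, pow_one]
    rfl
  have e7 : 2 * α * momentError α U m = 2 * (α ^ 2 + α ^ 2 * U 1 + s₂) := by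
    rw [momentError, hs₂, mul_add, Finset.mul_sum, mul_add, mul_add, mul_add, Finset.mul_sum]
    congr 1
    · ring
    · refine Finset.sum_congr rfl fun j hj => ?_
      have : α ^ j = α ^ (j - 1) * α := by
        rw [← pow_succ]
        congr 1
        have := (Finset.mem_Icc.1 hj).1
        omega
      rw [this]
      ring
  rw [e6] at e5
  rw [e7]
  have e8 : α * (D * (α + (α * U 1 + s₂))) ≤ D * (α ^ 2 + α ^ 2 * U 1 + s₂) := by
    have : α * (α + (α * U 1 + s₂)) ≤ α ^ 2 + α ^ 2 * U 1 + s₂ := by nlinarith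
    nlinarith [mul_le_mul_of_nonneg_left this hD0]
  have key : ∀ A B : ℝ, A - ((p - p ^ 2) * a q + S) * X = (B - S * X) +
      a q * ((1 - 2 * p) * R) + (A - B - a q * ((1 - 2 * p) * R + (p - p ^ 2) * X)) := by
    intro A B; ring
  rw [key _ (∫ η, (J q η - p) * G 0 (linStat μ J a (Q.erase q) η) ∂μ)]
  refine (abs_add_le _ _).trans ?_
  refine (add_le_add_left (abs_add_le _ _) _).trans ?_
  linarith [e1, e3, e5, e8]

/-- The variance of the linear statistic. -/
noncomputable def statVar {Ω ι : Type*} [MeasurableSpace Ω] (μ : Measure Ω) (J : ι → Ω → ℝ)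
    (a : ι → ℝ) (Q : Finset ι) : ℝ := ∑ q ∈ Q, ∑ r ∈ Q, a q * a r * indCov μ J q r

/-- The moments of `W` satisfy the recursion of the Gaussian moments up to a small error. -/
theorem IsTruncated.abs_moment_sub_le (h : IsTruncated μ Q J u) (hs : StatBounds Q u a α U)
    {m : ℕ} (hm : 1 ≤ m) :
    |∫ η, linStat μ J a Q η ^ (m + 1) ∂μ -
        statVar μ J a Q * (m * ∫ η, linStat μ J a Q η ^ (m - 1) ∂μ)| ≤
      2 * momentConst m * m.factorial * (Q.card * α ^ 2) * momentError α U m *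
        absMoment μ (linStat μ J a Q) (m - 1) := by
  have hα := hs.nonneg
  have hWb : BddMeas (linStat μ J a Q) := h.bdd_linStat Q
  have hq := fun q (hq : q ∈ Q) => h.abs_centered_comp_sub_le hs hm (Nat.cast_nonneg m.factorial)
    (polyGrowth_pow m) hq
  simp only [Nat.descFactorial_zero, Nat.sub_zero, Nat.cast_one, one_mul,
    Nat.descFactorial_one, integral_const_mul] at hq
  set W := linStat μ J a Q with hW
  -- One of the `m + 1` factors is written out as a sum over `q`; the other `m` form the function `x
  -- ^ m` in the estimate for each `q`.
  have hexp : ∫ η, W η ^ (m + 1) ∂μ =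
      ∑ q ∈ Q, a q * ∫ η, (J q η - ∫ η', J q η' ∂μ) * W η ^ m ∂μ := by
    simp only [← integral_const_mul]
    rw [← integral_finsetSum]
    · refine integral_congr_ae (ae_of_all _ fun η => ?_)
      simp only
      rw [pow_succ', hW, linStat, Finset.sum_mul]
      exact Finset.sum_congr rfl fun q _ => by ring
    · intro q _
      exact ((BddMeas.const _).mul (((h.bdd q).sub (BddMeas.const _)).mul
        (hWb.comp (G := fun x => x ^ m) (by fun_prop)))).integrable
  have hvar : statVar μ J a Q = ∑ q ∈ Q, a q * ∑ r ∈ Q, indCov μ J q r * a r := by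
    unfold statVar
    refine Finset.sum_congr rfl fun q _ => ?_
    rw [Finset.mul_sum]
    exact Finset.sum_congr rfl fun r _ => by ring
  rw [hexp, hvar, Finset.sum_mul, ← Finset.sum_sub_distrib]
  set e := absMoment μ W (m - 1)
  calc _ ≤ ∑ q ∈ Q, α * (momentConst m * m.factorial * e * (2 * α * momentError α U m)) := by
        refine (Finset.abs_sum_le_sum_abs _ _).trans (Finset.sum_le_sum fun q hqQ => ?_)
        rw [mul_assoc (a q), ← mul_sub, abs_mul]
        exact mul_le_mul (hs.coeff q hqQ) (hq q hqQ) (abs_nonneg _) hα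
    _ = _ := by
        rw [Finset.sum_const, nsmul_eq_mul]
        ring

end MomentRecursionBound

/-! ### The method of moments for characteristic functions -/

section MethodOfMoments

-- The derivative of the remainder of order `N + 1` is `c` times the remainder of order `N`, and
-- `‖c‖ = 1`; the bound is integrated from 0.
open Complex in
lemma norm_exp_mul_sub_sum_le {c : ℂ} (hre : c.re = 0) (hc : ‖c‖ = 1) (N : ℕ) {x : ℝ}
    (hx : 0 ≤ x) :
    ‖exp (c * x) - ∑ k ∈ Finset.range N, (c * x) ^ k / k.factorial‖ ≤ x ^ N / N.factorial := by
  induction N generalizing x with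
  | zero =>
    have : ‖exp (c * x)‖ = 1 := by rw [norm_exp]; simp [hre]
    simp [this]
  | succ N ih =>
    have hpow : ∀ (k : ℕ) (t : ℝ), HasDerivAt (fun t : ℝ => (c * t) ^ (k + 1) / (k + 1).factorial)
        (c * ((c * t) ^ k / k.factorial)) t := by
      intro k t
      have h1 : HasDerivAt (fun t : ℝ => c * (t : ℂ)) c t := by
        simpa using (Complex.ofRealCLM.hasDerivAt (x := t)).const_mul c
      have h2 := (h1.fun_pow (k + 1)).div_const ((k + 1).factorial : ℂ)
      refine h2.congr_deriv ?_
      have hk : ((k + 1 : ℕ) : ℂ) ≠ 0 := by exact_mod_cast Nat.succ_ne_zero k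
      have hk' : ((k.factorial : ℕ) : ℂ) ≠ 0 := by exact_mod_cast k.factorial_ne_zero
      rw [Nat.factorial_succ, Nat.cast_mul, Nat.add_sub_cancel]
      field_simp
    have hder : ∀ t : ℝ, HasDerivAt
        (fun t : ℝ => exp (c * t) - ∑ k ∈ Finset.range (N + 1), (c * t) ^ k / k.factorial)
        (c * (exp (c * t) - ∑ k ∈ Finset.range N, (c * t) ^ k / k.factorial)) t := by
      intro t
      have h1 : HasDerivAt (fun t : ℝ => c * (t : ℂ)) c t := by
        simpa using (Complex.ofRealCLM.hasDerivAt (x := t)).const_mul c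
      have h2 : HasDerivAt (fun t : ℝ => ∑ k ∈ Finset.range (N + 1), (c * t) ^ k / k.factorial)
          (c * ∑ k ∈ Finset.range N, (c * t) ^ k / k.factorial) t := by
        simp only [Finset.sum_range_succ', Finset.mul_sum]
        have := (HasDerivAt.fun_sum fun k (_ : k ∈ Finset.range N) => hpow k t).add_const
          ((c * (t : ℂ)) ^ 0 / (Nat.factorial 0 : ℂ))
        simpa using this
      refine (h1.cexp.sub h2).congr_deriv ?_
      ring
    have hB : ∀ t : ℝ, HasDerivAt (fun t : ℝ => t ^ (N + 1) / ((N + 1).factorial : ℝ))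
        (t ^ N / N.factorial) t := by
      intro t
      refine ((hasDerivAt_pow (N + 1) t).div_const _).congr_deriv ?_
      have hk : ((N + 1 : ℕ) : ℝ) ≠ 0 := by exact_mod_cast Nat.succ_ne_zero N
      have hk' : ((N.factorial : ℕ) : ℝ) ≠ 0 := by exact_mod_cast N.factorial_ne_zero
      rw [Nat.factorial_succ, Nat.cast_mul, Nat.add_sub_cancel]
      field_simp
    refine image_norm_le_of_norm_deriv_right_le_deriv_boundary (a := 0) (b := x)
      (f := fun t : ℝ => exp (c * t) - ∑ k ∈ Finset.range (N + 1), (c * t) ^ k / k.factorial)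
      (fun t _ => (hder t).continuousAt.continuousWithinAt)
      (fun t _ => (hder t).hasDerivWithinAt) ?_ hB (fun t ht => ?_) ⟨hx, le_rfl⟩
    · simp [Finset.sum_range_succ']
    · rw [norm_mul, hc, one_mul]
      exact ih ht.1

open Complex in
lemma norm_exp_I_mul_sub_sum_le (x : ℝ) (N : ℕ) :
    ‖exp (I * x) - ∑ k ∈ Finset.range N, (I * x) ^ k / k.factorial‖ ≤ |x| ^ N / N.factorial := by
  rcases le_total 0 x with hx | hx
  · rw [abs_of_nonneg hx]
    exact norm_exp_mul_sub_sum_le (by simp) (by simp) N hx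
  · rw [abs_of_nonpos hx]
    have := norm_exp_mul_sub_sum_le (c := -I) (by simp) (by simp) N (neg_nonneg.2 hx)
    simpa using this

/-- The moments of the centred Gaussian distribution with variance `s`. -/
noncomputable def gaussMoment (s : ℝ) : ℕ → ℝ
  | 0 => 1
  | 1 => 0
  | i + 2 => s * ((i + 1 : ℕ) * gaussMoment s i)

lemma gaussMoment_odd (s : ℝ) (j : ℕ) : gaussMoment s (2 * j + 1) = 0 := by
  induction j with
  | zero => rfl
  | succ j ih =>
    rw [show 2 * (j + 1) + 1 = 2 * j + 1 + 2 by ring, gaussMoment, ih]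
    simp

lemma gaussMoment_even (s : ℝ) (j : ℕ) :
    gaussMoment s (2 * j) / (2 * j).factorial = (s / 2) ^ j / j.factorial := by
  induction j with
  | zero => simp [gaussMoment]
  | succ j ih =>
    have h1 : ((2 * j).factorial : ℝ) ≠ 0 := by exact_mod_cast (2 * j).factorial_ne_zero
    have h2 : (j.factorial : ℝ) ≠ 0 := by exact_mod_cast j.factorial_ne_zero
    have h3 : ((j : ℝ) + 1) ≠ 0 := by positivity
    have h4 : (2 * (j : ℝ) + 1) ≠ 0 := by positivity
    rw [show 2 * (j + 1) = 2 * j + 2 by ring, gaussMoment, Nat.factorial_succ (2 * j + 1),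
      Nat.factorial_succ (2 * j), Nat.factorial_succ j]
    rw [div_eq_div_iff h1 h2] at ih
    push_cast
    have : gaussMoment s (2 * j) = (s / 2) ^ j * (2 * j).factorial / j.factorial := by
      field_simp; linarith
    rw [this, pow_succ]
    field_simp
    ring

/-- Odd moments vanish, and the even ones turn the moment series into the exponential series at `-s
/ 2`. -/
lemma sum_gaussMoment (s : ℝ) (N : ℕ) :
    ∑ k ∈ Finset.range (2 * N), Complex.I ^ k * (gaussMoment s k : ℂ) / k.factorial =
      ∑ j ∈ Finset.range N, ((-s / 2 : ℝ) : ℂ) ^ j / j.factorial := by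
  induction N with
  | zero => simp
  | succ N ih =>
    rw [show 2 * (N + 1) = 2 * N + 1 + 1 by ring, Finset.sum_range_succ, Finset.sum_range_succ, ih,
      gaussMoment_odd, Finset.sum_range_succ]
    simp only [Complex.ofReal_zero, mul_zero, zero_div, add_zero]
    congr 1
    have := congrArg (fun x : ℝ => (x : ℂ)) (gaussMoment_even s N)
    push_cast at this
    rw [pow_mul, Complex.I_sq, mul_div_assoc, this]
    push_cast
    rw [show (-(s : ℂ) / 2) = (-1) * (s / 2) by ring, mul_pow]
    ring

variable {κ : Type*} {l : Filter κ} {Ω : κ → Type*} [∀ n, MeasurableSpace (Ω n)]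
  {μ : ∀ n, Measure (Ω n)} [∀ n, IsProbabilityMeasure (μ n)] {W : ∀ n, Ω n → ℝ}

lemma one_add_abs_pow_le (x : ℝ) (j : ℕ) : (1 + |x|) ^ (2 * j) ≤ 2 ^ (2 * j) * (1 + x ^ (2 * j)) := by
  have h := add_pow_le (zero_le_one (α := ℝ)) (abs_nonneg x) (2 * j)
  have h2 : |x| ^ (2 * j) = x ^ (2 * j) := by rw [pow_mul, pow_mul, sq_abs]
  rw [one_pow, h2] at h
  refine h.trans (mul_le_mul_of_nonneg_right ?_ ?_)
  · exact pow_le_pow_right₀ (by norm_num) (Nat.sub_le _ _)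
  · have : 0 ≤ x ^ (2 * j) := by rw [pow_mul]; positivity
    linarith

lemma absMoment_even_le {Ω : Type*} [MeasurableSpace Ω] {μ : Measure Ω} [IsProbabilityMeasure μ]
    {W : Ω → ℝ} (hW : BddMeas W) (j : ℕ) :
    absMoment μ W (2 * j) ≤ 2 ^ (2 * j) * (1 + ∫ η, W η ^ (2 * j) ∂μ) := by
  have hp : BddMeas fun η => W η ^ (2 * j) := hW.comp (G := fun x => x ^ (2 * j)) (by fun_prop)
  calc absMoment μ W (2 * j) ≤ ∫ η, 2 ^ (2 * j) * (1 + W η ^ (2 * j)) ∂μ :=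
        integral_mono (hW.absPow _).integrable
          ((BddMeas.const _).mul ((BddMeas.const _).add hp)).integrable
          fun η => one_add_abs_pow_le _ _
    _ = _ := by
        rw [integral_const_mul, integral_add (integrable_const _) hp.integrable]
        simp

/-- Even moments are bounded inductively by the recursion with `m = 2 * j + 1`: its main term and
its error involve order `2 * j` only, and an absolute moment of even order is controlled by the
plain moment of that order. Every order `i` lies below `2 * i`, because `1 + |W| ≥ 1`. -/
lemma exists_absMoment_le (hW : ∀ n, BddMeas (W n)) {s : κ → ℝ} {s₀ : ℝ} (hs : Tendsto s l (𝓝 s₀))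
    (hrec : ∀ m : ℕ, 1 ≤ m → ∃ δ : κ → ℝ, Tendsto δ l (𝓝 0) ∧ ∀ᶠ n in l,
      |∫ η, W n η ^ (m + 1) ∂μ n - s n * (m * ∫ η, W n η ^ (m - 1) ∂μ n)| ≤
        δ n * absMoment (μ n) (W n) (m - 1)) (i : ℕ) :
    ∃ C, ∀ᶠ n in l, absMoment (μ n) (W n) i ≤ C := by
  have heven : ∀ j : ℕ, ∃ C, 0 ≤ C ∧ ∀ᶠ n in l, ∫ η, W n η ^ (2 * j) ∂μ n ≤ C := by
    intro j
    induction j with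
    | zero => exact ⟨1, zero_le_one, Eventually.of_forall fun n => by simp⟩
    | succ j ih =>
      obtain ⟨C, hC0, hC⟩ := ih
      obtain ⟨δ, hδ, hrec'⟩ := hrec (2 * j + 1) (by omega)
      refine ⟨(|s₀| + 1) * ((2 * j + 1 : ℕ) * C) + 1 * (2 ^ (2 * j) * (1 + C)), by positivity, ?_⟩
      filter_upwards [hC, hrec', hδ.eventually (ge_mem_nhds (zero_lt_one' ℝ)),
        hs.abs.eventually (ge_mem_nhds (lt_add_one |s₀|))] with n h1 h2 h3 h4
      rw [show 2 * j + 1 - 1 = 2 * j by omega, show 2 * j + 1 + 1 = 2 * (j + 1) by ring] at h2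
      have hnn : 0 ≤ ∫ η, W n η ^ (2 * j) ∂μ n :=
        integral_nonneg fun η => by rw [pow_mul]; positivity
      have hm := absMoment_even_le (μ := μ n) (hW n) j
      have hm0 := absMoment_nonneg (μ n) (W n) (2 * j)
      have h5 : δ n * absMoment (μ n) (W n) (2 * j) ≤ 1 * (2 ^ (2 * j) * (1 + C)) := by
        refine mul_le_mul h3 (hm.trans ?_) hm0 zero_le_one
        gcongr
      have h6 : s n * ((2 * j + 1 : ℕ) * ∫ η, W n η ^ (2 * j) ∂μ n) ≤
          (|s₀| + 1) * ((2 * j + 1 : ℕ) * C) := by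
        refine (le_abs_self _).trans ?_
        rw [abs_mul, abs_of_nonneg (mul_nonneg (Nat.cast_nonneg _) hnn)]
        gcongr
      have := (abs_le.1 h2).2
      linarith
  obtain ⟨C, hC0, hC⟩ := heven i
  refine ⟨2 ^ (2 * i) * (1 + C), hC.mono fun n hn => ?_⟩
  calc absMoment (μ n) (W n) i ≤ absMoment (μ n) (W n) (2 * i) :=
        integral_mono ((hW n).absPow _).integrable ((hW n).absPow _).integrable fun η =>
          pow_le_pow_right₀ (by linarith [abs_nonneg (W n η)]) (by omega)
    _ ≤ _ := absMoment_even_le (hW n) i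
    _ ≤ _ := by gcongr

/-- `gaussMoment` is defined by the limiting recursion; the bounded absolute moments make the error
disappear. The recursion has step 2, so it starts from the total mass and the mean. -/
lemma tendsto_moments (hW : ∀ n, BddMeas (W n)) (hmean : ∀ n, ∫ η, W n η ∂μ n = 0)
    {s : κ → ℝ} {s₀ : ℝ} (hs : Tendsto s l (𝓝 s₀))
    (hrec : ∀ m : ℕ, 1 ≤ m → ∃ δ : κ → ℝ, Tendsto δ l (𝓝 0) ∧ ∀ᶠ n in l,
      |∫ η, W n η ^ (m + 1) ∂μ n - s n * (m * ∫ η, W n η ^ (m - 1) ∂μ n)| ≤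
        δ n * absMoment (μ n) (W n) (m - 1)) (i : ℕ) :
    Tendsto (fun n => ∫ η, W n η ^ i ∂μ n) l (𝓝 (gaussMoment s₀ i)) := by
  induction i using Nat.twoStepInduction with
  | zero => simpa [gaussMoment] using tendsto_const_nhds
  | one => simpa [gaussMoment, hmean] using tendsto_const_nhds
  | more i ih _ =>
    obtain ⟨δ, hδ, hrec'⟩ := hrec (i + 1) (by omega)
    obtain ⟨C, hC⟩ := exists_absMoment_le hW hs hrec i
    rw [Nat.add_sub_cancel] at hrec'
    have h0 : Tendsto (fun n => ∫ η, W n η ^ (i + 1 + 1) ∂μ n -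
        s n * ((i + 1 : ℕ) * ∫ η, W n η ^ i ∂μ n)) l (𝓝 0) := by
      have hδC : Tendsto (fun n => |δ n| * C) l (𝓝 0) := by simpa using hδ.abs.mul_const C
      refine squeeze_zero_norm' ?_ hδC
      filter_upwards [hrec', hC] with n h1 h2
      refine h1.trans ?_
      exact (mul_le_mul_of_nonneg_right (le_abs_self _) (absMoment_nonneg _ _ _)).trans
        (mul_le_mul_of_nonneg_left h2 (abs_nonneg _))
    have h1 := h0.add (hs.mul (ih.const_mul ((i + 1 : ℕ) : ℝ)))
    simp only [sub_add_cancel, zero_add] at h1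
    exact h1

/-- The method of moments: convergence of the characteristic function at `1` from the asymptotic
recursion for the moments. -/
theorem tendsto_integral_exp_of_moment_recursion (hW : ∀ n, BddMeas (W n))
    (hmean : ∀ n, ∫ η, W n η ∂μ n = 0)
    {s : κ → ℝ} {s₀ : ℝ} (hs : Tendsto s l (𝓝 s₀))
    (hrec : ∀ m : ℕ, 1 ≤ m → ∃ δ : κ → ℝ, Tendsto δ l (𝓝 0) ∧ ∀ᶠ n in l,
      |∫ η, W n η ^ (m + 1) ∂μ n - s n * (m * ∫ η, W n η ^ (m - 1) ∂μ n)| ≤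
        δ n * absMoment (μ n) (W n) (m - 1)) :
    Tendsto (fun n => ∫ η, Complex.exp (Complex.I * (W n η : ℂ)) ∂μ n) l
      (𝓝 (Complex.exp ((-s₀ / 2 : ℝ) : ℂ))) := by
  have hmom := tendsto_moments hW hmean hs hrec
  have hpoly : ∀ N : ℕ, Tendsto (fun n => ∑ k ∈ Finset.range N,
      Complex.I ^ k * ((∫ η, W n η ^ k ∂μ n : ℝ) : ℂ) / k.factorial) l
      (𝓝 (∑ k ∈ Finset.range N, Complex.I ^ k * (gaussMoment s₀ k : ℂ) / k.factorial)) := by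
    intro N
    refine tendsto_finsetSum _ fun k _ => ?_
    exact ((Complex.continuous_ofReal.tendsto _).comp (hmom k)).const_mul _ |>.div_const _
  -- The order `2 * N` is even, so the Taylor remainder is bounded by a plain moment, whose limit is
  -- known.
  have hbound : ∀ (N : ℕ) n, ‖∫ η, Complex.exp (Complex.I * (W n η : ℂ)) ∂μ n -
      ∑ k ∈ Finset.range (2 * N), Complex.I ^ k * ((∫ η, W n η ^ k ∂μ n : ℝ) : ℂ) / k.factorial‖ ≤
      (∫ η, W n η ^ (2 * N) ∂μ n) / (2 * N).factorial := by
    intro N n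
    have hpb : ∀ k : ℕ, BddMeas fun η => W n η ^ k := fun k =>
      (hW n).comp (G := fun x => x ^ k) (by fun_prop)
    have hsum : ∑ k ∈ Finset.range (2 * N), Complex.I ^ k * ((∫ η, W n η ^ k ∂μ n : ℝ) : ℂ) /
        k.factorial = ∫ η, ∑ k ∈ Finset.range (2 * N),
          (Complex.I * (W n η : ℂ)) ^ k / k.factorial ∂μ n := by
      rw [integral_finsetSum]
      · refine Finset.sum_congr rfl fun k _ => ?_
        rw [← integral_complex_ofReal, ← integral_const_mul, ← integral_div]
        refine integral_congr_ae (ae_of_all _ fun η => ?_)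
        simp only
        rw [mul_pow]
        push_cast
        rfl
      · intro k _
        have := ((hpb k).integrable (μ := μ n)).ofReal (𝕜 := ℂ)
        refine ((this.const_mul (Complex.I ^ k)).div_const (k.factorial : ℂ)).congr
          (ae_of_all _ fun η => ?_)
        simp [mul_pow]
    have hmeas : Measurable fun η => Complex.exp (Complex.I * (W n η : ℂ)) :=
      Complex.measurable_exp.comp
        (measurable_const.mul (Complex.measurable_ofReal.comp (hW n).1))
    have hint1 : Integrable (fun η => Complex.exp (Complex.I * (W n η : ℂ))) (μ n) :=
      Integrable.of_bound hmeas.aestronglyMeasurable 1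
        (ae_of_all _ fun η => by rw [mul_comm, Complex.norm_exp_ofReal_mul_I])
    have hint2 : Integrable (fun η => ∑ k ∈ Finset.range (2 * N),
          (Complex.I * (W n η : ℂ)) ^ k / (k.factorial : ℂ)) (μ n) := by
      refine integrable_finsetSum _ fun k _ => ?_
      have := ((hpb k).integrable (μ := μ n)).ofReal (𝕜 := ℂ)
      refine ((this.const_mul (Complex.I ^ k)).div_const (k.factorial : ℂ)).congr
        (ae_of_all _ fun η => ?_)
      simp [mul_pow]
    rw [hsum, ← integral_sub hint1 hint2, ← integral_div]
    refine norm_integral_le_of_norm_le ((hpb (2 * N)).integrable.div_const _)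
      (ae_of_all _ fun η => ?_)
    refine (norm_exp_I_mul_sub_sum_le (W n η) (2 * N)).trans (le_of_eq ?_)
    rw [pow_mul, pow_mul, sq_abs]
  have hexp : Tendsto (fun N : ℕ => ∑ k ∈ Finset.range (2 * N),
      Complex.I ^ k * (gaussMoment s₀ k : ℂ) / k.factorial) atTop
      (𝓝 (Complex.exp ((-s₀ / 2 : ℝ) : ℂ))) := by
    simp only [sum_gaussMoment]
    rw [Complex.exp_eq_exp_ℂ]
    exact (NormedSpace.expSeries_div_hasSum_exp ((-s₀ / 2 : ℝ) : ℂ)).tendsto_sum_nat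
  have hrem : Tendsto (fun N : ℕ => gaussMoment s₀ (2 * N) / (2 * N).factorial) atTop (𝓝 0) := by
    simp only [gaussMoment_even]
    exact FloorSemiring.tendsto_pow_div_factorial_atTop (s₀ / 2)
  rw [Metric.tendsto_nhds]
  intro ε hε
  -- `N` is fixed before `n`: it makes both the tail of the exponential series and the limit of the
  -- remainder small. The latter is `(s₀ / 2) ^ N / N!`, which tends to 0.
  obtain ⟨N, h1, h2⟩ := ((Metric.tendsto_nhds.1 hexp (ε / 3) (by positivity)).and
    (hrem.eventually (gt_mem_nhds (show 0 < ε / 3 by positivity)))).exists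
  have h3 := ((hmom (2 * N)).div_const ((2 * N).factorial : ℝ)).eventually (gt_mem_nhds h2)
  filter_upwards [h3, Metric.tendsto_nhds.1 (hpoly (2 * N)) (ε / 3) (by positivity)] with n h4 h5
  refine (dist_triangle4 _ (∑ k ∈ Finset.range (2 * N),
      Complex.I ^ k * ((∫ η, W n η ^ k ∂μ n : ℝ) : ℂ) / k.factorial)
    (∑ k ∈ Finset.range (2 * N), Complex.I ^ k * (gaussMoment s₀ k : ℂ) / k.factorial) _).trans_lt ?_
  have := hbound N n
  rw [← dist_eq_norm] at this
  linarith

end MethodOfMoments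

/-! ### Lattice sums, lattice point counts and Riemann sums -/

section LatticeSums

open scoped Pointwise

variable {d : ℕ} (Λ : Submodule ℤ (EuclideanSpace ℝ (Fin d))) [DiscreteTopology Λ] [IsZLattice ℝ Λ]

lemma summable_one_add_norm_rpow {s : ℝ} (hs : (d : ℝ) < s) :
    Summable fun l : Λ => (1 + ‖(l : EuclideanSpace ℝ (Fin d))‖) ^ (-s) := by
  have h1 : Summable fun l : Λ => ‖l‖ ^ (-s) := by
    refine ZLattice.summable_norm_rpow Λ (-s) ?_
    rw [ZLattice.rank ℝ Λ, finrank_euclideanSpace_fin]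
    linarith
  -- At `l = 0` the value of `‖l‖ ^ (-s)` is 0 by convention, while the term to be bounded is 1, so
  -- this point needs a majorant of its own.
  have h2 : Summable fun l : Λ => if l = 0 then (1 : ℝ) else 0 := (hasSum_ite_eq 0 1).summable
  have hs0 : 0 < s := lt_of_le_of_lt (Nat.cast_nonneg d) hs
  refine Summable.of_nonneg_of_le (fun l => by positivity) (fun l => ?_) (h1.add h2)
  by_cases hl : l = 0
  · subst hl
    simp [Real.zero_rpow (neg_ne_zero.2 hs0.ne')]
  · rw [if_neg hl, add_zero]
    refine Real.rpow_le_rpow_of_nonpos (norm_pos_iff.2 hl) ?_ (by linarith)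
    simp

lemma sum_one_add_norm_sub_rpow_le {s : ℝ} (hs : (d : ℝ) < s) (l₀ : Λ) (T : Finset Λ) :
    ∑ l ∈ T, (1 + ‖((l₀ - l : Λ) : EuclideanSpace ℝ (Fin d))‖) ^ (-s) ≤
      ∑' l : Λ, (1 + ‖(l : EuclideanSpace ℝ (Fin d))‖) ^ (-s) := by
  have h := summable_one_add_norm_rpow Λ hs
  have h' := (Equiv.subLeft l₀).summable_iff.2 h
  rw [← (Equiv.subLeft l₀).tsum_eq]
  exact h'.sum_le_tsum T fun _ _ => by positivity

/-- The number of points of the rescaled lattice in a fixed ball, divided by `n ^ d`, converges to a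
volume ratio and is therefore bounded in `n`. -/
lemma exists_card_lattice_ball_le (R : ℝ) :
    ∃ C : ℝ, 0 ≤ C ∧ ∀ (n : ℕ+) (T : Finset Λ),
      (∀ l ∈ T, ‖(l : EuclideanSpace ℝ (Fin d))‖ ≤ R * n) → (T.card : ℝ) ≤ C * (n : ℝ) ^ d := by
  set s : Set (EuclideanSpace ℝ (Fin d)) := Metric.closedBall 0 R
  -- In dimension 0 a sphere need not be a null set; there the lattice has a single point.
  rcases Nat.eq_zero_or_pos d with hd | hd
  · subst hd
    refine ⟨1, zero_le_one, fun n T _ => ?_⟩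
    have : T.card ≤ 1 := Finset.card_le_one.2 fun a _ b _ => Subsingleton.elim _ _
    simpa using (by exact_mod_cast this : (T.card : ℝ) ≤ 1)
  have : Nonempty (Fin d) := ⟨⟨0, hd⟩⟩
  have hlim := ZLattice.covolume.tendsto_card_div_pow' Λ (s := s) Metric.isBounded_closedBall
    measurableSet_closedBall (by
      refine measure_mono_null Metric.frontier_closedBall_subset_sphere ?_
      exact Measure.addHaar_sphere _ _ _)
  obtain ⟨C, hC⟩ := hlim.bddAbove_range
  refine ⟨C, ?_, fun n T hT => ?_⟩
  · refine le_trans ?_ (hC ⟨1, rfl⟩)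
    positivity
  have hn : (0 : ℝ) < n := by exact_mod_cast n.pos
  have h1 := hC ⟨(n : ℕ), rfl⟩
  simp only [finrank_euclideanSpace_fin] at h1
  have hfin : (s ∩ ((n : ℕ) : ℝ)⁻¹ • (Λ : Set (EuclideanSpace ℝ (Fin d)))).Finite := by
    have hcl : IsClosed (Λ : Set (EuclideanSpace ℝ (Fin d))) :=
      @AddSubgroup.isClosed_of_discrete _ _ _ _ _ Λ.toAddSubgroup (by assumption)
    have hfin' : (Metric.closedBall (0 : EuclideanSpace ℝ (Fin d)) (R * n) ∩ Λ).Finite :=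
      Metric.finite_isBounded_inter_isClosed DiscreteTopology.isDiscrete
        Metric.isBounded_closedBall hcl
    refine (hfin'.image fun x => ((n : ℕ) : ℝ)⁻¹ • x).subset ?_
    rintro x ⟨hx, y, hy, rfl⟩
    refine ⟨y, ⟨?_, hy⟩, rfl⟩
    simp only [s, mem_closedBall_zero_iff, norm_smul, norm_inv, RCLike.norm_natCast] at hx ⊢
    rw [inv_mul_le_iff₀ hn] at hx
    linarith
  have h2 : T.card ≤ Nat.card (s ∩ ((n : ℕ) : ℝ)⁻¹ • (Λ : Set (EuclideanSpace ℝ (Fin d))) :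
      Set (EuclideanSpace ℝ (Fin d))) := by
    rw [Nat.card_coe_set_eq, ← Set.ncard_coe_finset]
    refine Set.ncard_le_ncard_of_injOn
      (fun l : Λ => ((n : ℕ) : ℝ)⁻¹ • (l : EuclideanSpace ℝ (Fin d))) ?_ ?_ hfin
    · intro l hl
      refine ⟨?_, l, l.2, rfl⟩
      simp only [s, mem_closedBall_zero_iff, norm_smul, norm_inv, RCLike.norm_natCast]
      rw [inv_mul_le_iff₀ hn]
      linarith [hT l hl]
    · intro l _ l' _ h
      have := smul_right_injective (EuclideanSpace ℝ (Fin d)) (inv_ne_zero hn.ne') h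
      exact Subtype.ext this
  rw [div_le_iff₀ (by positivity)] at h1
  exact le_trans (by exact_mod_cast h2) h1

lemma finite_lattice_norm_le (R : ℝ) :
    {l : Λ | ‖(l : EuclideanSpace ℝ (Fin d))‖ ≤ R}.Finite := by
  have hcl : IsClosed (Λ : Set (EuclideanSpace ℝ (Fin d))) :=
    @AddSubgroup.isClosed_of_discrete _ _ _ _ _ Λ.toAddSubgroup (by assumption)
  have hfin' : (Metric.closedBall (0 : EuclideanSpace ℝ (Fin d)) R ∩ Λ).Finite :=
    Metric.finite_isBounded_inter_isClosed DiscreteTopology.isDiscrete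
      Metric.isBounded_closedBall hcl
  refine (hfin'.preimage (Subtype.val_injective (p := fun x => x ∈ Λ)).injOn).subset ?_
  intro l hl
  exact ⟨by simpa using hl, l.2⟩

/-- Riemann sums over the rescaled lattice: if `F n l` is uniformly close to `f (l / n)` for a
continuous function `f` of compact support, then `n^{-d} ∑ F n l` tends to `∫ f / covol Λ`. -/
theorem tendsto_lattice_riemannSum {f : EuclideanSpace ℝ (Fin d) → ℝ} (hf : Continuous f)
    (hfc : HasCompactSupport f) {F : ℕ+ → Λ → ℝ} {R : ℝ}
    (hsupp : ∀ (n : ℕ+) (l : Λ), R * n < ‖(l : EuclideanSpace ℝ (Fin d))‖ → F n l = 0)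
    (hunif : ∀ ε > 0, ∀ᶠ n : ℕ+ in atTop, ∀ l : Λ,
      |F n l - f ((n : ℝ)⁻¹ • (l : EuclideanSpace ℝ (Fin d)))| ≤ ε) :
    Tendsto (fun n : ℕ+ => ((n : ℝ) ^ d)⁻¹ * ∑' l, F n l) atTop
      (𝓝 ((∫ x, f x) / ZLattice.covolume Λ)) := by
  let b := Module.Free.chooseBasis ℤ Λ
  let P := ZSpan.fundamentalDomain (b.ofZLatticeBasis ℝ Λ)
  have hP : IsAddFundamentalDomain Λ P (volume : Measure (EuclideanSpace ℝ (Fin d))) := ZLattice.isAddFundamentalDomain b _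
  have hPb : Bornology.IsBounded P := ZSpan.fundamentalDomain_isBounded _
  have hPfin : volume P < ⊤ := hPb.measure_lt_top
  have hvol : ZLattice.covolume Λ = volume.real P :=
    ZLattice.covolume_eq_measure_fundamentalDomain Λ volume hP
  set v := ZLattice.covolume Λ with hv
  have hv0 : 0 < v := ZLattice.covolume_pos Λ
  obtain ⟨r, hr0, hr⟩ : ∃ r : ℝ, 0 ≤ r ∧ ∀ y ∈ P, ‖y‖ ≤ r := by
    obtain ⟨r, hr⟩ := hPb.exists_norm_le
    exact ⟨max r 0, le_max_right _ _, fun y hy => (hr y hy).trans (le_max_left _ _)⟩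
  obtain ⟨R₁, hR₁⟩ : ∃ R₁ : ℝ, ∀ x, R₁ < ‖x‖ → f x = 0 := by
    obtain ⟨R₁, hR₁⟩ := hfc.isBounded.exists_norm_le
    refine ⟨R₁, fun x hx => ?_⟩
    by_contra hne
    exact absurd (hR₁ x (subset_tsupport f hne)) (not_le.2 hx)
  -- Beyond `R' * n` both sides vanish: `R` serves for `F`, and `R₁ + r` for the integral of `f`
  -- over a translate of the fundamental cell, whose points have norm at most `r`.
  set R' := max R (R₁ + r) with hR'
  obtain ⟨C, hC0, hC⟩ := exists_card_lattice_ball_le Λ R'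
  have huc : UniformContinuous f := hf.uniformContinuous_of_tendsto_cocompact hfc.is_zero_at_infty
  have hint : ∀ n : ℕ+, Integrable fun x : EuclideanSpace ℝ (Fin d) => f ((n : ℝ)⁻¹ • x) := fun n => by
    have hn : (n : ℝ)⁻¹ ≠ 0 := inv_ne_zero (by exact_mod_cast n.ne_zero)
    exact ((hf.integrable_of_hasCompactSupport hfc).comp_smul hn)
  rw [Metric.tendsto_nhds]
  intro ε hε
  -- On each cell one `ε'` pays for the distance of `F` from `f` and one for the oscillation of `f`.
  -- There are at most `C * n ^ d` cells, and `(C + 1) * (2 * ε') = ε / 2`.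
  set ε' := ε / (2 * (2 * (C + 1))) with hε'
  have hε'0 : 0 < ε' := by positivity
  obtain ⟨δ, hδ0, hδ⟩ := Metric.uniformContinuous_iff.1 huc ε' hε'0
  have hlarge : ∀ᶠ n : ℕ+ in atTop, r / δ < (n : ℝ) := by
    obtain ⟨N, hN⟩ := exists_nat_gt (r / δ)
    filter_upwards [eventually_ge_atTop (⟨N + 1, N.succ_pos⟩ : ℕ+)] with n hn
    have : (N + 1 : ℕ) ≤ (n : ℕ) := hn
    have : ((N + 1 : ℕ) : ℝ) ≤ (n : ℕ) := by exact_mod_cast this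
    push_cast at this
    linarith
  filter_upwards [hunif ε' hε'0, hlarge] with n h1 h2
  have hn : (0 : ℝ) < n := by exact_mod_cast n.pos
  set T : Finset Λ := (finite_lattice_norm_le Λ (R' * n)).toFinset with hT
  have hTmem : ∀ l : Λ, l ∈ T ↔ ‖(l : EuclideanSpace ℝ (Fin d))‖ ≤ R' * n := fun l => by simp [hT]
  have hcard : (T.card : ℝ) ≤ C * (n : ℝ) ^ d := hC n T fun l hl => (hTmem l).1 hl
  have hsumF : ∑' l, F n l = ∑ l ∈ T, F n l := by
    refine tsum_eq_sum fun l hl => hsupp n l ?_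
    rw [hTmem, not_le] at hl
    exact lt_of_le_of_lt (mul_le_mul_of_nonneg_right (le_max_left _ _) hn.le) hl
  have : MeasurableVAdd Λ (EuclideanSpace ℝ (Fin d)) :=
    (inferInstance : MeasurableVAdd Λ.toAddSubgroup (EuclideanSpace ℝ (Fin d)))
  have : VAddInvariantMeasure Λ (EuclideanSpace ℝ (Fin d)) volume :=
    (inferInstance : VAddInvariantMeasure Λ.toAddSubgroup (EuclideanSpace ℝ (Fin d)) volume)
  have hdom := hP.integral_eq_tsum'' (fun x : EuclideanSpace ℝ (Fin d) => f ((n : ℝ)⁻¹ • x)) (hint n)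
  have hzero : ∀ l : Λ, l ∉ T → ∫ x in P, f ((n : ℝ)⁻¹ • (l +ᵥ x)) = 0 := by
    intro l hl
    rw [hTmem, not_le] at hl
    have : ∀ x ∈ P, f ((n : ℝ)⁻¹ • (l +ᵥ x)) = 0 := by
      intro x hx
      refine hR₁ _ ?_
      rw [norm_smul, norm_inv, Real.norm_of_nonneg hn.le, lt_inv_mul_iff₀ hn]
      have e1 : ‖(l : EuclideanSpace ℝ (Fin d))‖ ≤ ‖l +ᵥ x‖ + ‖x‖ := by
        have : (l : EuclideanSpace ℝ (Fin d)) = (l +ᵥ x) - x := by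
          change (l : EuclideanSpace ℝ (Fin d)) = ((l : EuclideanSpace ℝ (Fin d)) + x) - x
          abel
        conv_lhs => rw [this]
        exact norm_sub_le _ _
      have e2 := hr x hx
      have e3 : (R₁ + r) * n ≤ R' * n := mul_le_mul_of_nonneg_right (le_max_right _ _) hn.le
      have e4 : (1 : ℝ) ≤ n := by exact_mod_cast n.pos
      nlinarith
    rw [setIntegral_congr_fun (g := fun _ => (0 : ℝ)) (ZSpan.fundamentalDomain_measurableSet _) this]
    simp
  rw [tsum_eq_sum (s := T) (fun l hl => hzero l hl)] at hdom
  have hscale : ∫ x : EuclideanSpace ℝ (Fin d), f ((n : ℝ)⁻¹ • x) = (n : ℝ) ^ d * ∫ x, f x := by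
    rw [Measure.integral_comp_inv_smul_of_nonneg _ _ hn.le, finrank_euclideanSpace_fin, smul_eq_mul]
  rw [hscale] at hdom
  have hterm : ∀ l : Λ, |v * F n l - ∫ x in P, f ((n : ℝ)⁻¹ • (l +ᵥ x))| ≤ v * (2 * ε') := by
    intro l
    have hi : IntegrableOn (fun x : EuclideanSpace ℝ (Fin d) => f ((n : ℝ)⁻¹ • (l +ᵥ x))) P := by
      have := (hint n).comp_add_left (l : EuclideanSpace ℝ (Fin d))
      exact this.integrableOn
    have hconst : v * F n l = ∫ _ in P, F n l := by
      rw [setIntegral_const, smul_eq_mul, hvol]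
    have hc : IntegrableOn (fun _ : EuclideanSpace ℝ (Fin d) => F n l) P :=
      integrableOn_const hPfin.ne
    rw [hconst, ← integral_sub hc hi]
    have := norm_setIntegral_le_of_norm_le_const (μ := volume) (s := P) (C := 2 * ε')
      (f := fun x => F n l - f ((n : ℝ)⁻¹ • (l +ᵥ x))) hPfin (fun x hx => ?_)
    · rw [Real.norm_eq_abs] at this
      rw [hvol]
      linarith
    · rw [Real.norm_eq_abs]
      have e1 := h1 l
      have e2 : |f ((n : ℝ)⁻¹ • (l : EuclideanSpace ℝ (Fin d))) - f ((n : ℝ)⁻¹ • (l +ᵥ x))| ≤ ε' := by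
        refine (hδ ?_).le
        have hlx : (l +ᵥ x : EuclideanSpace ℝ (Fin d)) = (l : EuclideanSpace ℝ (Fin d)) + x := rfl
        rw [hlx, smul_add, dist_self_add_right, norm_smul, norm_inv, Real.norm_of_nonneg hn.le,
          inv_mul_lt_iff₀ hn]
        rw [div_lt_iff₀ hδ0] at h2
        exact lt_of_le_of_lt (hr x hx) h2
      calc _ = |(F n l - f ((n : ℝ)⁻¹ • (l : EuclideanSpace ℝ (Fin d)))) +
            (f ((n : ℝ)⁻¹ • (l : EuclideanSpace ℝ (Fin d))) - f ((n : ℝ)⁻¹ • (l +ᵥ x)))| := by ring_nf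
        _ ≤ _ := abs_add_le _ _
        _ ≤ 2 * ε' := by linarith
  have hsum : |v * ∑ l ∈ T, F n l - (n : ℝ) ^ d * ∫ x, f x| ≤ (C * (n : ℝ) ^ d) * (v * (2 * ε')) := by
    rw [hdom, Finset.mul_sum, ← Finset.sum_sub_distrib]
    refine (Finset.abs_sum_le_sum_abs _ _).trans ?_
    refine (Finset.sum_le_card_nsmul _ _ _ fun l _ => hterm l).trans ?_
    rw [nsmul_eq_mul]
    exact mul_le_mul_of_nonneg_right hcard (by positivity)
  have hnd : (0 : ℝ) < (n : ℝ) ^ d := by positivity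
  rw [Real.dist_eq, hsumF]
  have heq : ((n : ℝ) ^ d)⁻¹ * ∑ l ∈ T, F n l - (∫ x, f x) / v =
      (v * ∑ l ∈ T, F n l - (n : ℝ) ^ d * ∫ x, f x) / ((n : ℝ) ^ d * v) := by
    field_simp
  rw [heq, abs_div, abs_of_pos (mul_pos hnd hv0), div_lt_iff₀ (mul_pos hnd hv0)]
  refine hsum.trans_lt ?_
  have : C * (2 * ε') < ε := by
    have : (C + 1) * (2 * ε') = ε / 2 := by rw [hε']; field_simp
    nlinarith
  nlinarith [mul_pos hnd hv0]

end LatticeSums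

/-! ### Pattern probabilities as determinants -/

section PatternDeterminant

/-- The matrix is block triangular for `O` and its complement, with an identity block on the
complement. -/
lemma det_ite_row {V : Type*} [Fintype V] [DecidableEq V] (M : Matrix V V ℝ) (O : Finset V) :
    (Matrix.of fun v w => if v ∈ O then M v w else if v = w then 1 else 0).det =
      (Matrix.of fun v w : O => M v w).det := by
  rw [Matrix.twoBlockTriangular_det _ (fun v => v ∈ O)]
  · have h1 : Matrix.toSquareBlockProp
        (Matrix.of fun v w => if v ∈ O then M v w else if v = w then 1 else 0)
        (fun v => ¬ v ∈ O) = 1 := by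
      ext ⟨v, hv⟩ ⟨w, hw⟩
      simp [Matrix.toSquareBlockProp, Matrix.one_apply, hv, Matrix.toBlock]
    rw [h1, Matrix.det_one, mul_one]
    have h2 : Matrix.toSquareBlockProp
        (Matrix.of fun v w => if v ∈ O then M v w else if v = w then 1 else 0)
        (fun v => v ∈ O) = (Matrix.of fun v w : {v // v ∈ O} => M v w) := by
      ext ⟨v, hv⟩ ⟨w, hw⟩
      simp [Matrix.toSquareBlockProp, hv, Matrix.toBlock]
    rw [h2]
    congr!
  · intro v hv w hw
    have : v ≠ w := fun h => hv (h ▸ hw)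
    simp [hv, this]

variable {d : ℕ} {S : Set (EuclideanSpace ℝ (Fin d))}
  {μ : Measure (Set S)}
  {K : EuclideanSpace ℝ (Fin d) → EuclideanSpace ℝ (Fin d) → ℝ}

lemma measurableSet_mem_set {α : Type*} (x : α) : MeasurableSet {T : Set α | x ∈ T} :=
  measurableSet_setOfPred.2 (measurable_set_mem x)

lemma measurableSet_forall_mem_notMem {V : Type*} (s : V → S) (O Z : Finset V) :
    MeasurableSet {T : Set S | (∀ v ∈ O, s v ∈ T) ∧ ∀ v ∈ Z, s v ∉ T} := by
  have h1 : MeasurableSet (⋂ v ∈ O, {T : Set S | s v ∈ T}) :=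
    Finset.measurableSet_biInter _ fun v _ => measurableSet_mem_set _
  have h2 : MeasurableSet (⋂ v ∈ Z, {T : Set S | s v ∈ T}ᶜ) :=
    Finset.measurableSet_biInter _ fun v _ => (measurableSet_mem_set _).compl
  convert h1.inter h2 using 1
  ext T
  simp

/-- The probability that a determinantal process contains some sites and avoids others. -/
theorem IsDeterminantal.measureReal_mem_notMem [IsProbabilityMeasure μ] (hK : IsDeterminantal μ K)
    {V : Type*} [Fintype V] [DecidableEq V] {s : V → S} (hs : Function.Injective s)
    (O Z : Finset V) (hOZ : Disjoint O Z) :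
    μ.real {T : Set S | (∀ v ∈ O, s v ∈ T) ∧ ∀ v ∈ Z, s v ∉ T} =
      (Matrix.of fun v w => if v ∈ O then K (s v) (s w) else
        if v ∈ Z then (if v = w then 1 else 0) - K (s v) (s w) else if v = w then 1 else 0).det := by
  induction Z using Finset.induction_on generalizing O with
  | empty =>
    have h1 := hK O.card (fun i => s (O.equivFin.symm i))
      (fun i j h => O.equivFin.symm.injective (Subtype.ext (hs h)))
    have h2 : {T : Set S | ∀ i, s (O.equivFin.symm i) ∈ T} =
        {T : Set S | (∀ v ∈ O, s v ∈ T) ∧ ∀ v ∈ (∅ : Finset V), s v ∉ T} := by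
      ext T
      simp only [Set.mem_ofPred_eq, Finset.notMem_empty, false_imp_iff, implies_true, and_true]
      constructor
      · intro h v hv
        simpa using h (O.equivFin ⟨v, hv⟩)
      · exact fun h i => h _ (O.equivFin.symm i).2
    rw [← h2, h1]
    simp only [Finset.notMem_empty, if_false]
    have h3 := det_ite_row (Matrix.of fun v w => K (s v) (s w)) O
    simp only [Matrix.of_apply] at h3
    rw [h3, ← Matrix.det_submatrix_equiv_self O.equivFin.symm]
    rfl
  | insert z Z hz ih =>
    rw [Finset.disjoint_insert_right] at hOZ
    have e1 := ih O hOZ.2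
    have e2 := ih (insert z O) (by rw [Finset.disjoint_insert_left]; exact ⟨hz, hOZ.2⟩)
    -- Inclusion-exclusion in the single site `z`. The three determinants agree outside row `z`.
    -- That row is the identity row in the event that ignores `z`, the row of `K` when `z` is
    -- occupied, and their difference when `z` is empty, so additivity in this row suffices.
    have hset : {T : Set S | (∀ v ∈ O, s v ∈ T) ∧ ∀ v ∈ insert z Z, s v ∉ T} =
        {T : Set S | (∀ v ∈ O, s v ∈ T) ∧ ∀ v ∈ Z, s v ∉ T} \
          {T : Set S | (∀ v ∈ insert z O, s v ∈ T) ∧ ∀ v ∈ Z, s v ∉ T} := by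
      ext T
      simp only [Set.mem_ofPred_eq, Set.mem_sdiff, Finset.forall_mem_insert]
      tauto
    have hsub : {T : Set S | (∀ v ∈ insert z O, s v ∈ T) ∧ ∀ v ∈ Z, s v ∉ T} ⊆
        {T : Set S | (∀ v ∈ O, s v ∈ T) ∧ ∀ v ∈ Z, s v ∉ T} := by
      intro T
      simp only [Set.mem_ofPred_eq, Finset.forall_mem_insert]
      tauto
    rw [hset, measureReal_sdiff hsub (measurableSet_forall_mem_notMem s _ _), e1, e2]
    set A := (Matrix.of fun v w => if v ∈ O then K (s v) (s w) else
        if v ∈ insert z Z then (if v = w then 1 else 0) - K (s v) (s w)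
          else if v = w then 1 else 0) with hA
    have hrow : ∀ (B : Matrix V V ℝ) (r : V → ℝ), (∀ w, B z w = r w) →
        (∀ v w, v ≠ z → B v w = A v w) → B = A.updateRow z r := by
      intro B r h1 h2
      ext v w
      by_cases hv : v = z
      · subst hv; simp [h1]
      · rw [Matrix.updateRow_ne hv, h2 v w hv]
    have hzO : z ∉ O := hOZ.1
    have hE : (Matrix.of fun v w => if v ∈ O then K (s v) (s w) else
        if v ∈ Z then (if v = w then 1 else 0) - K (s v) (s w) else if v = w then 1 else 0) =
        A.updateRow z (fun w => ((if z = w then 1 else 0) - K (s z) (s w)) + K (s z) (s w)) := by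
      refine hrow _ _ (fun w => ?_) fun v w hv => ?_
      · simp [hzO, hz]
      · simp [hA, Finset.mem_insert, hv]
    have hB : (Matrix.of fun v w => if v ∈ insert z O then K (s v) (s w) else
        if v ∈ Z then (if v = w then 1 else 0) - K (s v) (s w) else if v = w then 1 else 0) =
        A.updateRow z (fun w => K (s z) (s w)) := by
      refine hrow _ _ (fun w => ?_) fun v w hv => ?_
      · simp
      · simp [hA, Finset.mem_insert, hv]
    have hA' : A = A.updateRow z (fun w => (if z = w then 1 else 0) - K (s z) (s w)) := by
      refine hrow _ _ (fun w => ?_) fun v w hv => rfl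
      simp [hA, hzO]
    have hadd := Matrix.det_updateRow_add A z
      (fun w => (if z = w then 1 else 0) - K (s z) (s w)) (fun w => K (s z) (s w))
    rw [hE, hB]
    conv_rhs => rw [hA']
    have hfun : (fun w => ((if z = w then (1 : ℝ) else 0) - K (s z) (s w)) + K (s z) (s w)) =
      (fun w => (if z = w then 1 else 0) - K (s z) (s w)) + fun w => K (s z) (s w) := rfl
    rw [hfun, hadd]
    ring

lemma IsDeterminantal.diag_mem [IsProbabilityMeasure μ] (hK : IsDeterminantal μ K) (x : S) :
    0 ≤ K x x ∧ K x x ≤ 1 := by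
  have h := hK 1 (fun _ => x) (fun i j _ => Subsingleton.elim i j)
  rw [Matrix.det_unique] at h
  simp only [Matrix.of_apply] at h
  rw [← h]
  exact ⟨measureReal_nonneg, measureReal_le_one⟩

/-- The set of the sites of a pattern, as a finite set. -/
noncomputable def Pattern.sitesFinset (p : Pattern d) : Finset (EuclideanSpace ℝ (Fin d)) :=
  open Classical in p.zeros ∪ p.ones

lemma Pattern.mem_sitesFinset {p : Pattern d} {x : EuclideanSpace ℝ (Fin d)} :
    x ∈ p.sitesFinset ↔ x ∈ p.zeros ∨ x ∈ p.ones := by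
  simp [Pattern.sitesFinset]

lemma Pattern.coe_sitesFinset (p : Pattern d) : (p.sitesFinset : Set _) = p.support := by
  ext x
  simp [Pattern.mem_sitesFinset, Pattern.support]

lemma Pattern.mem_support {p : Pattern d} {x : EuclideanSpace ℝ (Fin d)} :
    x ∈ p.support ↔ x ∈ p.zeros ∨ x ∈ p.ones := by
  simp [Pattern.support]

lemma Pattern.mem_occurs {p : Pattern d} {T : Set S} :
    T ∈ p.occurs S ↔ (∀ x ∈ p.ones, x ∈ Subtype.val '' T) ∧
      ∀ x ∈ p.zeros, x ∉ Subtype.val '' T := by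
  simp only [Pattern.occurs, Set.mem_ofPred_eq, Set.disjoint_left, Set.subset_def, Finset.mem_coe]

lemma Pattern.measurableSet_occurs (S : Set (EuclideanSpace ℝ (Fin d))) (p : Pattern d) :
    MeasurableSet (p.occurs S) := by
  have hx : ∀ x, MeasurableSet {T : Set S | x ∈ Subtype.val '' T} := by
    intro x
    by_cases hx : x ∈ S
    · convert measurableSet_mem_set (⟨x, hx⟩ : S) using 1
      ext T
      simp [hx]
    · convert MeasurableSet.empty using 1
      ext T
      simp [hx]
  have h1 : MeasurableSet (⋂ x ∈ p.ones, {T : Set S | x ∈ Subtype.val '' T}) :=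
    Finset.measurableSet_biInter _ fun x _ => hx x
  have h2 : MeasurableSet (⋂ x ∈ p.zeros, {T : Set S | x ∈ Subtype.val '' T}ᶜ) :=
    Finset.measurableSet_biInter _ fun x _ => (hx x).compl
  convert h1.inter h2 using 1
  ext T
  rw [Pattern.mem_occurs]
  simp only [Set.mem_inter_iff, Set.mem_iInter, Set.mem_compl_iff, Set.mem_ofPred_eq]

/-- The matrix whose block minors are the probabilities of the joint occurrence of patterns. -/
noncomputable def patternMatrix {ι V : Type*} [DecidableEq V]
    (K : EuclideanSpace ℝ (Fin d) → EuclideanSpace ℝ (Fin d) → ℝ) (pat : ι → Pattern d) (c : V → ι)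
    (s : V → EuclideanSpace ℝ (Fin d)) : Matrix V V ℝ :=
  open Classical in Matrix.of fun v w => if s v ∈ (pat (c v)).ones then K (s v) (s w) else
    (if v = w then 1 else 0) - K (s v) (s w)

-- The sites of all patterns of `Q`, coloured by their patterns, index one fixed matrix; passing to
-- a subset `A` only masks rows. All joint probabilities are thus determinants of the form treated
-- by the cluster expansion.
open ClusterDet in
theorem IsDeterminantal.measureReal_biInter_occurs [IsProbabilityMeasure μ]
    (hK : IsDeterminantal μ K) {ι V : Type*} [Fintype V] [DecidableEq V] [DecidableEq ι]
    {pat : ι → Pattern d} {c : V → ι} {s : V → S} (hs : Function.Injective s)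
    {Q A : Finset ι} (hA : A ⊆ Q) (hmem : ∀ v, (s v : EuclideanSpace ℝ (Fin d)) ∈ (pat (c v)).support)
    (hsurj : ∀ q ∈ Q, ∀ x ∈ (pat q).support, ∃ v, c v = q ∧ (s v : EuclideanSpace ℝ (Fin d)) = x) :
    μ.real (⋂ q ∈ A, (pat q).occurs S) =
      (rowMask (patternMatrix K pat c fun v => (s v : EuclideanSpace ℝ (Fin d))) c A).det := by
  classical
  set O := Finset.univ.filter fun v => c v ∈ A ∧ (s v : EuclideanSpace ℝ (Fin d)) ∈ (pat (c v)).ones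
  set Z := Finset.univ.filter fun v => c v ∈ A ∧ (s v : EuclideanSpace ℝ (Fin d)) ∉ (pat (c v)).ones
  have hset : (⋂ q ∈ A, (pat q).occurs S) =
      {T : Set S | (∀ v ∈ O, s v ∈ T) ∧ ∀ v ∈ Z, s v ∉ T} := by
    ext T
    simp only [Set.mem_iInter, Pattern.mem_occurs, Set.mem_ofPred_eq, O, Z, Finset.mem_filter,
      Finset.mem_univ, true_and, and_imp]
    have hval : ∀ v, (s v : EuclideanSpace ℝ (Fin d)) ∈ Subtype.val '' T ↔ s v ∈ T := fun v =>
      ⟨fun ⟨y, hy, he⟩ => Subtype.ext he ▸ hy, fun h => ⟨_, h, rfl⟩⟩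
    constructor
    · intro h
      refine ⟨fun v hv hone => (hval v).1 ((h (c v) hv).1 _ hone), fun v hv hone hT => ?_⟩
      have := (Pattern.mem_support.1 (hmem v)).resolve_right hone
      exact (h (c v) hv).2 _ this ((hval v).2 hT)
    · rintro ⟨h1, h2⟩ q hq
      constructor
      · intro x hx
        obtain ⟨v, rfl, rfl⟩ := hsurj q (hA hq) x (Pattern.mem_support.2 (Or.inr hx))
        exact (hval v).2 (h1 v hq hx)
      · intro x hx
        obtain ⟨v, rfl, rfl⟩ := hsurj q (hA hq) x (Pattern.mem_support.2 (Or.inl hx))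
        rw [hval v]
        exact h2 v hq fun hx' => Finset.disjoint_left.1 (pat (c v)).disj hx hx'
  have hdis : Disjoint O Z := by
    rw [Finset.disjoint_left]
    intro v hv hv'
    simp only [O, Z, Finset.mem_filter] at hv hv'
    exact hv'.2.2 hv.2.2
  rw [hset, hK.measureReal_mem_notMem hs O Z hdis]
  congr 1
  ext v w
  simp only [rowMask, patternMatrix, Matrix.of_apply, O, Z, Finset.mem_filter, Finset.mem_univ,
    true_and]
  by_cases h1 : c v ∈ A <;> by_cases h2 : (s v : EuclideanSpace ℝ (Fin d)) ∈ (pat (c v)).ones <;>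
    simp [h1, h2]

/-- The indicator of the occurrence of a pattern. -/
noncomputable def patInd {ι : Type*} (S : Set (EuclideanSpace ℝ (Fin d))) (pat : ι → Pattern d)
    (q : ι) (T : Set S) : ℝ := ((pat q).occurs S).indicator 1 T

lemma prod_patInd {ι : Type*} (S : Set (EuclideanSpace ℝ (Fin d))) (pat : ι → Pattern d)
    (A : Finset ι) (T : Set S) :
    ∏ q ∈ A, patInd S pat q T = (⋂ q ∈ A, (pat q).occurs S).indicator 1 T := by
  classical
  induction A using Finset.induction_on with
  | empty => simp
  | insert a A ha ih =>
    rw [Finset.prod_insert ha, ih, Finset.set_biInter_insert, patInd, Set.inter_indicator_one, Pi.mul_apply]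

end PatternDeterminant

/-! ### Truncated correlations of the patterns of a determinantal process -/

section PatternTruncation

variable {d : ℕ} {S : Set (EuclideanSpace ℝ (Fin d))}
  {μ : Measure (Set S)} [IsProbabilityMeasure μ]
  {K : EuclideanSpace ℝ (Fin d) → EuclideanSpace ℝ (Fin d) → ℝ}

lemma measurable_patInd {ι : Type*} (S : Set (EuclideanSpace ℝ (Fin d))) (pat : ι → Pattern d)
    (q : ι) : Measurable (patInd S pat q) :=
  measurable_one.indicator (Pattern.measurableSet_occurs S (pat q))

lemma patInd_zero_or_one {ι : Type*} (S : Set (EuclideanSpace ℝ (Fin d))) (pat : ι → Pattern d)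
    (q : ι) (T : Set S) : patInd S pat q T = 0 ∨ patInd S pat q T = 1 := by
  by_cases h : T ∈ (pat q).occurs S <;> simp [patInd, h]

lemma integral_prod_patInd {ι : Type*} (pat : ι → Pattern d) (A : Finset ι) :
    ∫ T, ∏ q ∈ A, patInd S pat q T ∂μ = μ.real (⋂ q ∈ A, (pat q).occurs S) := by
  simp only [prod_patInd]
  exact integral_indicator_one
    (Finset.measurableSet_biInter _ fun q _ => Pattern.measurableSet_occurs S (pat q))

lemma indCov_patInd {ι : Type*} (pat : ι → Pattern d) (q r : ι) :
    indCov μ (patInd S pat) q r = (pat q).cov μ (pat r) := by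
  have h1 : ∀ q, ∫ T, patInd S pat q T ∂μ = μ.real ((pat q).occurs S) := fun q =>
    integral_indicator_one (Pattern.measurableSet_occurs S (pat q))
  have h2 : ∫ T, patInd S pat q T * patInd S pat r T ∂μ =
      μ.real ((pat q).occurs S ∩ (pat r).occurs S) := by
    rw [← integral_indicator_one ((Pattern.measurableSet_occurs S (pat q)).inter
      (Pattern.measurableSet_occurs S (pat r))), Set.inter_indicator_one]
    rfl
  rw [indCov, h1, h1, h2, Pattern.cov]

/-- The combinatorial constant in the bounds of the truncated correlation functions. -/
noncomputable def truncConst (N : ℕ) (m : ℝ) (k : ℕ) : ℝ :=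
  ((N * (k + 1)).factorial : ℝ) * m ^ (N * (k + 1))

open ClusterDet in
/-- The truncated correlation functions of the patterns of a determinantal process, and their
bounds by the decay of the kernel. -/
theorem IsDeterminantal.exists_isTruncated (hK : IsDeterminantal μ K) {ι : Type*} [DecidableEq ι]
    {pat : ι → Pattern d} {Q : Finset ι} (hS : ∀ q ∈ Q, (pat q).support ⊆ S)
    (hdis : ∀ q ∈ Q, ∀ r ∈ Q, q ≠ r → Disjoint (pat q).support (pat r).support)
    {N : ℕ} (hN : ∀ q ∈ Q, (pat q).sitesFinset.card ≤ N)
    {g : ι → ι → ℝ} (hg0 : ∀ q r, 0 ≤ g q r) (hg1 : ∀ q r, g q r ≤ 1) (hgq : ∀ q, g q q = 1)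
    (hgs : ∀ q r, g q r = g r q) {m : ℝ} (hm : 1 ≤ m)
    (hKg : ∀ q ∈ Q, ∀ r ∈ Q, ∀ x ∈ (pat q).support, ∀ y ∈ (pat r).support, x ≠ y →
      |K x y| ≤ m * g q r) :
    ∃ u : ι → Finset ι → ℝ, IsTruncated μ Q (patInd S pat) u ∧
      (∀ q ∈ Q, ∀ B ⊆ Q, q ∉ B → |u q B| ≤ truncConst N m B.card * treeWeight g B.card {q} B) ∧
      ∀ q ∈ Q, ∀ r ∈ Q, q ≠ r → |u q {r}| ≤ truncConst N m 1 * g q r ^ 2 := by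
  classical
  let X := Q.biUnion fun q => (pat q).sitesFinset
  let V := {x // x ∈ X}
  have hex : ∀ v : V, ∃ q ∈ Q, (v : EuclideanSpace ℝ (Fin d)) ∈ (pat q).support := by
    intro v
    obtain ⟨q, hq, hv⟩ := Finset.mem_biUnion.1 v.2
    exact ⟨q, hq, by rw [← Pattern.coe_sitesFinset]; exact hv⟩
  choose c hcQ hcs using hex
  have hcu : ∀ (v : V) (q : ι), q ∈ Q → (v : EuclideanSpace ℝ (Fin d)) ∈ (pat q).support →
      c v = q := by
    intro v q hq hv
    by_contra hne
    exact Set.disjoint_left.1 (hdis _ (hcQ v) q hq hne) (hcs v) hv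
  let s : V → S := fun v => ⟨v, hS _ (hcQ v) (hcs v)⟩
  have hs : Function.Injective s := fun v w h =>
    Subtype.ext (congrArg (fun x : S => (x : EuclideanSpace ℝ (Fin d))) h)
  have hsurj : ∀ q ∈ Q, ∀ x ∈ (pat q).support, ∃ v : V, c v = q ∧
      (s v : EuclideanSpace ℝ (Fin d)) = x := by
    intro q hq x hx
    have hxX : x ∈ X := Finset.mem_biUnion.2
      ⟨q, hq, by rw [← Finset.mem_coe, Pattern.coe_sitesFinset]; exact hx⟩
    exact ⟨⟨x, hxX⟩, hcu _ q hq hx, rfl⟩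
  set M := patternMatrix K pat c fun v => (s v : EuclideanSpace ℝ (Fin d)) with hM
  have hdet : ∀ A ⊆ Q, ∫ T, ∏ q ∈ A, patInd S pat q T ∂μ = (rowMask M c A).det := fun A hA => by
    rw [integral_prod_patInd, hK.measureReal_biInter_occurs hs hA hcs hsurj]
  -- Diagonal entries are values of `K` or `1 - K`, both in `[0, 1]`, and `g q q = 1`. Off the
  -- diagonal the entries are those of `K` up to sign.
  have hMb : ∀ v w, |M v w| ≤ m * g (c v) (c w) := by
    intro v w
    by_cases hvw : v = w
    · subst hvw
      rw [hgq, mul_one]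
      refine le_trans ?_ hm
      have := hK.diag_mem (s v)
      simp only [hM, patternMatrix, Matrix.of_apply, if_true]
      split_ifs <;> rw [abs_le] <;> constructor <;> linarith
    · have hne : (v : EuclideanSpace ℝ (Fin d)) ≠ w := fun h => hvw (Subtype.ext h)
      have := hKg _ (hcQ v) _ (hcQ w) v (hcs v) w (hcs w) hne
      simp only [hM, patternMatrix, Matrix.of_apply, if_neg hvw, zero_sub]
      split_ifs
      · exact this
      · rwa [abs_neg]
  have hcard : ∀ A ⊆ Q, (Finset.univ.filter fun v : V => c v ∈ A).card ≤ N * A.card := by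
    intro A hA
    have h1 : (Finset.univ.filter fun v : V => c v ∈ A).card ≤
        (A.biUnion fun q => (pat q).sitesFinset).card := by
      refine Finset.card_le_card_of_injOn (fun v => (v : EuclideanSpace ℝ (Fin d))) ?_
        fun v _ w _ h => Subtype.ext h
      intro v hv
      simp only [Finset.coe_filter, Finset.mem_univ, true_and, Set.mem_ofPred_eq] at hv
      refine Finset.mem_coe.2 (Finset.mem_biUnion.2 ⟨c v, hv, ?_⟩)
      rw [← Finset.mem_coe, Pattern.coe_sitesFinset]
      exact hcs v
    refine h1.trans (Finset.card_biUnion_le.trans ?_)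
    rw [mul_comm, ← smul_eq_mul]
    exact Finset.sum_le_card_nsmul _ _ _ fun q hq => hN q (hA hq)
  refine ⟨truncDet M c, ⟨measurable_patInd S pat, patInd_zero_or_one S pat, ?_⟩, ?_, ?_⟩
  · intro q hq A hA hqA
    have hins : ∀ T, patInd S pat q T * ∏ r ∈ A, patInd S pat r T =
        ∏ r ∈ insert q A, patInd S pat r T := fun T => by
      rw [Finset.prod_insert hqA]
    simp only [hins]
    rw [hdet _ (Finset.insert_subset hq hA), det_rowMask_insert M c hqA]
    refine Finset.sum_congr rfl fun B _ => ?_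
    rw [hdet _ (Finset.sdiff_subset.trans hA)]
  · intro q hq B hB hqB
    refine abs_truncDet_le_treeWeight hm hqB hg0 hg1 (fun v w _ _ => hMb v w) ?_
    have := hcard (insert q B) (Finset.insert_subset hq hB)
    rwa [Finset.card_insert_of_notMem hqB] at this
  · intro q hq r hr hqr
    have := hcard {q, r} (by
      intro x hx
      rw [Finset.mem_insert, Finset.mem_singleton] at hx
      rcases hx with rfl | rfl <;> assumption)
    rw [Finset.card_pair hqr] at this
    have h := abs_truncDet_singleton_le (M := M) (c := c) hm hqr hg0 hg1 (fun v w _ _ => hMb v w)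
      this
    rwa [hgs r q, ← sq] at h

/-- The tree bound summed over all sets of size `k`; the root is the single element `q`, whence `(1
+ k) ^ k`. -/
lemma sum_powersetCard_abs_le {ι : Type*} [DecidableEq ι] {Q : Finset ι} {g : ι → ι → ℝ}
    (hg0 : ∀ q r, 0 ≤ g q r) {u : ι → Finset ι → ℝ} {A L : ℝ} {k : ℕ} (hA : 0 ≤ A)
    (hL : ∀ q ∈ Q, ∑ r ∈ Q, g q r ≤ L)
    (hu : ∀ q ∈ Q, ∀ B ⊆ Q, q ∉ B → B.card = k →
      |u q B| ≤ A * ClusterDet.treeWeight g k {q} B) {q : ι} (hq : q ∈ Q) :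
    ∑ B ∈ (Q.erase q).powersetCard k, |u q B| ≤ A * ((1 + k) ^ k * L ^ k) := by
  calc ∑ B ∈ (Q.erase q).powersetCard k, |u q B|
      ≤ ∑ B ∈ (Q.erase q).powersetCard k, A * ClusterDet.treeWeight g k {q} B := by
        refine Finset.sum_le_sum fun B hB => ?_
        rw [Finset.mem_powersetCard] at hB
        exact hu q hq B (hB.1.trans (Finset.erase_subset _ _))
          (fun h => Finset.notMem_erase q Q (hB.1 h)) hB.2
    _ ≤ _ := by
        rw [← Finset.mul_sum]
        refine mul_le_mul_of_nonneg_left ?_ hA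
        have := ClusterDet.sum_treeWeight_le hg0 hL k (C := {q}) (S := Q.erase q)
          (by simpa using hq) (Finset.erase_subset _ _) (by simp)
        simpa using this

end PatternTruncation

/-! ### Periodic patterns and the decay of kernels in lattice coordinates -/

section LatticePatterns

variable {d : ℕ}

lemma Pattern.mem_support_translate {p : Pattern d} {l x : EuclideanSpace ℝ (Fin d)} :
    x ∈ (p.translate l).support ↔ ∃ y ∈ p.support, y + l = x := by
  simp only [Pattern.mem_support, Pattern.translate, Finset.mem_map, addRightEmbedding_apply]
  constructor
  · rintro (⟨y, hy, rfl⟩ | ⟨y, hy, rfl⟩)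
    exacts [⟨y, Or.inl hy, rfl⟩, ⟨y, Or.inr hy, rfl⟩]
  · rintro ⟨y, hy | hy, rfl⟩
    exacts [Or.inl ⟨y, hy, rfl⟩, Or.inr ⟨y, hy, rfl⟩]

lemma Pattern.translate_translate (p : Pattern d) (l l' : EuclideanSpace ℝ (Fin d)) :
    (p.translate l).translate l' = p.translate (l + l') := by
  ext x <;> simp [Pattern.translate, Finset.mem_map, add_assoc]

lemma Pattern.translate_zero (p : Pattern d) : p.translate 0 = p := by
  ext x <;> simp [Pattern.translate, Finset.mem_map]

lemma Pattern.support_nonempty (p : Pattern d) : p.support.Nonempty := by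
  rcases p.nonempty with ⟨x, hx⟩ | ⟨x, hx⟩
  exacts [⟨x, Or.inl hx⟩, ⟨x, Or.inr hx⟩]

lemma Pattern.location_translate (p : Pattern d) (l : EuclideanSpace ℝ (Fin d)) :
    (p.translate l).location = p.location + l := by
  have hpos : (0 : ℝ) < p.zeros.card + p.ones.card := by
    rcases p.nonempty with h | h <;> have := Finset.card_pos.2 h <;> positivity
  simp only [Pattern.location, Pattern.translate, Finset.card_map, Finset.sum_map,
    addRightEmbedding_apply, Finset.sum_add_distrib, Finset.sum_const]
  rw [← Nat.cast_smul_eq_nsmul ℝ, ← Nat.cast_smul_eq_nsmul ℝ, show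
    ∑ x ∈ p.zeros, x + (p.zeros.card : ℝ) • l + (∑ x ∈ p.ones, x + (p.ones.card : ℝ) • l) =
      (∑ x ∈ p.zeros, x + ∑ x ∈ p.ones, x) + ((p.zeros.card : ℝ) + p.ones.card) • l by
        rw [add_smul]; abel, smul_add, smul_smul, inv_mul_cancel₀ hpos.ne', one_smul]

lemma Pattern.finite_support (p : Pattern d) : p.support.Finite := by
  rw [← Pattern.coe_sitesFinset]
  exact Finset.finite_toSet _

variable {Λ : Submodule ℤ (EuclideanSpace ℝ (Fin d))} {P₀ : Finset (Pattern d)}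
  {Ω D : Set (EuclideanSpace ℝ (Fin d))}

/-- The pattern `p + l` of the periodic collection with index `(p, l)`. -/
def latticePattern (Λ : Submodule ℤ (EuclideanSpace ℝ (Fin d))) (P₀ : Finset (Pattern d))
    (q : P₀ × Λ) : Pattern d :=
  (q.1 : Pattern d).translate q.2

lemma latticePattern_translate (q : P₀ × Λ) (l : Λ) :
    (latticePattern Λ P₀ q).translate l = latticePattern Λ P₀ (q.1, q.2 + l) := by
  simp [latticePattern, Pattern.translate_translate]

lemma location_latticePattern (q : P₀ × Λ) :
    (latticePattern Λ P₀ q).location = (q.1 : Pattern d).location + q.2 :=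
  Pattern.location_translate _ _

lemma mem_periodicPatterns {p : Pattern d} :
    p ∈ periodicPatterns Λ P₀ ↔ ∃ q : P₀ × Λ, latticePattern Λ P₀ q = p := by
  constructor
  · rintro ⟨p, hp, l, hl, rfl⟩
    exact ⟨(⟨p, hp⟩, ⟨l, hl⟩), rfl⟩
  · rintro ⟨⟨p, l⟩, rfl⟩
    exact ⟨p, p.2, l, l.2, rfl⟩

lemma GeneratesDisjointPatterns.disjoint (h : GeneratesDisjointPatterns Λ Ω P₀) {q r : P₀ × Λ}
    (hqr : q ≠ r) :
    Disjoint (latticePattern Λ P₀ q).support (latticePattern Λ P₀ r).support := by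
  obtain ⟨p, l⟩ := q
  obtain ⟨p', l'⟩ := r
  have hne : (p : Pattern d) ≠ p' ∨ ((l' - l : Λ) : EuclideanSpace ℝ (Fin d)) ≠ 0 := by
    by_contra! hcon
    obtain ⟨h1, h2⟩ := hcon
    have h3 : l' - l = 0 := Subtype.ext h2
    exact hqr (Prod.ext (Subtype.ext h1) (sub_eq_zero.1 h3).symm)
  have := h.2 p p.2 p' p'.2 (l' - l : Λ) (l' - l).2 hne
  rw [Set.disjoint_left] at this ⊢
  intro x hx hx'
  obtain ⟨y, hy, rfl⟩ := Pattern.mem_support_translate.1 hx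
  obtain ⟨y', hy', he⟩ := Pattern.mem_support_translate.1 hx'
  refine this hy (Pattern.mem_support_translate.2 ⟨y', hy', ?_⟩)
  simp only at he
  rw [Submodule.coe_sub, ← add_sub_assoc, he, add_sub_cancel_right]

/-- Equal patterns with different indices would be disjoint from themselves, but supports are
nonempty. -/
lemma GeneratesDisjointPatterns.injective (h : GeneratesDisjointPatterns Λ Ω P₀) :
    Function.Injective (latticePattern Λ P₀) := by
  intro q r hqr
  by_contra hne
  have h1 := h.disjoint hne
  rw [hqr, disjoint_self] at h1
  exact (Pattern.support_nonempty _).ne_empty h1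

/-- The patterns of the periodic collection, indexed by the fundamental patterns and the lattice. -/
noncomputable def patternEquiv (h : GeneratesDisjointPatterns Λ Ω P₀) :
    P₀ × Λ ≃ periodicPatterns Λ P₀ :=
  Equiv.ofBijective (fun q => ⟨latticePattern Λ P₀ q, mem_periodicPatterns.2 ⟨q, rfl⟩⟩)
    ⟨fun _ _ hqr => h.injective (congrArg Subtype.val hqr), fun ⟨_, hp⟩ => by
      obtain ⟨q, hq⟩ := mem_periodicPatterns.1 hp
      exact ⟨q, Subtype.ext hq⟩⟩

lemma latticePattern_support_subset (hΩ : IsPeriodicSet Λ Ω)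
    (h : GeneratesDisjointPatterns Λ Ω P₀) (q : P₀ × Λ) :
    (latticePattern Λ P₀ q).support ⊆ Ω := by
  intro x hx
  obtain ⟨y, hy, rfl⟩ := Pattern.mem_support_translate.1 hx
  exact hΩ.1 _ q.2.2 _ (h.1 q.1 q.1.2 hy)

lemma exists_card_sitesFinset_le (Λ : Submodule ℤ (EuclideanSpace ℝ (Fin d)))
    (P₀ : Finset (Pattern d)) :
    ∃ N : ℕ, ∀ q : P₀ × Λ, (latticePattern Λ P₀ q).sitesFinset.card ≤ N := by
  refine ⟨∑ p ∈ P₀, (p.zeros.card + p.ones.card), fun q => ?_⟩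
  refine (Finset.card_union_le _ _).trans ?_
  simp only [latticePattern, Pattern.translate, Finset.card_map]
  exact Finset.single_le_sum (f := fun p : Pattern d => p.zeros.card + p.ones.card)
    (fun _ _ => Nat.zero_le _) q.1.2

/-- All the sites and locations of the fundamental patterns lie in a ball. -/
lemma exists_pattern_radius (P₀ : Finset (Pattern d)) :
    ∃ ρ : ℝ, 0 ≤ ρ ∧ ∀ p ∈ P₀, ‖p.location‖ ≤ ρ ∧ ∀ x ∈ p.support, ‖x‖ ≤ ρ := by
  have h1 : ∀ p : Pattern d, ∃ ρ : ℝ, ‖p.location‖ ≤ ρ ∧ ∀ x ∈ p.support, ‖x‖ ≤ ρ := by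
    intro p
    obtain ⟨R, hR⟩ := p.finite_support.isBounded.exists_norm_le
    exact ⟨max ‖p.location‖ R, le_max_left _ _, fun x hx => (hR x hx).trans (le_max_right _ _)⟩
  choose ρ hρ using h1
  have h0 : ∀ p, 0 ≤ ρ p := fun p => (norm_nonneg _).trans (hρ p).1
  refine ⟨∑ p ∈ P₀, ρ p, Finset.sum_nonneg fun p _ => h0 p, fun p hp => ?_⟩
  have hle : ρ p ≤ ∑ p ∈ P₀, ρ p := Finset.single_le_sum (fun p _ => h0 p) hp
  exact ⟨(hρ p).1.trans hle, fun x hx => ((hρ p).2 x hx).trans hle⟩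

variable [DiscreteTopology Λ] [IsZLattice ℝ Λ]

/-- The sites of the patterns of the periodic collection are uniformly separated. -/
lemma exists_separation (Λ : Submodule ℤ (EuclideanSpace ℝ (Fin d))) [DiscreteTopology Λ]
    [IsZLattice ℝ Λ] (P₀ : Finset (Pattern d)) :
    ∃ δ : ℝ, 0 < δ ∧ ∀ q r : P₀ × Λ, ∀ x ∈ (latticePattern Λ P₀ q).support,
      ∀ y ∈ (latticePattern Λ P₀ r).support, x ≠ y → δ ≤ ‖x - y‖ := by
  obtain ⟨ρ, hρ0, hρ⟩ := exists_pattern_radius P₀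
  set Z : Set (EuclideanSpace ℝ (Fin d) × EuclideanSpace ℝ (Fin d) × Λ) :=
    (⋃ p ∈ P₀, p.support) ×ˢ (⋃ p ∈ P₀, p.support) ×ˢ
      {l : Λ | ‖(l : EuclideanSpace ℝ (Fin d))‖ ≤ 1 + 2 * ρ} with hZ
  have hfin : Z.Finite := by
    have h1 : (⋃ p ∈ P₀, p.support).Finite :=
      P₀.finite_toSet.biUnion fun p _ => p.finite_support
    exact h1.prod (h1.prod (finite_lattice_norm_le Λ _))
  -- A difference of two sites has the form `x₀ - y₀ + l`. If `‖l‖ > 1 + 2 * ρ`, its norm is at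
  -- least 1; only the finitely many triples of `Z` remain.
  have hev : ∀ᶠ δ in 𝓝[>] (0 : ℝ), ∀ z ∈ Z,
      z.1 - z.2.1 + (z.2.2 : EuclideanSpace ℝ (Fin d)) ≠ 0 →
        δ ≤ ‖z.1 - z.2.1 + (z.2.2 : EuclideanSpace ℝ (Fin d))‖ := by
    rw [Filter.eventually_all_finite hfin]
    intro z _
    by_cases h0 : z.1 - z.2.1 + (z.2.2 : EuclideanSpace ℝ (Fin d)) = 0
    · simp [h0]
    · filter_upwards [nhdsWithin_le_nhds (eventually_le_nhds (norm_pos_iff.2 h0))] with δ hδ _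
      exact hδ
  obtain ⟨δ, ⟨h1, h2⟩, h3⟩ := ((hev.and (nhdsWithin_le_nhds
    (eventually_le_nhds (zero_lt_one' ℝ)))).and self_mem_nhdsWithin).exists
  refine ⟨δ, h3, fun q r x hx y hy hxy => ?_⟩
  obtain ⟨x₀, hx₀, rfl⟩ := Pattern.mem_support_translate.1 hx
  obtain ⟨y₀, hy₀, rfl⟩ := Pattern.mem_support_translate.1 hy
  have hsub : x₀ + (q.2 : EuclideanSpace ℝ (Fin d)) - (y₀ + r.2) = x₀ - y₀ + ((q.2 - r.2 : Λ) :
      EuclideanSpace ℝ (Fin d)) := by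
    rw [Submodule.coe_sub]; abel
  rw [hsub]
  have hne : x₀ - y₀ + ((q.2 - r.2 : Λ) : EuclideanSpace ℝ (Fin d)) ≠ 0 := by
    rw [← hsub]; exact sub_ne_zero.2 hxy
  by_cases hl : ‖((q.2 - r.2 : Λ) : EuclideanSpace ℝ (Fin d))‖ ≤ 1 + 2 * ρ
  · exact h1 (x₀, y₀, q.2 - r.2) ⟨Set.mem_biUnion q.1.2 hx₀, Set.mem_biUnion r.1.2 hy₀, hl⟩ hne
  · push Not at hl
    have e1 := (hρ q.1 q.1.2).2 x₀ hx₀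
    have e2 := (hρ r.1 r.1.2).2 y₀ hy₀
    have e3 : ‖((q.2 - r.2 : Λ) : EuclideanSpace ℝ (Fin d))‖ ≤
        ‖x₀ - y₀ + ((q.2 - r.2 : Λ) : EuclideanSpace ℝ (Fin d))‖ + ‖x₀ - y₀‖ := by
      have := norm_sub_le (x₀ - y₀ + ((q.2 - r.2 : Λ) : EuclideanSpace ℝ (Fin d))) (x₀ - y₀)
      rwa [add_sub_cancel_left] at this
    have e4 := norm_sub_le x₀ y₀
    linarith

/-- The decay in the lattice distance used to compare the kernels on different patterns. -/
noncomputable def latticeDecay (Λ : Submodule ℤ (EuclideanSpace ℝ (Fin d))) (P₀ : Finset (Pattern d))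
    (q r : P₀ × Λ) : ℝ :=
  (1 + ‖((q.2 - r.2 : Λ) : EuclideanSpace ℝ (Fin d))‖) ^ (-(d : ℝ))

lemma latticeDecay_nonneg (q r : P₀ × Λ) : 0 ≤ latticeDecay Λ P₀ q r := by
  unfold latticeDecay; positivity

lemma latticeDecay_le_one (q r : P₀ × Λ) : latticeDecay Λ P₀ q r ≤ 1 := by
  have h := norm_nonneg ((q.2 - r.2 : Λ) : EuclideanSpace ℝ (Fin d))
  exact Real.rpow_le_one_of_one_le_of_nonpos (by linarith) (by simp)

lemma latticeDecay_self (q : P₀ × Λ) : latticeDecay Λ P₀ q q = 1 := by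
  simp [latticeDecay]

lemma latticeDecay_comm (q r : P₀ × Λ) : latticeDecay Λ P₀ q r = latticeDecay Λ P₀ r q := by
  unfold latticeDecay
  rw [← neg_sub r.2 q.2, Submodule.coe_neg, norm_neg]

/-- The difference of two sites is within `2 * ρ` of the difference of the lattice vectors, and
distinct sites are at least `δ` apart. Hence 1 plus the lattice distance is at most `κ` times the
distance of the sites. -/
lemma exists_kernel_le_latticeDecay (Λ : Submodule ℤ (EuclideanSpace ℝ (Fin d)))
    [DiscreteTopology Λ] [IsZLattice ℝ Λ] (P₀ : Finset (Pattern d)) (M : ℝ) :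
    ∃ m : ℝ, 1 ≤ m ∧ ∀ q r : P₀ × Λ, ∀ x ∈ (latticePattern Λ P₀ q).support,
      ∀ y ∈ (latticePattern Λ P₀ r).support, x ≠ y →
        M / ‖x - y‖ ^ d ≤ m * latticeDecay Λ P₀ q r := by
  obtain ⟨ρ, hρ0, hρ⟩ := exists_pattern_radius P₀
  obtain ⟨δ, hδ0, hδ⟩ := exists_separation Λ P₀
  set κ := (1 + 2 * ρ) / δ + 1 with hκ
  have hκ0 : 0 < κ := by positivity
  refine ⟨max 1 (|M| * κ ^ d), le_max_left _ _, fun q r x hx y hy hxy => ?_⟩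
  have hsep := hδ q r x hx y hy hxy
  obtain ⟨x₀, hx₀, rfl⟩ := Pattern.mem_support_translate.1 hx
  obtain ⟨y₀, hy₀, rfl⟩ := Pattern.mem_support_translate.1 hy
  set w := x₀ + (q.2 : EuclideanSpace ℝ (Fin d)) - (y₀ + r.2) with hw
  have hw0 : 0 < ‖w‖ := hδ0.trans_le hsep
  set t := ‖((q.2 - r.2 : Λ) : EuclideanSpace ℝ (Fin d))‖ with ht
  have ht0 : 0 ≤ t := norm_nonneg _
  have h1 : t ≤ ‖w‖ + 2 * ρ := by
    have e1 := (hρ q.1 q.1.2).2 x₀ hx₀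
    have e2 := (hρ r.1 r.1.2).2 y₀ hy₀
    have e3 : ((q.2 - r.2 : Λ) : EuclideanSpace ℝ (Fin d)) = w - (x₀ - y₀) := by
      rw [hw, Submodule.coe_sub]; abel
    rw [ht, e3]
    have := norm_sub_le w (x₀ - y₀)
    have := norm_sub_le x₀ y₀
    linarith
  have h2 : 1 + t ≤ κ * ‖w‖ := by
    have : 1 + 2 * ρ ≤ (1 + 2 * ρ) / δ * ‖w‖ := by
      rw [div_mul_eq_mul_div, le_div_iff₀ hδ0]
      exact mul_le_mul_of_nonneg_left hsep (by positivity)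
    rw [hκ, add_mul]
    linarith
  have h3 : (1 + t) ^ d ≤ κ ^ d * ‖w‖ ^ d := by
    rw [← mul_pow]
    exact pow_le_pow_left₀ (by positivity) h2 d
  have h4 : latticeDecay Λ P₀ q r = ((1 + t) ^ d)⁻¹ := by
    rw [latticeDecay, Real.rpow_neg (by positivity), Real.rpow_natCast]
  rw [h4]
  calc M / ‖w‖ ^ d ≤ |M| / ‖w‖ ^ d := by gcongr; exact le_abs_self M
    _ ≤ |M| * κ ^ d * ((1 + t) ^ d)⁻¹ := by
        rw [← div_eq_mul_inv, div_le_div_iff₀ (by positivity) (by positivity), mul_assoc]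
        exact mul_le_mul_of_nonneg_left h3 (abs_nonneg _)
    _ ≤ _ := mul_le_mul_of_nonneg_right (le_max_right _ _) (by positivity)

end LatticePatterns

/-! ### Locally uniform convergence of pattern probabilities and covariances -/

section UniformConvergence

variable {d : ℕ}

lemma tendsto_pnat_cast_atTop : Tendsto (fun n : ℕ+ => (n : ℝ)) atTop atTop :=
  tendsto_natCast_atTop_atTop.comp tendsto_PNat_val_atTop_atTop

/-- A compact subset of an open set has a compact neighbourhood in it that absorbs microscopic
displacements. -/
lemma exists_compact_eventually_mem {C D : Set (EuclideanSpace ℝ (Fin d))} (hC : IsCompact C)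
    (hD : IsOpen D) (hCD : C ⊆ D) :
    ∃ C', IsCompact C' ∧ C' ⊆ D ∧ ∀ R : ℝ, ∀ᶠ n : ℕ+ in atTop,
      ∀ x y : EuclideanSpace ℝ (Fin d), (n : ℝ)⁻¹ • x ∈ C → ‖y - x‖ ≤ R → (n : ℝ)⁻¹ • y ∈ C' := by
  obtain ⟨δ, hδ, hsub⟩ := hC.exists_cthickening_subset_open hD hCD
  refine ⟨Metric.cthickening δ C, hC.cthickening, hsub, fun R => ?_⟩
  filter_upwards [tendsto_pnat_cast_atTop.eventually_ge_atTop (R / δ)] with n hn x y hx hxy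
  refine Metric.mem_cthickening_of_dist_le _ _ _ _ hx ?_
  have hn0 : (0 : ℝ) < n := by exact_mod_cast n.pos
  rw [dist_eq_norm, ← smul_sub, norm_smul, norm_inv, Real.norm_of_nonneg hn0.le,
    inv_mul_le_iff₀ hn0]
  rw [div_le_iff₀ hδ] at hn
  exact hxy.trans hn

variable {Λ : Submodule ℤ (EuclideanSpace ℝ (Fin d))} {P₀ : Finset (Pattern d)}
  {Ω D : Set (EuclideanSpace ℝ (Fin d))}
  {Kn : ℕ+ → EuclideanSpace ℝ (Fin d) → EuclideanSpace ℝ (Fin d) → ℝ}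
  {μn : ∀ n : ℕ+, Measure (Set (sites Ω D n))} [∀ n, IsProbabilityMeasure (μn n)]
  {K : EuclideanSpace ℝ (Fin d) → EuclideanSpace ℝ (Fin d) → ℝ}
  {μ : Measure (Set Ω)} [IsProbabilityMeasure μ]

open ClusterDet in
/-- The probabilities of the joint occurrence of finitely many patterns converge, uniformly over
lattice translations at macroscopic positions in a compact subset of `D`. -/
theorem KernelsConverge.eventually_abs_prob_sub_lt (hΩ : IsPeriodicSet Λ Ω) (hD : IsOpen D)
    (hKn : ∀ n, IsDeterminantal (μn n) (Kn n)) (hK : IsDeterminantal μ K)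
    (hconv : KernelsConverge Λ Ω D Kn K) (hP₀ : GeneratesDisjointPatterns Λ Ω P₀)
    {C : Set (EuclideanSpace ℝ (Fin d))} (hC : IsCompact C) (hCD : C ⊆ D) (A : Finset (P₀ × Λ))
    {ε : ℝ} (hε : 0 < ε) :
    ∀ᶠ n : ℕ+ in atTop, ∀ l : Λ, (n : ℝ)⁻¹ • (l : EuclideanSpace ℝ (Fin d)) ∈ C →
      |(μn n).real (⋂ q ∈ A, (latticePattern Λ P₀ (q.1, q.2 + l)).occurs (sites Ω D n)) -
        μ.real (⋂ q ∈ A, (latticePattern Λ P₀ q).occurs Ω)| < ε := by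
  classical
  let X := A.biUnion fun q => (latticePattern Λ P₀ q).sitesFinset
  let V := {x // x ∈ X}
  have hex : ∀ v : V, ∃ q ∈ A,
      (v : EuclideanSpace ℝ (Fin d)) ∈ (latticePattern Λ P₀ q).support := by
    intro v
    obtain ⟨q, hq, hv⟩ := Finset.mem_biUnion.1 v.2
    exact ⟨q, hq, by rw [← Pattern.coe_sitesFinset]; exact hv⟩
  choose c hcA hcs using hex
  have hsurj₀ : ∀ q ∈ A, ∀ x ∈ (latticePattern Λ P₀ q).support, ∃ v : V, c v = q ∧
      (v : EuclideanSpace ℝ (Fin d)) = x := by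
    intro q hq x hx
    have hxX : x ∈ X := Finset.mem_biUnion.2
      ⟨q, hq, by rw [← Finset.mem_coe, Pattern.coe_sitesFinset]; exact hx⟩
    refine ⟨⟨x, hxX⟩, ?_, rfl⟩
    by_contra hne
    exact Set.disjoint_left.1 (hP₀.disjoint hne) (hcs ⟨x, hxX⟩) hx
  have hVΩ : ∀ v : V, (v : EuclideanSpace ℝ (Fin d)) ∈ Ω := fun v =>
    latticePattern_support_subset hΩ hP₀ _ (hcs v)
  -- the probabilities as a continuous function of the kernel
  let F : (V → V → ℝ) → ℝ := fun k => (rowMask (Matrix.of fun v w =>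
    if (v : EuclideanSpace ℝ (Fin d)) ∈ (latticePattern Λ P₀ (c v)).ones then k v w else
      (if v = w then 1 else 0) - k v w) c A).det
  have hF : Continuous F := by
    refine Continuous.matrix_det ?_
    refine continuous_pi fun v => continuous_pi fun w => ?_
    simp only [rowMask, Matrix.of_apply]
    split_ifs <;> fun_prop
  have hlim : μ.real (⋂ q ∈ A, (latticePattern Λ P₀ q).occurs Ω) = F fun v w => K v w := by
    rw [hK.measureReal_biInter_occurs (c := c) (s := fun v : V => ⟨v, hVΩ v⟩)
      (fun v w h => Subtype.ext (congrArg (fun x : Ω => (x : EuclideanSpace ℝ (Fin d))) h))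
      subset_rfl hcs hsurj₀]
    rfl
  obtain ⟨δ, hδ, hFδ⟩ := Metric.continuous_iff.1 hF (fun v w => K v w) ε hε
  obtain ⟨C', hC', hC'D, hev⟩ := exists_compact_eventually_mem hC hD hCD
  obtain ⟨R, hR⟩ : ∃ R : ℝ, ∀ v : V, ‖(v : EuclideanSpace ℝ (Fin d))‖ ≤ R := by
    obtain ⟨R, hR⟩ := X.finite_toSet.isBounded.exists_norm_le
    exact ⟨R, fun v => hR v v.2⟩
  have hker : ∀ᶠ n : ℕ+ in atTop, ∀ v w : V, ∀ l ∈ Λ, (n : ℝ)⁻¹ • l ∈ C →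
      |Kn n (v + l) (w + l) - K v w| < δ := by
    simp only [eventually_all]
    exact fun v w => hconv C hCD hC v (hVΩ v) w (hVΩ w) δ hδ
  filter_upwards [hev R, hker] with n hn hkn l hl
  have hmemD : ∀ v : V, (v : EuclideanSpace ℝ (Fin d)) + l ∈ sites Ω D n := fun v =>
    ⟨hΩ.1 l l.2 v (hVΩ v), hC'D (hn l _ hl (by rw [add_sub_cancel_right]; exact hR v))⟩
  -- Translation by `l` preserves the index set `V`, the colours and the spins. Only the kernel
  -- entries change, so the same continuous function `F` gives the probability.
  have hn' : (μn n).real (⋂ q ∈ A, (latticePattern Λ P₀ (q.1, q.2 + l)).occurs (sites Ω D n)) =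
      F fun v w => Kn n (v + l) (w + l) := by
    rw [(hKn n).measureReal_biInter_occurs (c := c)
      (pat := fun q => latticePattern Λ P₀ (q.1, q.2 + l))
      (s := fun v : V => ⟨v + l, hmemD v⟩)
      (fun v w h => Subtype.ext (add_right_cancel (congrArg Subtype.val h))) subset_rfl]
    · simp only [F, patternMatrix, ← latticePattern_translate]
      congr 2
      ext v w
      simp [Pattern.translate]
    · intro v
      rw [← latticePattern_translate]
      exact Pattern.mem_support_translate.2 ⟨v, hcs v, rfl⟩
    · intro q hq x hx
      rw [← latticePattern_translate] at hx
      obtain ⟨y, hy, rfl⟩ := Pattern.mem_support_translate.1 hx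
      obtain ⟨v, hv, rfl⟩ := hsurj₀ q hq y hy
      exact ⟨v, hv, rfl⟩
  rw [hn', hlim, ← Real.dist_eq]
  refine hFδ _ ?_
  rw [dist_pi_lt_iff hδ]
  intro v
  rw [dist_pi_lt_iff hδ]
  intro w
  rw [Real.dist_eq]
  exact hkn v w l l.2 hl

/-- The covariances of two patterns converge, uniformly over lattice translations at macroscopic
positions in a compact subset of `D`. -/
theorem KernelsConverge.eventually_abs_cov_sub_lt (hΩ : IsPeriodicSet Λ Ω) (hD : IsOpen D)
    (hKn : ∀ n, IsDeterminantal (μn n) (Kn n)) (hK : IsDeterminantal μ K)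
    (hconv : KernelsConverge Λ Ω D Kn K) (hP₀ : GeneratesDisjointPatterns Λ Ω P₀)
    {C : Set (EuclideanSpace ℝ (Fin d))} (hC : IsCompact C) (hCD : C ⊆ D) (q r : P₀ × Λ)
    {ε : ℝ} (hε : 0 < ε) :
    ∀ᶠ n : ℕ+ in atTop, ∀ l : Λ, (n : ℝ)⁻¹ • (l : EuclideanSpace ℝ (Fin d)) ∈ C →
      |(latticePattern Λ P₀ (q.1, q.2 + l)).cov (μn n) (latticePattern Λ P₀ (r.1, r.2 + l)) -
        (latticePattern Λ P₀ q).cov μ (latticePattern Λ P₀ r)| < ε := by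
  classical
  have key := fun A : Finset (P₀ × Λ) => hconv.eventually_abs_prob_sub_lt hΩ hD hKn hK hP₀ hC hCD A
    (show 0 < ε / 3 by positivity)
  filter_upwards [key {q, r}, key {q}, key {r}] with n h1 h2 h3 l hl
  have h1 := h1 l hl
  have h2 := h2 l hl
  have h3 := h3 l hl
  simp only [Finset.mem_insert, Finset.mem_singleton, Set.iInter_iInter_eq_or_left,
    Set.iInter_iInter_eq_left] at h1 h2 h3
  simp only [Pattern.cov]
  have b1 : |(μn n).real ((latticePattern Λ P₀ (q.1, q.2 + l)).occurs (sites Ω D n))| ≤ 1 := by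
    rw [abs_of_nonneg measureReal_nonneg]; exact measureReal_le_one
  have b2 : |μ.real ((latticePattern Λ P₀ r).occurs Ω)| ≤ 1 := by
    rw [abs_of_nonneg measureReal_nonneg]; exact measureReal_le_one
  generalize (μn n).real ((latticePattern Λ P₀ (q.1, q.2 + l)).occurs (sites Ω D n)) = a at *
  generalize (μn n).real ((latticePattern Λ P₀ (r.1, r.2 + l)).occurs (sites Ω D n)) = b at *
  generalize μ.real ((latticePattern Λ P₀ q).occurs Ω) = a' at *
  generalize μ.real ((latticePattern Λ P₀ r).occurs Ω) = b' at *
  -- `a * b - a' * b' = a * (b - b') + (a - a') * b'`; with the joint probability this makes three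
  -- errors below `ε / 3`.
  have e1 : |a * (b - b')| ≤ |b - b'| := by
    rw [abs_mul]; exact mul_le_of_le_one_left (abs_nonneg _) b1
  have e2 : |(a - a') * b'| ≤ |a - a'| := by
    rw [abs_mul]; exact mul_le_of_le_one_right (abs_nonneg _) b2
  rw [abs_lt] at *
  rw [abs_le] at e1 e2
  have := abs_lt.2 h2
  have := abs_lt.2 h3
  constructor <;> nlinarith

end UniformConvergence

/-! ### Sums over pattern indices and the scaling of the error -/

section FieldBounds

variable {d : ℕ}

lemma tendsto_pnat_rpow_neg {e : ℝ} (he : 0 < e) :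
    Tendsto (fun n : ℕ+ => (n : ℝ) ^ (-e)) atTop (𝓝 0) :=
  (tendsto_rpow_neg_atTop he).comp tendsto_pnat_cast_atTop

variable (Λ : Submodule ℤ (EuclideanSpace ℝ (Fin d))) [DiscreteTopology Λ] [IsZLattice ℝ Λ]
  (P₀ : Finset (Pattern d))

/-- The summand depends only on the lattice component, and each lattice vector carries at most
`P₀.card` patterns. -/
lemma sum_index_le {f : Λ → ℝ} (hf : ∀ l, 0 ≤ f l) (Q : Finset (P₀ × Λ)) :
    ∃ T : Finset Λ, (∀ l ∈ T, ∃ q ∈ Q, q.2 = l) ∧ ∑ q ∈ Q, f q.2 ≤ P₀.card * ∑ l ∈ T, f l := by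
  classical
  refine ⟨Q.image Prod.snd, fun l hl => by simpa using hl, ?_⟩
  calc ∑ q ∈ Q, f q.2 ≤ ∑ q ∈ (Finset.univ : Finset P₀) ×ˢ Q.image Prod.snd, f q.2 :=
        Finset.sum_le_sum_of_subset_of_nonneg
          (fun q hq => Finset.mem_product.2 ⟨Finset.mem_univ _, Finset.mem_image_of_mem _ hq⟩)
          fun q _ _ => hf q.2
    _ = _ := by
        rw [Finset.sum_product]
        simp

lemma sum_index_rpow_le {s : ℝ} (hs : (d : ℝ) < s) (l₀ : Λ) (Q : Finset (P₀ × Λ)) :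
    ∑ q ∈ Q, (1 + ‖((l₀ - q.2 : Λ) : EuclideanSpace ℝ (Fin d))‖) ^ (-s) ≤
      P₀.card * ∑' l : Λ, (1 + ‖(l : EuclideanSpace ℝ (Fin d))‖) ^ (-s) := by
  obtain ⟨T, -, hT⟩ := sum_index_le Λ P₀
    (f := fun l => (1 + ‖((l₀ - l : Λ) : EuclideanSpace ℝ (Fin d))‖) ^ (-s))
    (fun l => by positivity) Q
  exact hT.trans (mul_le_mul_of_nonneg_left (sum_one_add_norm_sub_rpow_le Λ hs l₀ T)
    (Nat.cast_nonneg _))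

lemma exists_card_index_le (R : ℝ) :
    ∃ C : ℝ, 0 ≤ C ∧ ∀ (n : ℕ+) (Q : Finset (P₀ × Λ)),
      (∀ q ∈ Q, ‖(q.2 : EuclideanSpace ℝ (Fin d))‖ ≤ R * n) → (Q.card : ℝ) ≤ C * (n : ℝ) ^ d := by
  obtain ⟨C, hC0, hC⟩ := exists_card_lattice_ball_le Λ R
  refine ⟨P₀.card * C, by positivity, fun n Q hQ => ?_⟩
  obtain ⟨T, hT, hle⟩ := sum_index_le Λ P₀ (f := fun _ => 1) (fun _ => zero_le_one) Q
  have := hC n T fun l hl => by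
    obtain ⟨q, hq, rfl⟩ := hT l hl
    exact hQ q hq
  simp only [Finset.sum_const, nsmul_eq_mul, mul_one] at hle
  rw [mul_assoc]
  exact hle.trans (mul_le_mul_of_nonneg_left this (Nat.cast_nonneg _))

variable {Λ P₀}

lemma latticeDecay_sq (q r : P₀ × Λ) : latticeDecay Λ P₀ q r ^ 2 =
    (1 + ‖((q.2 - r.2 : Λ) : EuclideanSpace ℝ (Fin d))‖) ^ (-(2 * d : ℝ)) := by
  rw [latticeDecay, ← Real.rpow_natCast, ← Real.rpow_mul (by positivity)]
  congr 1
  push_cast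
  ring

variable (Λ P₀)

lemma exists_sum_latticeDecay_sq_le (hd : 1 ≤ d) :
    ∃ G : ℝ, 0 ≤ G ∧ ∀ (q : P₀ × Λ) (Q : Finset (P₀ × Λ)),
      ∑ r ∈ Q, latticeDecay Λ P₀ q r ^ 2 ≤ G := by
  have hd' : (1 : ℝ) ≤ d := by exact_mod_cast hd
  refine ⟨P₀.card * ∑' l : Λ, (1 + ‖(l : EuclideanSpace ℝ (Fin d))‖) ^ (-(2 * d : ℝ)),
    mul_nonneg (Nat.cast_nonneg _) (tsum_nonneg fun l => by positivity), fun q Q => ?_⟩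
  simp only [latticeDecay_sq]
  exact sum_index_rpow_le Λ P₀ (by linarith) q.2 Q

/-- The decay `|x|^{-d}` is not summable, but its sum over a box grows slower than any power. -/
lemma exists_sum_latticeDecay_le (hd : 1 ≤ d) {R : ℝ} (hR : 0 ≤ R) :
    ∃ L : ℝ, 0 ≤ L ∧ ∀ (n : ℕ+) (Q : Finset (P₀ × Λ)),
      (∀ q ∈ Q, ‖(q.2 : EuclideanSpace ℝ (Fin d))‖ ≤ R * n) → ∀ q ∈ Q,
        ∑ r ∈ Q, latticeDecay Λ P₀ q r ≤ L * (n : ℝ) ^ ((d : ℝ) / 8) := by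
  have hd' : (1 : ℝ) ≤ d := by exact_mod_cast hd
  -- The exponent `s > d` makes the lattice sum converge. The surplus factor `(1 + ‖·‖) ^ (d / 8)`
  -- is at most `((1 + 2 * R) * n) ^ (d / 8)` in the box.
  set s : ℝ := d + d / 8 with hs
  set G := P₀.card * ∑' l : Λ, (1 + ‖(l : EuclideanSpace ℝ (Fin d))‖) ^ (-s) with hG
  have hG0 : 0 ≤ G := mul_nonneg (Nat.cast_nonneg _) (tsum_nonneg fun l => by positivity)
  refine ⟨(1 + 2 * R) ^ ((d : ℝ) / 8) * G, by positivity, fun n Q hQ q hq => ?_⟩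
  have hn1 : (1 : ℝ) ≤ n := Nat.one_le_cast.2 n.pos
  have hterm : ∀ r ∈ Q, latticeDecay Λ P₀ q r ≤ ((1 + 2 * R) * n) ^ ((d : ℝ) / 8) *
      (1 + ‖((q.2 - r.2 : Λ) : EuclideanSpace ℝ (Fin d))‖) ^ (-s) := by
    intro r hr
    have hpos : 0 < 1 + ‖((q.2 - r.2 : Λ) : EuclideanSpace ℝ (Fin d))‖ := by positivity
    have hle : 1 + ‖((q.2 - r.2 : Λ) : EuclideanSpace ℝ (Fin d))‖ ≤ (1 + 2 * R) * n := by
      have h1 := hQ q hq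
      have h2 := hQ r hr
      have h3 : ‖((q.2 - r.2 : Λ) : EuclideanSpace ℝ (Fin d))‖ ≤
        ‖(q.2 : EuclideanSpace ℝ (Fin d))‖ + ‖(r.2 : EuclideanSpace ℝ (Fin d))‖ := by
        rw [Submodule.coe_sub]; exact norm_sub_le _ _
      linarith
    calc latticeDecay Λ P₀ q r = (1 + ‖((q.2 - r.2 : Λ) : EuclideanSpace ℝ (Fin d))‖) ^
          ((d : ℝ) / 8) * (1 + ‖((q.2 - r.2 : Λ) : EuclideanSpace ℝ (Fin d))‖) ^ (-s) := by
          rw [latticeDecay, ← Real.rpow_add hpos, hs]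
          congr 1
          ring
      _ ≤ _ := by gcongr
  refine (Finset.sum_le_sum hterm).trans ?_
  rw [← Finset.mul_sum, Real.mul_rpow (by positivity) (by positivity), mul_right_comm]
  rw [mul_right_comm _ G]
  rw [mul_right_comm]
  exact mul_le_mul_of_nonneg_left (sum_index_rpow_le Λ P₀ (by rw [hs]; linarith) q.2 Q)
    (by positivity)

/-- The scaling of the error in the moment recursion. -/
lemma tendsto_momentError_zero (hd : 1 ≤ d) (b c L : ℝ) (A : ℕ → ℝ) (m : ℕ) :
    Tendsto (fun n : ℕ+ => momentError (b * (n : ℝ) ^ (-(d : ℝ) / 2))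
      (fun k => if k = 1 then c else A k * (L * (n : ℝ) ^ ((d : ℝ) / 8)) ^ k) m) atTop (𝓝 0) := by
  have hd' : (1 : ℝ) ≤ d := by exact_mod_cast hd
  have h1 : Tendsto (fun n : ℕ+ => b * (n : ℝ) ^ (-(d : ℝ) / 2)) atTop (𝓝 0) := by
    have := (tendsto_pnat_rpow_neg (e := (d : ℝ) / 2) (by positivity)).const_mul b
    simpa [neg_div] using this
  unfold momentError
  have h2 : Tendsto (fun n : ℕ+ => ∑ j ∈ Finset.Icc 2 m, (b * (n : ℝ) ^ (-(d : ℝ) / 2)) ^ (j - 1) *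
      (if j = 1 then c else A j * (L * (n : ℝ) ^ ((d : ℝ) / 8)) ^ j)) atTop
      (𝓝 (∑ j ∈ Finset.Icc 2 m, 0)) := by
    refine tendsto_finsetSum _ fun j hj => ?_
    have hj2 := (Finset.mem_Icc.1 hj).1
    have hj' : (2 : ℝ) ≤ j := by exact_mod_cast hj2
    -- The term of size `j` scales like `n` to the power `-(d / 2 * (j - 1) - d / 8 * j) = -d * (3 *
    -- j - 4) / 8`, negative for `j ≥ 2`. Any loss below `n ^ (d / 4)` per element would do in place
    -- of `n ^ (d / 8)`.
    have h3 := (tendsto_pnat_rpow_neg (e := (d : ℝ) / 2 * (j - 1) - d / 8 * j)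
      (by nlinarith)).const_mul (b ^ (j - 1) * (A j * L ^ j))
    rw [mul_zero] at h3
    refine h3.congr fun n => ?_
    have hn0 : (0 : ℝ) < n := by exact_mod_cast n.pos
    rw [if_neg (by omega), mul_pow, mul_pow, ← Real.rpow_natCast ((n : ℝ) ^ (-(d : ℝ) / 2)),
      ← Real.rpow_natCast ((n : ℝ) ^ ((d : ℝ) / 8)), ← Real.rpow_mul hn0.le, ← Real.rpow_mul hn0.le,
      show -((d : ℝ) / 2 * (j - 1) - d / 8 * j) = -(d : ℝ) / 2 * ((j - 1 : ℕ) : ℝ) + d / 8 * j by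
        rw [Nat.cast_sub (by omega)]; push_cast; ring, Real.rpow_add hn0]
    ring
  simpa using (h1.add (h1.mul_const c)).add h2

end FieldBounds

/-! ### The rescaled field as a linear statistic, and its moments -/

section FieldMoments

variable {d : ℕ} (Λ : Submodule ℤ (EuclideanSpace ℝ (Fin d))) (P₀ : Finset (Pattern d))
  (Ω D : Set (EuclideanSpace ℝ (Fin d))) (n : ℕ+) (φ : EuclideanSpace ℝ (Fin d) → ℝ)

/-- The macroscopic position of a pattern. -/
noncomputable def macroPos (q : P₀ × Λ) : EuclideanSpace ℝ (Fin d) :=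
  (n : ℝ)⁻¹ • (latticePattern Λ P₀ q).location

/-- The coefficients of the rescaled field. -/
noncomputable def fieldCoeff (q : P₀ × Λ) : ℝ := (n : ℝ) ^ (-(d : ℝ) / 2) * φ (macroPos Λ P₀ n q)

/-- The indices of the patterns that contribute to the field. -/
def activeSet : Set (P₀ × Λ) :=
  {q | (latticePattern Λ P₀ q).support ⊆ sites Ω D n ∧ φ (macroPos Λ P₀ n q) ≠ 0}

variable {Λ P₀ Ω D n φ}

lemma macroPos_eq (q : P₀ × Λ) : macroPos Λ P₀ n q =
    (n : ℝ)⁻¹ • ((q.1 : Pattern d).location + (q.2 : EuclideanSpace ℝ (Fin d))) := by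
  rw [macroPos, location_latticePattern]

/-- The index set may exceed the active set, so that several test functions can share one index set.
-/
lemma patternField_eq_sum (hP₀ : GeneratesDisjointPatterns Λ Ω P₀) {Q : Finset (P₀ × Λ)}
    (h1 : activeSet Λ P₀ Ω D n φ ⊆ Q)
    (h2 : ∀ q ∈ Q, (latticePattern Λ P₀ q).support ⊆ sites Ω D n) (T : Set (sites Ω D n)) :
    patternField Λ P₀ Ω D n φ T =
      ∑ q ∈ Q, φ (macroPos Λ P₀ n q) * patInd (sites Ω D n) (latticePattern Λ P₀) q T := by
  classical
  rw [patternField, finsum_mem_eq_sum_of_subset (t := Q.image (latticePattern Λ P₀)),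
    Finset.sum_image fun q _ r _ h => hP₀.injective h]
  · rfl
  · rintro p ⟨⟨hp1, hp2⟩, hp3⟩
    obtain ⟨q, rfl⟩ := mem_periodicPatterns.1 hp1
    refine Finset.mem_coe.2 (Finset.mem_image_of_mem _ (h1 ⟨hp2, fun h0 => hp3 ?_⟩))
    change φ (macroPos Λ P₀ n q) * _ = 0
    rw [h0, zero_mul]
  · intro p hp
    obtain ⟨q, hq, rfl⟩ := Finset.mem_image.1 (Finset.mem_coe.1 hp)
    exact ⟨mem_periodicPatterns.2 ⟨q, rfl⟩, h2 q hq⟩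

lemma rescaledField_eq_linStat {μ : Measure (Set (sites Ω D n))} [IsProbabilityMeasure μ]
    (hP₀ : GeneratesDisjointPatterns Λ Ω P₀) {Q : Finset (P₀ × Λ)}
    (h1 : activeSet Λ P₀ Ω D n φ ⊆ Q)
    (h2 : ∀ q ∈ Q, (latticePattern Λ P₀ q).support ⊆ sites Ω D n) (T : Set (sites Ω D n)) :
    rescaledField Λ P₀ Ω D n μ φ T =
      linStat μ (patInd (sites Ω D n) (latticePattern Λ P₀)) (fieldCoeff Λ P₀ n φ) Q T := by
  simp only [rescaledField, patternField_eq_sum hP₀ h1 h2]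
  rw [integral_finsetSum _ fun q _ => ((bddMeas_of_zero_or_one (measurable_patInd _ _ q)
    (patInd_zero_or_one _ _ q)).integrable (μ := μ)).const_mul _, ← Finset.sum_sub_distrib,
    Finset.mul_sum, linStat]
  refine Finset.sum_congr rfl fun q _ => ?_
  rw [integral_const_mul, fieldCoeff]
  ring

lemma bddMeas_linStat_patInd {S : Set (EuclideanSpace ℝ (Fin d))} {ι : Type*}
    (μ : Measure (Set S)) (pat : ι → Pattern d) (a : ι → ℝ) (Q : Finset ι) :
    BddMeas (linStat μ (patInd S pat) a Q) := by
  refine BddMeas.sum fun q _ => (BddMeas.const _).mul ((bddMeas_of_zero_or_one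
    (measurable_patInd _ _ q) (patInd_zero_or_one _ _ q)).sub (BddMeas.const _))

lemma exists_norm_index_le (hφ : HasCompactSupport φ) :
    ∃ R : ℝ, 0 ≤ R ∧ ∀ (n : ℕ+) (q : P₀ × Λ), φ (macroPos Λ P₀ n q) ≠ 0 →
      ‖(q.2 : EuclideanSpace ℝ (Fin d))‖ ≤ R * n := by
  obtain ⟨ρ, hρ0, hρ⟩ := exists_pattern_radius P₀
  obtain ⟨r, hr⟩ := hφ.isCompact.isBounded.exists_norm_le
  refine ⟨max r 0 + ρ, by positivity, fun n q hq => ?_⟩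
  have hn1 : (1 : ℝ) ≤ n := Nat.one_le_cast.2 n.pos
  have hn0 : (0 : ℝ) < n := by linarith
  have h1 := hr _ (subset_tsupport φ hq)
  rw [macroPos_eq, norm_smul, norm_inv, Real.norm_of_nonneg hn0.le, inv_mul_le_iff₀ hn0] at h1
  have h2 := norm_sub_le ((q.1 : Pattern d).location + (q.2 : EuclideanSpace ℝ (Fin d)))
    (q.1 : Pattern d).location
  rw [add_sub_cancel_left] at h2
  have h3 := (hρ q.1 q.1.2).1
  have h4 : (n : ℝ) * r ≤ n * max r 0 := by gcongr; exact le_max_left _ _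
  nlinarith

lemma finite_activeSet [DiscreteTopology Λ] [IsZLattice ℝ Λ] (hφ : HasCompactSupport φ) :
    (activeSet Λ P₀ Ω D n φ).Finite := by
  obtain ⟨R, -, hR⟩ := exists_norm_index_le (Λ := Λ) (P₀ := P₀) hφ
  refine (Set.finite_univ.prod (finite_lattice_norm_le Λ (R * n))).subset fun q hq => ?_
  exact ⟨Set.mem_univ _, hR n q hq.2⟩

/-- For large `n` the patterns seen by a test function lie in a fixed macroscopic compact set. -/
lemma exists_compact_eventually_support_subset (hΩ : IsPeriodicSet Λ Ω) (hD : IsOpen D)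
    (hP₀ : GeneratesDisjointPatterns Λ Ω P₀) {C : Set (EuclideanSpace ℝ (Fin d))} (hC : IsCompact C)
    (hCD : C ⊆ D) :
    ∃ C', IsCompact C' ∧ C' ⊆ D ∧ ∀ᶠ n : ℕ+ in atTop, ∀ q : P₀ × Λ, macroPos Λ P₀ n q ∈ C →
      (latticePattern Λ P₀ q).support ⊆ sites Ω C' n ∧
        (n : ℝ)⁻¹ • (q.2 : EuclideanSpace ℝ (Fin d)) ∈ C' := by
  obtain ⟨ρ, hρ0, hρ⟩ := exists_pattern_radius P₀
  obtain ⟨C', hC', hC'D, hev⟩ := exists_compact_eventually_mem hC hD hCD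
  refine ⟨C', hC', hC'D, ?_⟩
  filter_upwards [hev (2 * ρ)] with n hn q hq
  have hloc := (hρ q.1 q.1.2).1
  refine ⟨fun x hx => ⟨latticePattern_support_subset hΩ hP₀ q hx, hn _ _ hq ?_⟩, hn _ _ hq ?_⟩
  · obtain ⟨y, hy, rfl⟩ := Pattern.mem_support_translate.1 hx
    rw [location_latticePattern, add_sub_add_right_eq_sub]
    have := norm_sub_le y (q.1 : Pattern d).location
    have := (hρ q.1 q.1.2).2 y hy
    linarith
  · rw [location_latticePattern, sub_add_cancel_right, norm_neg]
    linarith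

variable [DiscreteTopology Λ] [IsZLattice ℝ Λ]
  {Kn : ℕ+ → EuclideanSpace ℝ (Fin d) → EuclideanSpace ℝ (Fin d) → ℝ}
  {μn : ∀ n : ℕ+, Measure (Set (sites Ω D n))} [∀ n, IsProbabilityMeasure (μn n)]

open Classical in
open ClusterDet in
/-- The truncated correlations of the patterns in a macroscopic compact set, with bounds that do
not depend on `n`. -/
lemma KernelsDecay.exists_isTruncated (hKn : ∀ n, IsDeterminantal (μn n) (Kn n))
    (hdecay : KernelsDecay Ω D Kn) (hP₀ : GeneratesDisjointPatterns Λ Ω P₀)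
    {C : Set (EuclideanSpace ℝ (Fin d))} (hC : IsCompact C) (hCD : C ⊆ D) :
    ∃ A : ℕ → ℝ, (∀ k, 0 ≤ A k) ∧ ∀ (n : ℕ+) (Q : Finset (P₀ × Λ)),
      (∀ q ∈ Q, (latticePattern Λ P₀ q).support ⊆ sites Ω C n) →
      ∃ u : P₀ × Λ → Finset (P₀ × Λ) → ℝ,
        IsTruncated (μn n) Q (patInd (sites Ω D n) (latticePattern Λ P₀)) u ∧
        (∀ q ∈ Q, ∀ B ⊆ Q, q ∉ B →
          |u q B| ≤ A B.card * treeWeight (latticeDecay Λ P₀) B.card {q} B) ∧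
        ∀ q ∈ Q, ∀ r ∈ Q, q ≠ r → |u q {r}| ≤ A 1 * latticeDecay Λ P₀ q r ^ 2 := by
  obtain ⟨M, hM⟩ := hdecay C hCD hC
  obtain ⟨m, hm, hle⟩ := exists_kernel_le_latticeDecay Λ P₀ M
  obtain ⟨N, hN⟩ := exists_card_sitesFinset_le Λ P₀
  refine ⟨truncConst N m, fun k => by unfold truncConst; positivity, fun n Q hQ => ?_⟩
  exact (hKn n).exists_isTruncated (fun q hq x hx => ⟨(hQ q hq hx).1, hCD (hQ q hq hx).2⟩)
    (fun q _ r _ hqr => hP₀.disjoint hqr) (fun q _ => hN q) latticeDecay_nonneg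
    latticeDecay_le_one latticeDecay_self latticeDecay_comm hm
    fun q hq r hr x hx y hy hxy => (hM n x (hQ q hq hx) y (hQ r hr hy) hxy).trans
      (hle q r x hx y hy hxy)

/-- The covariances of the patterns in a macroscopic compact set are bounded by the square of the
decay of the kernel. -/
lemma KernelsDecay.exists_abs_cov_le (hKn : ∀ n, IsDeterminantal (μn n) (Kn n))
    (hdecay : KernelsDecay Ω D Kn) (hP₀ : GeneratesDisjointPatterns Λ Ω P₀)
    {C : Set (EuclideanSpace ℝ (Fin d))} (hC : IsCompact C) (hCD : C ⊆ D) :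
    ∃ A : ℝ, 0 ≤ A ∧ ∀ (n : ℕ+) (q r : P₀ × Λ),
      (latticePattern Λ P₀ q).support ⊆ sites Ω C n →
      (latticePattern Λ P₀ r).support ⊆ sites Ω C n →
      |(latticePattern Λ P₀ q).cov (μn n) (latticePattern Λ P₀ r)| ≤
        A * latticeDecay Λ P₀ q r ^ 2 := by
  classical
  obtain ⟨A, hA0, hA⟩ := hdecay.exists_isTruncated hKn hP₀ hC hCD
  refine ⟨max (A 1) 1, by positivity, fun n q r hq hr => ?_⟩
  by_cases hqr : q = r
  · subst hqr
    rw [latticeDecay_self, one_pow, mul_one]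
    refine le_trans ?_ (le_max_right _ _)
    rw [Pattern.cov, Set.inter_self]
    have h0 := measureReal_nonneg (μ := μn n) (s := (latticePattern Λ P₀ q).occurs (sites Ω D n))
    have h1 : (μn n).real ((latticePattern Λ P₀ q).occurs (sites Ω D n)) ≤ 1 := measureReal_le_one
    rw [abs_le]
    constructor <;> nlinarith
  · obtain ⟨u, hu, -, hu2⟩ := hA n {q, r} (by
      intro x hx
      rw [Finset.mem_insert, Finset.mem_singleton] at hx
      rcases hx with rfl | rfl <;> assumption)
    have hqm : q ∈ ({q, r} : Finset (P₀ × Λ)) := by simp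
    have hrm : r ∈ ({q, r} : Finset (P₀ × Λ)) := by simp
    have h1 := hu.trunc_singleton hqm hrm hqr
    rw [← indCov_patInd, indCov, ← h1]
    exact (hu2 q hqm r hrm hqr).trans
      (mul_le_mul_of_nonneg_right (le_max_left _ _) (sq_nonneg _))

/-- The moments of the rescaled fields satisfy the Gaussian moment recursion asymptotically. -/
theorem KernelsDecay.exists_moment_recursion (hd : 1 ≤ d) (hΩ : IsPeriodicSet Λ Ω) (hD : IsOpen D)
    (hKn : ∀ n, IsDeterminantal (μn n) (Kn n)) (hdecay : KernelsDecay Ω D Kn)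
    (hP₀ : GeneratesDisjointPatterns Λ Ω P₀) (hφ : Continuous φ) (hφc : HasCompactSupport φ)
    (hφD : tsupport φ ⊆ D) {Q : ℕ+ → Finset (P₀ × Λ)}
    (hQ : ∀ n, ∀ q ∈ Q n, φ (macroPos Λ P₀ n q) ≠ 0) {m : ℕ} (hm : 1 ≤ m) :
    ∃ δ : ℕ+ → ℝ, Tendsto δ atTop (𝓝 0) ∧ ∀ᶠ n in atTop,
      |∫ η, linStat (μn n) (patInd (sites Ω D n) (latticePattern Λ P₀)) (fieldCoeff Λ P₀ n φ) (Q n) η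
          ^ (m + 1) ∂μn n -
        statVar (μn n) (patInd (sites Ω D n) (latticePattern Λ P₀)) (fieldCoeff Λ P₀ n φ) (Q n) *
          (m * ∫ η, linStat (μn n) (patInd (sites Ω D n) (latticePattern Λ P₀))
            (fieldCoeff Λ P₀ n φ) (Q n) η ^ (m - 1) ∂μn n)| ≤
      δ n * absMoment (μn n) (linStat (μn n) (patInd (sites Ω D n) (latticePattern Λ P₀))
        (fieldCoeff Λ P₀ n φ) (Q n)) (m - 1) := by
  classical
  have hd' : (1 : ℝ) ≤ d := by exact_mod_cast hd
  obtain ⟨C, hC, hCD, hsupp⟩ := exists_compact_eventually_support_subset hΩ hD hP₀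
    hφc.isCompact hφD
  obtain ⟨A, hA0, hA⟩ := hdecay.exists_isTruncated hKn hP₀ hC hCD
  obtain ⟨R, hR0, hR⟩ := exists_norm_index_le (Λ := Λ) (P₀ := P₀) hφc
  obtain ⟨N, hN0, hN⟩ := exists_card_index_le Λ P₀ R
  obtain ⟨G, hG0, hG⟩ := exists_sum_latticeDecay_sq_le Λ P₀ hd
  obtain ⟨L, hL0, hL⟩ := exists_sum_latticeDecay_le Λ P₀ hd hR0
  obtain ⟨b, hb⟩ := hφ.bounded_above_of_compact_support hφc
  have hb0 : 0 ≤ b := (norm_nonneg _).trans (hb 0)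
  set α : ℕ+ → ℝ := fun n => b * (n : ℝ) ^ (-(d : ℝ) / 2) with hα
  set U : ℕ+ → ℕ → ℝ := fun n k =>
    if k = 1 then A 1 * G else A k * (1 + k) ^ k * (L * (n : ℝ) ^ ((d : ℝ) / 8)) ^ k with hU
  have hα0 : Tendsto α atTop (𝓝 0) := by
    have := (tendsto_pnat_rpow_neg (e := (d : ℝ) / 2) (by positivity)).const_mul b
    simpa [neg_div, hα] using this
  have herr : Tendsto (fun n => momentError (α n) (U n) m) atTop (𝓝 0) :=
    tendsto_momentError_zero hd b (A 1 * G) L (fun k => A k * (1 + k) ^ k) m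
  refine ⟨fun n => 2 * momentConst m * m.factorial * ((Q n).card * α n ^ 2) *
    momentError (α n) (U n) m, ?_, ?_⟩
  · have hbd : ∀ n, |2 * momentConst m * m.factorial * ((Q n).card * α n ^ 2) *
        momentError (α n) (U n) m| ≤
        |2 * momentConst m * m.factorial| * (N * b ^ 2) * |momentError (α n) (U n) m| := by
      intro n
      have hn0 : (0 : ℝ) < n := by exact_mod_cast n.pos
      have hcard := hN n (Q n) fun q hq => hR n q (hQ n q hq)
      rw [abs_mul, abs_mul]
      refine mul_le_mul_of_nonneg_right (mul_le_mul_of_nonneg_left ?_ (abs_nonneg _)) (abs_nonneg _)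
      rw [abs_of_nonneg (by positivity)]
      have h1 : ((n : ℝ) ^ (-(d : ℝ) / 2)) ^ 2 = ((n : ℝ) ^ d)⁻¹ := by
        rw [← Real.rpow_natCast, ← Real.rpow_mul hn0.le, ← Real.rpow_natCast, ← Real.rpow_neg hn0.le]
        congr 1
        push_cast
        ring
      rw [hα, mul_pow, h1]
      calc ((Q n).card : ℝ) * (b ^ 2 * ((n : ℝ) ^ d)⁻¹)
          ≤ (N * (n : ℝ) ^ d) * (b ^ 2 * ((n : ℝ) ^ d)⁻¹) := by gcongr
        _ = N * b ^ 2 := by field_simp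
    refine squeeze_zero_norm hbd ?_
    simpa using herr.abs.const_mul (|2 * momentConst m * m.factorial| * (N * b ^ 2))
  · filter_upwards [hsupp, hα0.eventually (eventually_le_nhds one_pos)] with n hn hαn
    have hn0 : (0 : ℝ) < n := by exact_mod_cast n.pos
    obtain ⟨u, hu, hu1, hu2⟩ := hA n (Q n) fun q hq => (hn q (subset_tsupport φ (hQ n q hq))).1
    refine hu.abs_moment_sub_le ⟨by positivity, hαn, fun r _ => ?_, fun q hq k hk => ?_⟩ hm
    · rw [fieldCoeff, abs_mul, abs_of_nonneg (by positivity), mul_comm]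
      exact mul_le_mul_of_nonneg_right (hb _) (by positivity)
    · by_cases hk1 : k = 1
      · subst hk1
        simp only [hU, if_true]
        rw [Finset.powersetCard_one, Finset.sum_map]
        calc ∑ r ∈ (Q n).erase q, |u q {r}|
            ≤ ∑ r ∈ (Q n).erase q, A 1 * latticeDecay Λ P₀ q r ^ 2 :=
              Finset.sum_le_sum fun r hr => hu2 q hq r (Finset.mem_of_mem_erase hr)
                (Finset.ne_of_mem_erase hr).symm
          _ ≤ _ := by
              rw [← Finset.mul_sum]
              exact mul_le_mul_of_nonneg_left (hG q _) (hA0 1)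
      · simp only [hU, if_neg hk1]
        rw [mul_assoc]
        refine sum_powersetCard_abs_le latticeDecay_nonneg (hA0 k)
          (hL n (Q n) fun q hq => hR n q (hQ n q hq)) (fun q hq B hB hqB hBk => ?_) hq
        rw [← hBk]
        exact hu1 q hq B hB hqB

end FieldMoments

/-! ### The limit of the variance -/

section VarianceLimit

variable {d : ℕ} {Λ : Submodule ℤ (EuclideanSpace ℝ (Fin d))} {P₀ : Finset (Pattern d)}
  {Ω D : Set (EuclideanSpace ℝ (Fin d))} {φ : EuclideanSpace ℝ (Fin d) → ℝ}
  [DiscreteTopology Λ] [IsZLattice ℝ Λ]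
  {Kn : ℕ+ → EuclideanSpace ℝ (Fin d) → EuclideanSpace ℝ (Fin d) → ℝ}
  {μn : ∀ n : ℕ+, Measure (Set (sites Ω D n))} [∀ n, IsProbabilityMeasure (μn n)]
  {K : EuclideanSpace ℝ (Fin d) → EuclideanSpace ℝ (Fin d) → ℝ}
  {μ : Measure (Set Ω)} [IsProbabilityMeasure μ]

lemma latticeDecay_add_right (p p' : P₀) (l m : Λ) :
    latticeDecay Λ P₀ (p, l) (p', m + l) = latticeDecay Λ P₀ (p, 0) (p', m) := by
  simp only [latticeDecay]
  rw [show l - (m + l) = 0 - m by abel]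

lemma summable_latticeDecay_sq (hd : 1 ≤ d) (q : P₀ × Λ) :
    Summable fun r => latticeDecay Λ P₀ q r ^ 2 := by
  obtain ⟨G, -, hG⟩ := exists_sum_latticeDecay_sq_le Λ P₀ hd
  exact summable_of_sum_le (fun r => sq_nonneg _) (hG q)

lemma summable_latticeDecay_sq_pairs (hd : 1 ≤ d) :
    Summable fun j : P₀ × P₀ × Λ => latticeDecay Λ P₀ (j.1, 0) j.2 ^ 2 := by
  have h0 : 0 ≤ fun j : P₀ × P₀ × Λ => latticeDecay Λ P₀ (j.1, 0) j.2 ^ 2 := fun j => sq_nonneg _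
  have h1 : ∀ p : P₀, Summable fun r : P₀ × Λ => latticeDecay Λ P₀ (p, 0) r ^ 2 :=
    fun p => summable_latticeDecay_sq hd (p, 0)
  exact (summable_prod_of_nonneg h0).2 ⟨h1, Summable.of_finite⟩

/-- The covariances of the limiting process are bounded by the square of the decay of the kernel. -/
lemma KernelsConverge.exists_abs_cov_le (hΩ : IsPeriodicSet Λ Ω) (hD : IsOpen D)
    (hD0 : (0 : EuclideanSpace ℝ (Fin d)) ∈ D)
    (hKn : ∀ n, IsDeterminantal (μn n) (Kn n)) (hK : IsDeterminantal μ K)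
    (hconv : KernelsConverge Λ Ω D Kn K) (hdecay : KernelsDecay Ω D Kn)
    (hP₀ : GeneratesDisjointPatterns Λ Ω P₀) :
    ∃ A : ℝ, 0 ≤ A ∧ ∀ q r : P₀ × Λ,
      |(latticePattern Λ P₀ q).cov μ (latticePattern Λ P₀ r)| ≤ A * latticeDecay Λ P₀ q r ^ 2 := by
  have h0D : ({0} : Set (EuclideanSpace ℝ (Fin d))) ⊆ D := Set.singleton_subset_iff.2 hD0
  obtain ⟨C, hC, hCD, hev⟩ := exists_compact_eventually_mem isCompact_singleton hD h0D
  obtain ⟨A, hA0, hA⟩ := hdecay.exists_abs_cov_le hKn hP₀ hC hCD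
  have hsupp : ∀ q : P₀ × Λ, ∀ᶠ n : ℕ+ in atTop,
      (latticePattern Λ P₀ q).support ⊆ sites Ω C n := by
    intro q
    obtain ⟨R, hR⟩ := (latticePattern Λ P₀ q).finite_support.isBounded.exists_norm_le
    filter_upwards [hev R] with n hn x hx
    exact ⟨latticePattern_support_subset hΩ hP₀ q hx,
      hn 0 x (by simp) (by rw [sub_zero]; exact hR x hx)⟩
  -- Around the macroscopic point 0 a fixed pair of patterns lies in the compact set for large `n`,
  -- and convergence with `l = 0` transfers the uniform bound to the limit.
  refine ⟨A, hA0, fun q r => le_of_forall_pos_le_add fun ε hε => ?_⟩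
  obtain ⟨n, ⟨h1, h2⟩, h3⟩ := ((hsupp q).and (hsupp r)).and
    (hconv.eventually_abs_cov_sub_lt hΩ hD hKn hK hP₀ isCompact_singleton h0D q r hε) |>.exists
  have h4 := h3 0 (by simp)
  simp only [add_zero] at h4
  have h5 := hA n q r h1 h2
  have h6 := abs_sub_abs_le_abs_sub ((latticePattern Λ P₀ q).cov μ (latticePattern Λ P₀ r))
    ((latticePattern Λ P₀ q).cov (μn n) (latticePattern Λ P₀ r))
  rw [abs_sub_comm] at h6
  linarith

lemma eventually_abs_sub_le_of_norm_sub_le (hφ : Continuous φ) (hφc : HasCompactSupport φ) (R : ℝ)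
    {ε : ℝ} (hε : 0 < ε) :
    ∀ᶠ n : ℕ+ in atTop, ∀ x y : EuclideanSpace ℝ (Fin d), ‖y - x‖ ≤ R →
      |φ ((n : ℝ)⁻¹ • y) - φ ((n : ℝ)⁻¹ • x)| ≤ ε := by
  have huc : UniformContinuous φ :=
    hφ.uniformContinuous_of_tendsto_cocompact hφc.is_zero_at_infty
  obtain ⟨δ, hδ, hu⟩ := Metric.uniformContinuous_iff.1 huc ε hε
  filter_upwards [tendsto_pnat_cast_atTop.eventually_gt_atTop (R / δ)] with n hn x y hxy
  have hn0 : (0 : ℝ) < n := by exact_mod_cast n.pos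
  rw [← Real.dist_eq]
  refine (hu ?_).le
  rw [dist_eq_norm, ← smul_sub, norm_smul, norm_inv, Real.norm_of_nonneg hn0.le,
    inv_mul_lt_iff₀ hn0]
  rw [div_lt_iff₀ hδ] at hn
  exact hxy.trans_lt hn

/-- Pairs of patterns of the periodic collection, indexed by their relative position and the
translation of the first one. -/
def patternPairEquiv (P₀ : Finset (Pattern d)) (Λ : Submodule ℤ (EuclideanSpace ℝ (Fin d))) :
    (P₀ × P₀ × Λ) × Λ ≃ (P₀ × Λ) × P₀ × Λ where
  toFun y := ((y.1.1, y.2), (y.1.2.1, y.1.2.2 + y.2))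
  invFun x := ((x.1.1, (x.2.1, x.2.2 - x.1.2)), x.1.2)
  left_inv y := by simp
  right_inv x := by simp

/-- The contribution to the variance of the pairs of patterns with a given relative position. -/
lemma tendsto_sum_pairs (hΩ : IsPeriodicSet Λ Ω) (hD : IsOpen D)
    (hKn : ∀ n, IsDeterminantal (μn n) (Kn n)) (hK : IsDeterminantal μ K)
    (hconv : KernelsConverge Λ Ω D Kn K) (hP₀ : GeneratesDisjointPatterns Λ Ω P₀)
    (hφ : Continuous φ) (hφc : HasCompactSupport φ) (hφD : tsupport φ ⊆ D) (j : P₀ × P₀ × Λ) :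
    Tendsto (fun n : ℕ+ => ((n : ℝ) ^ d)⁻¹ * ∑' l : Λ,
      φ (macroPos Λ P₀ n (j.1, l)) * φ (macroPos Λ P₀ n (j.2.1, j.2.2 + l)) *
        (latticePattern Λ P₀ (j.1, l)).cov (μn n) (latticePattern Λ P₀ (j.2.1, j.2.2 + l))) atTop
      (𝓝 ((latticePattern Λ P₀ (j.1, 0)).cov μ (latticePattern Λ P₀ j.2) * (∫ x, φ x ^ 2) /
        ZLattice.covolume Λ)) := by
  obtain ⟨p, p', m⟩ := j
  set c := (latticePattern Λ P₀ (p, 0)).cov μ (latticePattern Λ P₀ (p', m)) with hc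
  obtain ⟨C, hC, hCD, hsupp⟩ := exists_compact_eventually_support_subset hΩ hD hP₀
    hφc.isCompact hφD
  obtain ⟨R, hR0, hR⟩ := exists_norm_index_le (Λ := Λ) (P₀ := P₀) hφc
  obtain ⟨b, hb⟩ := hφ.bounded_above_of_compact_support hφc
  have hb0 : 0 ≤ b := (norm_nonneg _).trans (hb 0)
  rw [← integral_const_mul]
  refine tendsto_lattice_riemannSum Λ (f := fun x => c * φ x ^ 2) (R := R) (by fun_prop) ?_ ?_ ?_
  · exact (hφc.comp_left (g := fun t : ℝ => c * t ^ 2) (by simp))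
  · intro n l hl
    have : φ (macroPos Λ P₀ n (p, l)) = 0 := by
      by_contra h0
      exact absurd (hR n (p, l) h0) (not_le.2 hl)
    simp [this]
  · intro ε hε
    -- In the denominator, `b ^ 2` accounts for replacing the covariance by its limit and `|c| * (2
    -- * b)` for moving both values of `φ` to the point `l / n`.
    set η := ε / (b ^ 2 + |c| * (2 * b) + 1) with hη
    have hden : 0 < b ^ 2 + |c| * (2 * b) + 1 := by positivity
    have hη0 : 0 < η := by positivity
    filter_upwards [hsupp, hconv.eventually_abs_cov_sub_lt hΩ hD hKn hK hP₀ hC hCD (p, 0) (p', m) hη0,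
      eventually_abs_sub_le_of_norm_sub_le hφ hφc ‖(p : Pattern d).location‖ hη0,
      eventually_abs_sub_le_of_norm_sub_le hφ hφc
        ‖(p' : Pattern d).location + (m : EuclideanSpace ℝ (Fin d))‖ hη0] with n h1 h2 h3 h4 l
    set z := φ ((n : ℝ)⁻¹ • (l : EuclideanSpace ℝ (Fin d))) with hz
    have hx : |φ (macroPos Λ P₀ n (p, l)) - z| ≤ η := by
      rw [macroPos_eq]
      exact h3 _ _ (by rw [add_sub_cancel_right])
    have hy : |φ (macroPos Λ P₀ n (p', m + l)) - z| ≤ η := by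
      rw [macroPos_eq]
      refine h4 _ _ (le_of_eq ?_)
      simp only [Submodule.coe_add]
      rw [← add_assoc, add_sub_cancel_right]
    have hxb := hb (macroPos Λ P₀ n (p, l))
    have hyb := hb (macroPos Λ P₀ n (p', m + l))
    have hzb := hb ((n : ℝ)⁻¹ • (l : EuclideanSpace ℝ (Fin d)))
    rw [← hz] at hzb
    rw [Real.norm_eq_abs] at hxb hyb hzb
    simp only [zero_add] at h2
    -- The covariances converge uniformly only for `l / n` in the compact set `C`, which is
    -- guaranteed when this value of `φ` is nonzero; otherwise the product vanishes.
    have hcov : φ (macroPos Λ P₀ n (p, l)) ≠ 0 →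
        |(latticePattern Λ P₀ (p, l)).cov (μn n) (latticePattern Λ P₀ (p', m + l)) - c| ≤ η :=
      fun h0 => (h2 l (h1 (p, l) (subset_tsupport φ h0)).2).le
    generalize φ (macroPos Λ P₀ n (p, l)) = x at *
    generalize φ (macroPos Λ P₀ n (p', m + l)) = y at *
    generalize (latticePattern Λ P₀ (p, l)).cov (μn n) (latticePattern Λ P₀ (p', m + l)) = c' at *
    have e1 : |x * y * (c' - c)| ≤ b ^ 2 * η := by
      by_cases h0 : x = 0
      · rw [h0, zero_mul, zero_mul, abs_zero]; positivity
      · rw [abs_mul, abs_mul, sq]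
        exact mul_le_mul (mul_le_mul hxb hyb (abs_nonneg _) hb0) (hcov h0) (abs_nonneg _)
          (by positivity)
    have e2 : |c * ((x - z) * y + z * (y - z))| ≤ |c| * (2 * b) * η := by
      rw [abs_mul, mul_assoc]
      refine mul_le_mul_of_nonneg_left ((abs_add_le _ _).trans ?_) (abs_nonneg _)
      rw [abs_mul, abs_mul]
      have := mul_le_mul hx hyb (abs_nonneg _) hη0.le
      have := mul_le_mul hzb hy (abs_nonneg _) hb0
      linarith
    calc |x * y * c' - c * z ^ 2| = |x * y * (c' - c) + c * ((x - z) * y + z * (y - z))| := by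
          congr 1; ring
      _ ≤ b ^ 2 * η + |c| * (2 * b) * η := (abs_add_le _ _).trans (add_le_add e1 e2)
      _ ≤ (b ^ 2 + |c| * (2 * b) + 1) * η := by nlinarith
      _ = ε := by rw [hη]; field_simp

/-- The asymptotics of the variance of the rescaled field, as a sum over relative positions. -/
theorem tendsto_statVar (hd : 1 ≤ d) (hΩ : IsPeriodicSet Λ Ω) (hD : IsOpen D)
    (hKn : ∀ n, IsDeterminantal (μn n) (Kn n)) (hK : IsDeterminantal μ K)
    (hconv : KernelsConverge Λ Ω D Kn K) (hdecay : KernelsDecay Ω D Kn)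
    (hP₀ : GeneratesDisjointPatterns Λ Ω P₀)
    (hφ : Continuous φ) (hφc : HasCompactSupport φ) (hφD : tsupport φ ⊆ D)
    {Q : ℕ+ → Finset (P₀ × Λ)} (hQ : ∀ n, (Q n : Set (P₀ × Λ)) = activeSet Λ P₀ Ω D n φ) :
    Tendsto (fun n => statVar (μn n) (patInd (sites Ω D n) (latticePattern Λ P₀))
      (fieldCoeff Λ P₀ n φ) (Q n)) atTop
      (𝓝 (∑' j : P₀ × P₀ × Λ, (latticePattern Λ P₀ (j.1, 0)).cov μ (latticePattern Λ P₀ j.2) *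
        (∫ x, φ x ^ 2) / ZLattice.covolume Λ)) := by
  classical
  obtain ⟨C, hC, hCD, hsupp⟩ := exists_compact_eventually_support_subset hΩ hD hP₀
    hφc.isCompact hφD
  obtain ⟨A, hA0, hA⟩ := hdecay.exists_abs_cov_le hKn hP₀ hC hCD
  obtain ⟨R, hR0, hR⟩ := exists_norm_index_le (Λ := Λ) (P₀ := P₀) hφc
  obtain ⟨N, hN0, hN⟩ := exists_card_lattice_ball_le Λ R
  obtain ⟨b, hb⟩ := hφ.bounded_above_of_compact_support hφc
  have hb0 : 0 ≤ b := (norm_nonneg _).trans (hb 0)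
  set H : ℕ+ → (P₀ × P₀ × Λ) → Λ → ℝ := fun n j l =>
    φ (macroPos Λ P₀ n (j.1, l)) * φ (macroPos Λ P₀ n (j.2.1, j.2.2 + l)) *
      (latticePattern Λ P₀ (j.1, l)).cov (μn n) (latticePattern Λ P₀ (j.2.1, j.2.2 + l)) with hH
  have hsum : Summable fun j : P₀ × P₀ × Λ =>
      N * (b ^ 2 * (A * latticeDecay Λ P₀ (j.1, 0) j.2 ^ 2)) := by
    have h := summable_latticeDecay_sq_pairs (Λ := Λ) (P₀ := P₀) hd
    exact ((h.mul_left A).mul_left (b ^ 2)).mul_left N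
  -- Dominated convergence over relative positions `j`: the sum over translations has at most `N * n
  -- ^ d` nonzero terms, each bounded by `b ^ 2 * A` times the squared decay at `j`.
  refine (tendsto_tsum_of_dominated_convergence hsum
    (tendsto_sum_pairs hΩ hD hKn hK hconv hP₀ hφ hφc hφD) ?_).congr' ?_
  · filter_upwards [hsupp] with n hn j
    have hn0 : (0 : ℝ) < n := by exact_mod_cast n.pos
    set T : Finset Λ := (finite_lattice_norm_le Λ (R * n)).toFinset with hT
    have hTm : ∀ l ∉ T, H n j l = 0 := by
      intro l hl
      have : φ (macroPos Λ P₀ n (j.1, l)) = 0 := by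
        by_contra h0
        exact hl ((Set.Finite.mem_toFinset _).2 (hR n (j.1, l) h0))
      simp [hH, this]
    have hHb : ∀ l, ‖H n j l‖ ≤ b ^ 2 * (A * latticeDecay Λ P₀ (j.1, 0) j.2 ^ 2) := by
      intro l
      by_cases h1 : φ (macroPos Λ P₀ n (j.1, l)) = 0
      · simp only [hH, h1, zero_mul, norm_zero]; positivity
      by_cases h2 : φ (macroPos Λ P₀ n (j.2.1, j.2.2 + l)) = 0
      · simp only [hH, h2, mul_zero, zero_mul, norm_zero]; positivity
      have h3 := hA n (j.1, l) (j.2.1, j.2.2 + l) (hn _ (subset_tsupport φ h1)).1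
        (hn _ (subset_tsupport φ h2)).1
      rw [latticeDecay_add_right] at h3
      simp only [hH]
      rw [norm_mul, norm_mul, sq]
      exact mul_le_mul (mul_le_mul (hb _) (hb _) (norm_nonneg _) hb0) h3 (norm_nonneg _)
        (by positivity)
    change ‖((n : ℝ) ^ d)⁻¹ * ∑' l : Λ, H n j l‖ ≤ _
    rw [tsum_eq_sum hTm, norm_mul, norm_inv, norm_pow, Real.norm_of_nonneg hn0.le,
      inv_mul_le_iff₀ (by positivity)]
    have hcard := hN n T fun l hl => by
      rw [hT, Set.Finite.mem_toFinset] at hl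
      exact hl
    calc ‖∑ l ∈ T, H n j l‖ ≤ ∑ l ∈ T, ‖H n j l‖ := norm_sum_le _ _
      _ ≤ T.card • (b ^ 2 * (A * latticeDecay Λ P₀ (j.1, 0) j.2 ^ 2)) :=
          Finset.sum_le_card_nsmul _ _ _ fun l _ => hHb l
      _ ≤ (N * (n : ℝ) ^ d) * (b ^ 2 * (A * latticeDecay Λ P₀ (j.1, 0) j.2 ^ 2)) := by
          rw [nsmul_eq_mul]
          gcongr
      _ = _ := by ring
  · filter_upwards [hsupp] with n hn
    have hn0 : (0 : ℝ) < n := by exact_mod_cast n.pos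
    -- For large `n` every pattern whose position is seen by `φ` lies in `Ω ∩ nD`. The double sum
    -- over all indices is then the one over `Q n`, and can be rearranged by relative position.
    have hmem : ∀ q, φ (macroPos Λ P₀ n q) ≠ 0 → q ∈ Q n := by
      intro q hq
      rw [← Finset.mem_coe, hQ]
      exact ⟨fun x hx => ⟨((hn q (subset_tsupport φ hq)).1 hx).1,
        hCD ((hn q (subset_tsupport φ hq)).1 hx).2⟩, hq⟩
    set h : (P₀ × Λ) × (P₀ × Λ) → ℝ := fun x => φ (macroPos Λ P₀ n x.1) *
      φ (macroPos Λ P₀ n x.2) * (latticePattern Λ P₀ x.1).cov (μn n) (latticePattern Λ P₀ x.2)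
      with hh
    have hzero : ∀ x ∉ Q n ×ˢ Q n, h x = 0 := by
      intro x hx
      by_contra h0
      simp only [hh, mul_eq_zero, not_or] at h0
      exact hx (Finset.mem_product.2 ⟨hmem _ h0.1.1, hmem _ h0.1.2⟩)
    have hsm : Summable h := summable_of_ne_finset_zero hzero
    have hsm' : Summable fun y => h (patternPairEquiv P₀ Λ y) :=
      (patternPairEquiv P₀ Λ).summable_iff.2 hsm
    have h1 : ((n : ℝ) ^ (-(d : ℝ) / 2)) ^ 2 = ((n : ℝ) ^ d)⁻¹ := by
      rw [← Real.rpow_natCast, ← Real.rpow_mul hn0.le, ← Real.rpow_natCast, ← Real.rpow_neg hn0.le]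
      congr 1
      push_cast
      ring
    calc ∑' j, ((n : ℝ) ^ d)⁻¹ * ∑' l : Λ, H n j l
        = ((n : ℝ) ^ d)⁻¹ * ∑' y, h (patternPairEquiv P₀ Λ y) := by
          rw [tsum_mul_left, hsm'.tsum_prod]
          rfl
      _ = ((n : ℝ) ^ d)⁻¹ * ∑ x ∈ Q n ×ˢ Q n, h x := by
          rw [(patternPairEquiv P₀ Λ).tsum_eq h, tsum_eq_sum hzero]
      _ = _ := by
          rw [statVar, Finset.sum_product, Finset.mul_sum]
          refine Finset.sum_congr rfl fun q _ => ?_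
          rw [Finset.mul_sum]
          refine Finset.sum_congr rfl fun r _ => ?_
          rw [indCov_patInd, fieldCoeff, fieldCoeff, ← h1]
          ring

end VarianceLimit

/-! ### Characteristic functions and convergence to white noise -/

section WhiteNoise

variable {d : ℕ} {Λ : Submodule ℤ (EuclideanSpace ℝ (Fin d))} {P₀ : Finset (Pattern d)}
  {Ω D : Set (EuclideanSpace ℝ (Fin d))} {φ : EuclideanSpace ℝ (Fin d) → ℝ}
  [DiscreteTopology Λ] [IsZLattice ℝ Λ]
  {Kn : ℕ+ → EuclideanSpace ℝ (Fin d) → EuclideanSpace ℝ (Fin d) → ℝ}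
  {μn : ∀ n : ℕ+, Measure (Set (sites Ω D n))} [∀ n, IsProbabilityMeasure (μn n)]
  {K : EuclideanSpace ℝ (Fin d) → EuclideanSpace ℝ (Fin d) → ℝ}
  {μ : Measure (Set Ω)} [IsProbabilityMeasure μ]

lemma IsTestFunction.sum {k : ℕ} {φ : Fin k → EuclideanSpace ℝ (Fin d) → ℝ}
    (hφ : ∀ i, IsTestFunction D (φ i)) (t : Fin k → ℝ) :
    IsTestFunction D fun z => ∑ i, t i * φ i z := by
  have hsub : tsupport (fun z => ∑ i, t i * φ i z) ⊆ ⋃ i, tsupport (φ i) := by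
    refine closure_minimal (fun z hz => ?_) (isClosed_iUnion_of_finite fun i => isClosed_tsupport _)
    obtain ⟨i, -, hi⟩ := Finset.exists_ne_zero_of_sum_ne_zero hz
    exact Set.mem_iUnion.2 ⟨i, subset_tsupport _ (right_ne_zero_of_mul hi)⟩
  refine ⟨ContDiff.sum fun i _ => contDiff_const.mul (hφ i).1,
    (isCompact_iUnion fun i => (hφ i).2.1.isCompact).of_isClosed_subset (isClosed_tsupport _) hsub,
    hsub.trans (Set.iUnion_subset fun i => (hφ i).2.2)⟩

lemma bddMeas_rescaledField (hP₀ : GeneratesDisjointPatterns Λ Ω P₀) (hφ : HasCompactSupport φ)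
    (n : ℕ+) : BddMeas (rescaledField Λ P₀ Ω D n (μn n) φ) := by
  have hfin := finite_activeSet (Λ := Λ) (P₀ := P₀) (Ω := Ω) (D := D) (n := n) hφ
  have : rescaledField Λ P₀ Ω D n (μn n) φ = linStat (μn n)
      (patInd (sites Ω D n) (latticePattern Λ P₀)) (fieldCoeff Λ P₀ n φ) hfin.toFinset :=
    funext fun T => rescaledField_eq_linStat hP₀ (by simp)
      (fun q hq => ((Set.Finite.mem_toFinset _).1 hq).1) T
  rw [this]
  exact bddMeas_linStat_patInd _ _ _ _

/-- All the fields are written over the union of the active sets, where linearity holds coefficient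
by coefficient. -/
lemma rescaledField_sum (hP₀ : GeneratesDisjointPatterns Λ Ω P₀) {k : ℕ}
    {φ : Fin k → EuclideanSpace ℝ (Fin d) → ℝ} (hφ : ∀ i, HasCompactSupport (φ i))
    (t : Fin k → ℝ) (n : ℕ+) (T : Set (sites Ω D n)) :
    rescaledField Λ P₀ Ω D n (μn n) (fun z => ∑ i, t i * φ i z) T =
      ∑ i, t i * rescaledField Λ P₀ Ω D n (μn n) (φ i) T := by
  classical
  have hfin : (⋃ i, activeSet Λ P₀ Ω D n (φ i)).Finite :=
    Set.finite_iUnion fun i => finite_activeSet (hφ i)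
  have h2 : ∀ q ∈ hfin.toFinset, (latticePattern Λ P₀ q).support ⊆ sites Ω D n := by
    intro q hq
    obtain ⟨i, hi⟩ := Set.mem_iUnion.1 ((Set.Finite.mem_toFinset _).1 hq)
    exact hi.1
  have h3 : ∀ i, rescaledField Λ P₀ Ω D n (μn n) (φ i) T = _ := fun i =>
    rescaledField_eq_linStat hP₀ (Q := hfin.toFinset)
      (by rw [Set.Finite.coe_toFinset]; exact Set.subset_iUnion (fun i => activeSet Λ P₀ Ω D n (φ i)) i) h2 T
  rw [rescaledField_eq_linStat hP₀ (Q := hfin.toFinset) ?_ h2 T]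
  · simp only [h3, linStat, Finset.mul_sum]
    rw [Finset.sum_comm]
    refine Finset.sum_congr rfl fun q _ => ?_
    simp only [fieldCoeff, Finset.mul_sum, Finset.sum_mul]
    exact Finset.sum_congr rfl fun i _ => by ring
  · rw [Set.Finite.coe_toFinset]
    rintro q ⟨hq1, hq2⟩
    obtain ⟨i, -, hi⟩ := Finset.exists_ne_zero_of_sum_ne_zero hq2
    exact Set.mem_iUnion.2 ⟨i, hq1, right_ne_zero_of_mul hi⟩

lemma KernelsConverge.summable_cov (hd : 1 ≤ d) (hΩ : IsPeriodicSet Λ Ω) (hD : IsOpen D)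
    (hD0 : (0 : EuclideanSpace ℝ (Fin d)) ∈ D)
    (hKn : ∀ n, IsDeterminantal (μn n) (Kn n)) (hK : IsDeterminantal μ K)
    (hconv : KernelsConverge Λ Ω D Kn K) (hdecay : KernelsDecay Ω D Kn)
    (hP₀ : GeneratesDisjointPatterns Λ Ω P₀) :
    Summable fun j : P₀ × P₀ × Λ =>
      (latticePattern Λ P₀ (j.1, 0)).cov μ (latticePattern Λ P₀ j.2) := by
  obtain ⟨A, -, hA⟩ := hconv.exists_abs_cov_le hΩ hD hD0 hKn hK hdecay hP₀
  exact Summable.of_norm_bounded ((summable_latticeDecay_sq_pairs hd).mul_left A)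
    fun j => hA (j.1, 0) j.2

lemma latticePattern_zero (p : P₀) : latticePattern Λ P₀ (p, 0) = p := by
  rw [latticePattern, Submodule.coe_zero, Pattern.translate_zero]

/-- The second index `(p', l)` runs through the whole periodic collection, and `P₀.card` cancels the
normalisation of `patternIntensity`. For empty `P₀` both sides are 0. -/
lemma tsum_cov_eq_patternIntensity (hP₀ : GeneratesDisjointPatterns Λ Ω P₀)
    (hs : Summable fun j : P₀ × P₀ × Λ =>
      (latticePattern Λ P₀ (j.1, 0)).cov μ (latticePattern Λ P₀ j.2)) (x y : ℝ) :
    ∑' j : P₀ × P₀ × Λ, (latticePattern Λ P₀ (j.1, 0)).cov μ (latticePattern Λ P₀ j.2) * x / y =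
      P₀.card / y * patternIntensity Λ P₀ μ * x := by
  rw [tsum_div_const, tsum_mul_right, hs.tsum_prod, tsum_fintype]
  have h1 : ∀ p : P₀, ∑' q : P₀ × Λ, (latticePattern Λ P₀ (p, 0)).cov μ (latticePattern Λ P₀ q) =
      ∑' q : periodicPatterns Λ P₀, (p : Pattern d).cov μ q := by
    intro p
    rw [← (patternEquiv hP₀).tsum_eq, latticePattern_zero]
    rfl
  simp only [h1]
  rw [Finset.sum_coe_sort P₀ fun p => ∑' q : periodicPatterns Λ P₀, p.cov μ q, patternIntensity]
  rcases P₀.eq_empty_or_nonempty with rfl | hne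
  · simp
  · have : (P₀.card : ℝ) ≠ 0 := by exact_mod_cast hne.card_pos.ne'
    field_simp

/-- The characteristic function of the rescaled field, and the positivity of its limiting
variance. -/
theorem tendsto_integral_exp_rescaledField (hd : 1 ≤ d) (hΩ : IsPeriodicSet Λ Ω) (hD : IsOpen D)
    (hD0 : (0 : EuclideanSpace ℝ (Fin d)) ∈ D)
    (hKn : ∀ n, IsDeterminantal (μn n) (Kn n)) (hK : IsDeterminantal μ K)
    (hconv : KernelsConverge Λ Ω D Kn K) (hdecay : KernelsDecay Ω D Kn)
    (hP₀ : GeneratesDisjointPatterns Λ Ω P₀)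
    (hφ : Continuous φ) (hφc : HasCompactSupport φ) (hφD : tsupport φ ⊆ D) :
    0 ≤ P₀.card / ZLattice.covolume Λ * patternIntensity Λ P₀ μ * ∫ x, φ x ^ 2 ∧
    Tendsto (fun n => ∫ T, Complex.exp (Complex.I * (rescaledField Λ P₀ Ω D n (μn n) φ T : ℂ)) ∂μn n)
      atTop (𝓝 (Complex.exp ((-(P₀.card / ZLattice.covolume Λ * patternIntensity Λ P₀ μ *
        ∫ x, φ x ^ 2) / 2 : ℝ) : ℂ))) := by
  have hfin := fun n => finite_activeSet (Λ := Λ) (P₀ := P₀) (Ω := Ω) (D := D) (n := n) hφc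
  set Q : ℕ+ → Finset (P₀ × Λ) := fun n => (hfin n).toFinset with hQ
  have hQm : ∀ n q, q ∈ Q n ↔ q ∈ activeSet Λ P₀ Ω D n φ := fun n q => Set.Finite.mem_toFinset _
  have hQc : ∀ n, (Q n : Set (P₀ × Λ)) = activeSet Λ P₀ Ω D n φ := fun n =>
    Set.Finite.coe_toFinset _
  have hfield : ∀ n T, rescaledField Λ P₀ Ω D n (μn n) φ T = linStat (μn n)
      (patInd (sites Ω D n) (latticePattern Λ P₀)) (fieldCoeff Λ P₀ n φ) (Q n) T := fun n T =>
    rescaledField_eq_linStat hP₀ (hQc n).ge (fun q hq => ((hQm n q).1 hq).1) T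
  have hvar := tendsto_statVar hd hΩ hD hKn hK hconv hdecay hP₀ hφ hφc hφD hQc
  rw [tsum_cov_eq_patternIntensity hP₀
    (hconv.summable_cov hd hΩ hD hD0 hKn hK hdecay hP₀)] at hvar
  have hrec := fun (m : ℕ) (hm : 1 ≤ m) => hdecay.exists_moment_recursion hd hΩ hD hKn hP₀ hφ hφc
    hφD (Q := Q) (fun n q hq => ((hQm n q).1 hq).2) hm
  refine ⟨?_, ?_⟩
  -- For `m = 1` the recursion says that the variance sum differs from the second moment by at most
  -- `δ n`, so its limit is a limit of nonnegative numbers.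
  · obtain ⟨δ, hδ, hev⟩ := hrec 1 le_rfl
    have hlim := hvar.add hδ
    rw [add_zero] at hlim
    refine ge_of_tendsto hlim ?_
    filter_upwards [hev] with n hn
    have h0 : 0 ≤ ∫ η, linStat (μn n) (patInd (sites Ω D n) (latticePattern Λ P₀))
        (fieldCoeff Λ P₀ n φ) (Q n) η ^ (1 + 1) ∂μn n :=
      integral_nonneg fun η => by
        change (0 : ℝ) ≤ _ ^ 2
        exact sq_nonneg _
    simp only [absMoment, Nat.sub_self, pow_zero, integral_const, probReal_univ, smul_eq_mul,
      mul_one, Nat.cast_one] at hn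
    have := (abs_le.1 hn).2
    linarith
  · simp only [hfield]
    refine tendsto_integral_exp_of_moment_recursion (fun n => bddMeas_linStat_patInd _ _ _ _)
      (fun n => ?_) hvar hrec
    have hint : ∀ q, Integrable (fun T => patInd (sites Ω D n) (latticePattern Λ P₀) q T)
        (μn n) := fun q =>
      (bddMeas_of_zero_or_one (measurable_patInd _ _ q) (patInd_zero_or_one _ _ q)).integrable
    simp only [linStat]
    rw [integral_finsetSum _ fun q _ => (Integrable.sub' (hint q) (integrable_const _)).const_mul _]
    refine Finset.sum_eq_zero fun q _ => ?_
    rw [integral_const_mul, integral_sub (hint q) (integrable_const _)]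
    simp

/-- The limiting variance is tested with a bump function at 0, supported in `D`: the density of
patterns and the integral of the square are positive, so the sign is that of the intensity. -/
lemma patternIntensity_nonneg (hd : 1 ≤ d) (hΩ : IsPeriodicSet Λ Ω) (hD : IsOpen D)
    (hD0 : (0 : EuclideanSpace ℝ (Fin d)) ∈ D)
    (hKn : ∀ n, IsDeterminantal (μn n) (Kn n)) (hK : IsDeterminantal μ K)
    (hconv : KernelsConverge Λ Ω D Kn K) (hdecay : KernelsDecay Ω D Kn)
    (hP₀ : GeneratesDisjointPatterns Λ Ω P₀) : 0 ≤ patternIntensity Λ P₀ μ := by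
  rcases P₀.eq_empty_or_nonempty with rfl | hne
  · simp [patternIntensity]
  obtain ⟨r, hr, hrD⟩ := Metric.nhds_basis_closedBall.mem_iff.1 (hD.mem_nhds hD0)
  let f : ContDiffBump (0 : EuclideanSpace ℝ (Fin d)) := ⟨r / 2, r, by positivity, by linarith⟩
  have hpos : 0 < ∫ x, f x ^ 2 := by
    refine Continuous.integral_pos_of_hasCompactSupport_nonneg_nonzero (x := 0)
      (f.continuous.pow 2) ?_ (fun x => sq_nonneg _) ?_
    · exact f.hasCompactSupport.comp_left (g := fun t : ℝ => t ^ 2) (by simp)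
    · have : f 0 = 1 := f.one_of_mem_closedBall (by simp [f]; positivity)
      simp [this]
  have h := (tendsto_integral_exp_rescaledField hd hΩ hD hD0 hKn hK hconv hdecay hP₀ f.continuous
    f.hasCompactSupport (by rw [f.tsupport_eq]; exact hrD)).1
  have hc : 0 < (P₀.card : ℝ) / ZLattice.covolume Λ :=
    div_pos (by exact_mod_cast hne.card_pos) (ZLattice.covolume_pos Λ volume)
  exact (mul_nonneg_iff_of_pos_left hc).1 ((mul_nonneg_iff_of_pos_right hpos).1 h)

lemma setIntegral_mul_testFunctions {φ ψ : EuclideanSpace ℝ (Fin d) → ℝ}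
    (hφ : tsupport φ ⊆ D) : ∫ z in D, φ z * ψ z = ∫ z, φ z * ψ z := by
  refine setIntegral_eq_integral_of_forall_compl_eq_zero fun z hz => ?_
  rw [image_eq_zero_of_notMem_tsupport fun h => hz (hφ h), zero_mul]

/-- The quadratic form of the limiting covariance is the limiting variance of the field at `∑ x i *
φ i`. This gives both positive semidefiniteness and the match of the characteristic functions. -/
lemma dotProduct_gram_mulVec {k : ℕ} {φ : Fin k → EuclideanSpace ℝ (Fin d) → ℝ}
    (hφ : ∀ i, IsTestFunction D (φ i)) (σ : ℝ) (x : Fin k → ℝ) :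
    x ⬝ᵥ (Matrix.of fun i j => σ * ∫ z in D, φ i z * φ j z).mulVec x =
      σ * ∫ z, (∑ i, x i * φ i z) ^ 2 := by
  have hint : ∀ i j, Integrable fun z => φ i z * φ j z := fun i j =>
    ((hφ i).1.continuous.mul (hφ j).1.continuous).integrable_of_hasCompactSupport
      (hφ i).2.1.mul_right
  have h1 : ∀ z, (∑ i, x i * φ i z) ^ 2 = ∑ i, ∑ j, x i * x j * (φ i z * φ j z) := fun z => by
    rw [sq, Finset.sum_mul_sum]
    exact Finset.sum_congr rfl fun i _ => Finset.sum_congr rfl fun j _ => by ring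
  simp only [h1]
  rw [integral_finsetSum _ fun i _ => integrable_finsetSum _ fun j _ => (hint i j).const_mul _]
  simp only [dotProduct, Matrix.mulVec, Matrix.of_apply, Finset.mul_sum]
  refine Finset.sum_congr rfl fun i _ => ?_
  rw [integral_finsetSum _ fun j _ => (hint i j).const_mul _, Finset.mul_sum]
  refine Finset.sum_congr rfl fun j _ => ?_
  rw [integral_const_mul, setIntegral_mul_testFunctions (hφ i).2.2]
  ring

lemma posSemidef_gram {k : ℕ} {φ : Fin k → EuclideanSpace ℝ (Fin d) → ℝ}
    (hφ : ∀ i, IsTestFunction D (φ i)) {σ : ℝ} (hσ : 0 ≤ σ) :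
    (Matrix.of fun i j => σ * ∫ z in D, φ i z * φ j z).PosSemidef := by
  refine Matrix.PosSemidef.of_dotProduct_mulVec_nonneg ?_ fun x => ?_
  · ext i j
    simp [Matrix.conjTranspose_apply, mul_comm]
  · rw [star_trivial, dotProduct_gram_mulVec hφ]
    exact mul_nonneg hσ (integral_nonneg fun z => sq_nonneg _)

/-- Lévy's continuity theorem along the positive integers. -/
lemma tendsto_of_tendsto_charFun_pnat {E : Type*} [NormedAddCommGroup E] [InnerProductSpace ℝ E]
    [FiniteDimensional ℝ E] [MeasurableSpace E] [BorelSpace E] {ν : ℕ+ → ProbabilityMeasure E}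
    {ν₀ : ProbabilityMeasure E}
    (h : ∀ t : E, Tendsto (fun n => charFun (ν n : Measure E) t) atTop
      (𝓝 (charFun (ν₀ : Measure E) t))) : Tendsto ν atTop (𝓝 ν₀) := by
  have h1 : Tendsto (fun n : ℕ => ν (OrderIso.pnatIsoNat.symm n)) atTop (𝓝 ν₀) :=
    ProbabilityMeasure.tendsto_iff_tendsto_charFun.2 fun t =>
      (h t).comp OrderIso.pnatIsoNat.symm.tendsto_atTop
  refine (h1.comp OrderIso.pnatIsoNat.tendsto_atTop).congr fun n => ?_
  simp

end WhiteNoise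

/-! ### The central limit theorem for pattern fields -/

theorem theorem5p4 {d : ℕ} (hd : 1 ≤ d)
    (Λ : Submodule ℤ (EuclideanSpace ℝ (Fin d))) [DiscreteTopology Λ] [IsZLattice ℝ Λ]
    (Ω : Set (EuclideanSpace ℝ (Fin d))) (hΩ : IsPeriodicSet Λ Ω)
    (D : Set (EuclideanSpace ℝ (Fin d))) (hDo : IsOpen D) [SimplyConnectedSpace D]
    (hD0 : (0 : EuclideanSpace ℝ (Fin d)) ∈ D)
    -- the determinantal processes on `Ω_n` and the limiting one on `Ω`
    (Kn : ℕ+ → EuclideanSpace ℝ (Fin d) → EuclideanSpace ℝ (Fin d) → ℝ)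
    (μn : ∀ n : ℕ+, Measure (Set (sites Ω D n))) [∀ n, IsProbabilityMeasure (μn n)]
    (hKn : ∀ n, IsDeterminantal (μn n) (Kn n))
    (K : EuclideanSpace ℝ (Fin d) → EuclideanSpace ℝ (Fin d) → ℝ)
    (μ : Measure (Set Ω)) [IsProbabilityMeasure μ] (hK : IsDeterminantal μ K)
    (hconv : KernelsConverge Λ Ω D Kn K) (hdecay : KernelsDecay Ω D Kn)
    -- the periodic collection of disjoint patterns
    (P₀ : Finset (Pattern d)) (hP₀ : GeneratesDisjointPatterns Λ Ω P₀)
    (hlower : ∃ c : ℝ, 0 < c ∧ ∀ n : ℕ+, ∀ q ∈ patternsIn Λ P₀ Ω D n,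
      c ≤ (μn n).real (q.occurs (sites Ω D n))) :
    (∀ p ∈ P₀, Summable fun q : periodicPatterns Λ P₀ => p.cov μ q) ∧
      0 ≤ patternIntensity Λ P₀ μ ∧
      ConvergesToWhiteNoise D μn (fun n => rescaledField Λ P₀ Ω D n (μn n))
        (P₀.card / ZLattice.covolume Λ * patternIntensity Λ P₀ μ) := by
  have hsum := hconv.summable_cov hd hΩ hDo hD0 hKn hK hdecay hP₀
  have hnn := patternIntensity_nonneg hd hΩ hDo hD0 hKn hK hconv hdecay hP₀
  refine ⟨fun p hp => ?_, hnn, fun k φ hφ => ?_⟩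
  · have h1 := hsum.prod_factor ⟨p, hp⟩
    simp only [latticePattern_zero] at h1
    rw [← (patternEquiv hP₀).summable_iff]
    exact h1
  · set σ := P₀.card / ZLattice.covolume Λ * patternIntensity Λ P₀ μ with hσ
    have hσ0 : 0 ≤ σ :=
      mul_nonneg (div_nonneg (Nat.cast_nonneg _) (ZLattice.covolume_pos Λ volume).le) hnn
    have hmeas : ∀ n, Measurable fun s => WithLp.toLp 2 fun i =>
        rescaledField Λ P₀ Ω D n (μn n) (φ i) s := fun n =>
      (WithLp.measurable_toLp 2 (Fin k → ℝ)).comp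
        (measurable_pi_lambda _ fun i => (bddMeas_rescaledField hP₀ (hφ i).2.1 n).1)
    refine ⟨fun n => (hmeas n).aemeasurable, aemeasurable_id, ?_⟩
    -- The Cramér–Wold argument: the characteristic function of the vector at `t` is that of the
    -- field tested against `∑ t i * φ i`, evaluated at 1.
    refine tendsto_of_tendsto_charFun_pnat fun t => ?_
    obtain ⟨h1, h2, h3⟩ := IsTestFunction.sum hφ t
    have key := (tendsto_integral_exp_rescaledField hd hΩ hDo hD0 hKn hK hconv hdecay hP₀
      h1.continuous h2 h3).2
    simp only [ProbabilityMeasure.coe_mk, Measure.map_id]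
    rw [charFun_multivariateGaussian (posSemidef_gram hφ hσ0), dotProduct_gram_mulVec hφ]
    convert key using 1
    · ext n
      rw [charFun_apply, integral_map (hmeas n).aemeasurable (by fun_prop)]
      refine integral_congr_ae (Eventually.of_forall fun T => ?_)
      simp only [rescaledField_sum hP₀ (fun i => (hφ i).2.1), PiLp.inner_apply]
      rw [mul_comm]
      simp
    · simp [neg_div, hσ]
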